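/- **Setting.** Let $Y,T>0$, $l^2=[0,Y]\times[0,T]$, $N,n,m\in\mathbb Z_{\ge 0}$, and $$\mathcal L=\partial_y-L,\quad L=\sum_{i=0}^{n}a_i(x;y,t)\,\partial_x^i,\qquad \mathcal M=\partial_t-M,\quad M=\sum_{j=0}^{m}b_j(x;y,t)\,\partial_x^j ,$$ with $N\times N$ matrix coefficients in $C^1(l^2;C^\infty(\mathbb R))$ (in particular they may be in $C^1(l^2;\mathcal S(\mathbb R))$), where $g\in C^1(l^2;C^\infty(\mathbb R))$ means that all $x$-derivatives of $g$ exist and are jointly $C^1$ on $\mathbb R\times l^2$. Assume that the pair is compatible: $\mathcal L\mathcal M=\mathcal M\mathcal L$. Let $\rho$ be a finite measure on a measurable space $\Sigma$ (of spectral parameters), and let $\psi=\psi(\lambda)$, $\varphi=\varphi(\lambda)$, $\lambda\in\Sigma$, be families of $\mathbb C^N$-valued functions on $\mathbb R\times l^2$ which, as functions with values in $L_2^\rho(\Sigma)^N$, lie in $C^1(l^2;C^\infty(\mathbb R))$ and satisfy $\mathcal L\psi=\mathcal M\psi=0$ and $\mathcal L^*\varphi=\mathcal M^*\varphi=0$ with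 the formal adjoints $\mathcal L^*=-\partial_y-L^*$, $\mathcal M^*=-\partial_t-M^*$. Put $$Z_L[\varphi,\psi]=\sum_{i}\sum_{k<i}(-1)^k\,\partial_x^k(\bar\varphi^{\top}a_i)\;\partial_x^{i-1-k}\psi ,$$ so that $\partial_xZ_L[\varphi,\psi]=\bar\varphi^\top L\psi-\overline{(L^*\varphi)}^{\top}\psi$, and similarly $Z_M$. Let $\Omega(x;y,t)$ be bounded invertible operators on $L_2^\rho(\Sigma)$ with $$d\Omega=\bar\varphi^\top\psi\,dx+Z_L[\varphi,\psi]\,dy+Z_M[\varphi,\psi]\,dt\quad\text{on }\mathbb R\times l^2$$ (partial derivatives in operator norm; $\bar\varphi^\top\psi$ denotes the integral operator with kernel $\bar\varphi(\lambda)^\top\psi(\mu)$, and so on). Fix $P_0=(x_0;y_0,t_0)\in\mathbb R\times l^2$, let $\Omega_0=\Omega(P_0)$, $\tilde\psi=\psi\,\Omega^{-1}\Omega_0$, and let $$\mathbf\Omega=1-\tilde\psi\,\Omega_0^{-1}\,\partial^{-1}\bar\varphi^{\top},\qquad \partial^{-1}=\int_{x_0}^x dx ,$$ be the Delsarte–Darboux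 operator. Let $D$ be the space of $f\in C^1(l^2;C^\infty(\mathbb R;\mathbb C^N))$ whose $x$-derivatives of all orders vanish at $x=x_0$; on $D$ the operator $\partial_x$ is invertible with inverse $\partial^{-1}$. **Proposition 3.** The operator $\mathbf\Omega$ maps $D$ bijectively onto itself, and the dressed operators $\tilde{\mathcal L}=\mathbf\Omega\mathcal L\mathbf\Omega^{-1}$ and $\tilde{\mathcal M}=\mathbf\Omega\mathcal M\mathbf\Omega^{-1}$ are purely differential: there are $\tilde a_i,\tilde b_j\in C^1(l^2;C^\infty(\mathbb R;\mathrm{End}\,\mathbb C^N))$, uniquely determined, such that on $D$ $$\tilde{\mathcal L}=\partial_y-\tilde L,\quad \tilde L=\sum_{i=0}^{n}\tilde a_i\,\partial_x^i,\qquad \tilde{\mathcal M}=\partial_t-\tilde M,\quad \tilde M=\sum_{j=0}^{m}\tilde b_j\,\partial_x^j .$$ With the same coefficients, $\mathbf\Omega\mathcal Lf=\tilde{\mathcal L}\mathbf\Omega f$ holds for every $f\in C^1(l^2;C^\infty(\mathbb R;\mathbb C^N))$ for which $Z_L[\varphi,f]=0$ at $x=x_0$, and $\mathbf\Omega\mathcal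 Mf=\tilde{\mathcal M}\mathbf\Omega f$ for every such $f$ for which $Z_M[\varphi,f]=0$ at $x=x_0$. The orders are preserved, $\operatorname{ord}\tilde L=\operatorname{ord}L$ and $\operatorname{ord}\tilde M=\operatorname{ord}M$, and the dressed pair is again compatible, $\tilde{\mathcal L}\tilde{\mathcal M}=\tilde{\mathcal M}\tilde{\mathcal L}$. Hence $(a_i,b_j)\mapsto(\tilde a_i,\tilde b_j)$ is a Bäcklund–Darboux transformation: $(a_i,b_j)$ and $(\tilde a_i,\tilde b_j)$ both solve the nonlinear system $\partial_tL-\partial_yM+[L,M]=0$ (the derivatives acting on the coefficients). If moreover all $a_i,b_j$ lie in $C^1(l^2;\mathcal S(\mathbb R;\mathrm{End}\,\mathbb C^N))$ and all $x$-derivatives of $\varphi$, $\psi$ and $\Omega^{-1}$ grow at most polynomially in $x$, uniformly in $(y,t)$, then all $\tilde a_i,\tilde b_j$ lie in $C^1(l^2;\mathcal S(\mathbb R;\mathrm{End}\,\mathbb C^N))$. -/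

import Mathlib

open Set MeasureTheory
open scoped ContDiff

noncomputable section

namespace DelsarteDarboux

/-! ### Functions on `ℝ × [0,Y] × [0,T]`

A point is a triple `(x, y, t)`. A function on `ℝ × [0,Y] × [0,T]` is represented by a function on
all triples, of which only the values on `region Y T` matter. -/

/-- Points `(x, y, t)`. -/
abbrev Pt : Type := ℝ × ℝ × ℝ

/-- The domain `ℝ × [0,Y] × [0,T]`. -/
def region (Y T : ℝ) : Set Pt := univ ×ˢ (Icc 0 Y ×ˢ Icc 0 T)

section Derivatives

variable {E : Type*} [NormedAddCommGroup E] [NormedSpace ℝ E]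

/-- `∂ᵏ f / ∂xᵏ`. -/
def dX (k : ℕ) (f : Pt → E) (p : Pt) : E := iteratedDeriv k (fun x => f (x, p.2)) p.1

/-- `∂ f / ∂y`, one-sided at `y = 0` and `y = Y`. -/
def dY (Y : ℝ) (f : Pt → E) (p : Pt) : E :=
  derivWithin (fun y => f (p.1, y, p.2.2)) (Icc 0 Y) p.2.1

/-- `∂ f / ∂t`, one-sided at `t = 0` and `t = T`. -/
def dT (T : ℝ) (f : Pt → E) (p : Pt) : E :=
  derivWithin (fun t => f (p.1, p.2.1, t)) (Icc 0 T) p.2.2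

/-- `f ∈ C¹([0,Y] × [0,T]; C^∞(ℝ; E))`: all the `x`-derivatives of `f` are jointly `C¹` on the
domain (this includes that they exist). -/
def C1Smooth (Y T : ℝ) (f : Pt → E) : Prop :=
  ∀ k : ℕ, ContDiffOn ℝ 1 (dX k f) (region Y T)

/-- `f ∈ C¹([0,Y] × [0,T]; S(ℝ; E))`: moreover all Schwartz seminorms of `f(·, y, t)`,
`∂f/∂y(·, y, t)` and `∂f/∂t(·, y, t)` are bounded on the compact rectangle. Since all seminorms are
included, this gives the continuity of the three maps from the rectangle to the Schwartz space. -/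
def C1Schwartz (Y T : ℝ) (f : Pt → E) : Prop :=
  C1Smooth Y T f ∧ ∀ k m : ℕ, ∃ C : ℝ, ∀ p ∈ region Y T,
    |p.1| ^ m * ‖dX k f p‖ ≤ C ∧ |p.1| ^ m * ‖dX k (dY Y f) p‖ ≤ C ∧
      |p.1| ^ m * ‖dX k (dT T f) p‖ ≤ C

/-- Every `x`-derivative of `f` grows at most polynomially in `x`, uniformly in `(y, t)`. -/
def ModerateGrowth (Y T : ℝ) (f : Pt → E) : Prop :=
  ∀ k : ℕ, ∃ (C : ℝ) (m : ℕ), ∀ p ∈ region Y T, ‖dX k f p‖ ≤ C * (1 + |p.1|) ^ m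

end Derivatives

/-! ### Matrix differential expressions -/

/-- The coefficients `a₀, …, aₙ` of a matrix differential expression `∑ᵢ aᵢ(x; y, t) ∂ⁱ/∂xⁱ`. -/
abbrev Coeff (n N : ℕ) : Type := Fin (n + 1) → Pt → Matrix (Fin N) (Fin N) ℂ

/-- All matrix entries of all coefficients lie in `C¹([0,Y] × [0,T]; C^∞(ℝ; ℂ))`. -/
def SmoothCoeff (Y T : ℝ) {n N : ℕ} (a : Coeff n N) : Prop :=
  ∀ i r c, C1Smooth Y T (fun p => a i p r c)

/-- All matrix entries of all coefficients lie in `C¹([0,Y] × [0,T]; S(ℝ; ℂ))`. -/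
def SchwartzCoeff (Y T : ℝ) {n N : ℕ} (a : Coeff n N) : Prop :=
  ∀ i r c, C1Schwartz Y T (fun p => a i p r c)

section Operators

variable {E : Type*} [NormedAddCommGroup E] [NormedSpace ℂ E] {n N : ℕ}

/-- `L u = ∑ᵢ aᵢ ∂ⁱu/∂xⁱ` for columns `u` of length `N` with entries in a complex vector space
(complex numbers, or functions of the spectral parameter). -/
def diffOp (a : Coeff n N) (u : Pt → Fin N → E) (p : Pt) : Fin N → E := fun r =>
  ∑ i : Fin (n + 1), ∑ c : Fin N, a i p r c • dX (i : ℕ) u p c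

/-- The formal adjoint `L* u = ∑ᵢ (-1)ⁱ ∂ⁱ(aᵢᴴ u)/∂xⁱ`. -/
def adjOp (a : Coeff n N) (u : Pt → Fin N → E) (p : Pt) : Fin N → E :=
  ∑ i : Fin (n + 1), (-1 : ℂ) ^ (i : ℕ) •
    dX (i : ℕ) (fun q r => ∑ c : Fin N, (a i q).conjTranspose r c • u q c) p

/-- `𝓛 = ∂/∂y - L`. -/
def opY (Y : ℝ) (a : Coeff n N) (u : Pt → Fin N → E) (p : Pt) : Fin N → E :=
  dY Y u p - diffOp a u p

/-- `𝓜 = ∂/∂t - M`. -/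
def opT (T : ℝ) (b : Coeff n N) (u : Pt → Fin N → E) (p : Pt) : Fin N → E :=
  dT T u p - diffOp b u p

/-- `𝓛* = -∂/∂y - L*`. -/
def adjY (Y : ℝ) (a : Coeff n N) (u : Pt → Fin N → E) (p : Pt) : Fin N → E :=
  -dY Y u p - adjOp a u p

/-- `𝓜* = -∂/∂t - M*`. -/
def adjT (T : ℝ) (b : Coeff n N) (u : Pt → Fin N → E) (p : Pt) : Fin N → E :=
  -dT T u p - adjOp b u p

end Operators

section Compatibility

variable {n m N : ℕ}

/-- `𝓛 𝓜 = 𝓜 𝓛` as differential operators, that is, on all smooth functions. -/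
def Commuting (Y T : ℝ) (a : Coeff n N) (b : Coeff m N) : Prop :=
  ∀ f : Pt → Fin N → ℂ, ContDiff ℝ ∞ f → ∀ p ∈ region Y T,
    opY Y a (opT T b f) p = opT T b (opY Y a f) p

/-- The coefficient of `∂ᵏ`, which is zero above the order. -/
def coeffAt (a : Coeff n N) (k : ℕ) : Pt → Matrix (Fin N) (Fin N) ℂ :=
  if h : k < n + 1 then a ⟨k, h⟩ else 0

/-- The coefficient of `∂ᵏ` in the composition `L M`, from
`a ∂ⁱ ∘ b ∂ʲ = ∑ₗ (i choose l) a (∂ˡb/∂xˡ) ∂^(i + j - l)`. -/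
def compCoeff (a : Coeff n N) (b : Coeff m N) (k : ℕ) (p : Pt) : Matrix (Fin N) (Fin N) ℂ :=
  ∑ i : Fin (n + 1), ∑ j : Fin (m + 1), ∑ l ∈ Finset.range ((i : ℕ) + 1),
    if k + l = (i : ℕ) + (j : ℕ) then
      (((i : ℕ).choose l : ℕ) : ℂ) • (a i p * Matrix.of fun r c => dX l (fun q => b j q r c) p)
    else 0

/-- The Zakharov–Shabat system of nonlinear evolution equations for the coefficients:
`∂aₖ/∂t - ∂bₖ/∂y + [L, M]ₖ = 0` for every `k`. -/
def ZakharovShabat (Y T : ℝ) (a : Coeff n N) (b : Coeff m N) : Prop :=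
  ∀ k : ℕ, ∀ p ∈ region Y T,
    (Matrix.of fun r c => dT T (fun q => coeffAt a k q r c) p)
      - (Matrix.of fun r c => dY Y (fun q => coeffAt b k q r c) p)
      + (compCoeff a b k p - compCoeff b a k p) = 0

/-- The differential expression with coefficients `a` has order exactly `k` in `∂/∂x`. -/
def HasOrder (Y T : ℝ) (a : Coeff n N) (k : Fin (n + 1)) : Prop :=
  (∀ i, k < i → ∀ p ∈ region Y T, a i p = 0) ∧ ∃ p ∈ region Y T, a k p ≠ 0

end Compatibility

/-! ### The transmutation generator and the Delsarte–Darboux operator -/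

section Generator

variable {S : Type*} [MeasurableSpace S] {ρ : Measure S} {n m N : ℕ}

/-- The functional `g ↦ ∫ u g dρ` on `L²(ρ)`. -/
def row (u : Lp ℂ 2 ρ) : Lp ℂ 2 ρ →L[ℂ] ℂ := innerSL ℂ (star u)

theorem row_apply (u g : Lp ℂ 2 ρ) : row u g = ∫ s, u s * g s ∂ρ := by
  have h : row u g = ∫ s, inner ℂ ((star u : Lp ℂ 2 ρ) s) (g s) ∂ρ := rfl
  rw [h]
  refine integral_congr_ae ?_
  filter_upwards [Lp.coeFn_star u] with s hs
  rw [hs]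
  simp [mul_comm]

/-- The integral operator on `L²(ρ)` with kernel `v(λ) u(μ)`, that is
`g ↦ v · ∫ u(μ) g(μ) dρ(μ)`. -/
def tensor (v u : Lp ℂ 2 ρ) : Lp ℂ 2 ρ →L[ℂ] Lp ℂ 2 ρ := (row u).smulRight v

/-- The bilinear concomitant of `L = ∑ᵢ aᵢ ∂ⁱ`,
`Z[φ, ψ] = ∑ᵢ ∑_{k < i} (-1)ᵏ ∂ᵏ(φ̄ᵀ aᵢ) · ∂^(i-1-k) ψ`, for which
`φ̄ᵀ (L ψ) - (conj (L* φ))ᵀ ψ = ∂Z[φ, ψ]/∂x`. The products of the entries of the row `φ̄ᵀ aᵢ` and of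
the column `ψ` are formed with `B`. -/
def concomitant {E F : Type*} [NormedAddCommGroup E] [NormedSpace ℝ E] [AddCommGroup F]
    (B : Lp ℂ 2 ρ → E → F) (a : Coeff n N)
    (φ : Pt → Fin N → Lp ℂ 2 ρ) (ψ : Pt → Fin N → E) (p : Pt) : F :=
  ∑ i : Fin (n + 1), ∑ k ∈ Finset.range (i : ℕ), (-1 : ℤ) ^ k • ∑ c : Fin N,
    B (dX k (fun q d => ∑ r : Fin N, a i q r d • star (φ q r)) p c)
      (dX ((i : ℕ) - 1 - k) ψ p c)

/-- `Om` is a Delsarte transmutation generator for the solutions `φ`, `ψ`: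
`dΩ = φ̄ᵀψ dx + Z_L[φ, ψ] dy + Z_M[φ, ψ] dt` on `ℝ × [0,Y] × [0,T]`, where the right-hand sides
are the operators on `L²(ρ)` with kernels `(λ, μ) ↦ φ̄(λ)ᵀψ(μ)`, etc. -/
def IsGenerator (Y T : ℝ) (a : Coeff n N) (b : Coeff m N) (φ ψ : Pt → Fin N → Lp ℂ 2 ρ)
    (Om : Pt → Lp ℂ 2 ρ →L[ℂ] Lp ℂ 2 ρ) : Prop :=
  ∀ p ∈ region Y T,
    HasDerivAt (fun x => Om (x, p.2)) (∑ c : Fin N, tensor (star (φ p c)) (ψ p c)) p.1 ∧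
    HasDerivWithinAt (fun y => Om (p.1, y, p.2.2)) (concomitant tensor a φ ψ p)
      (Icc 0 Y) p.2.1 ∧
    HasDerivWithinAt (fun t => Om (p.1, p.2.1, t)) (concomitant tensor b φ ψ p)
      (Icc 0 T) p.2.2

/-- The transformed solution `ψ̃ = ψ Ω⁻¹ Ω₀`, as a column of functionals on `L²(ρ)`. -/
def psiTilde (ψ : Pt → Fin N → Lp ℂ 2 ρ) (Om : Pt → Lp ℂ 2 ρ →L[ℂ] Lp ℂ 2 ρ) (P₀ p : Pt) :
    Fin N → (Lp ℂ 2 ρ →L[ℂ] ℂ) := fun r =>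
  (row (ψ p r)).comp ((Ring.inverse (Om p)).comp (Om P₀))

/-- The Delsarte–Darboux operator `𝛀 = 1 - ψ̃ Ω₀⁻¹ ∂⁻¹ φ̄ᵀ`, where `Ω₀` is the value of `Ω` at the
point `P₀ = (x₀; y₀, t₀)` and `∂⁻¹` is the integration in `x` from `x₀`. -/
def delsarte (φ ψ : Pt → Fin N → Lp ℂ 2 ρ) (Om : Pt → Lp ℂ 2 ρ →L[ℂ] Lp ℂ 2 ρ) (P₀ : Pt)
    (f : Pt → Fin N → ℂ) (p : Pt) : Fin N → ℂ := fun r =>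
  f p r - psiTilde ψ Om P₀ p r (Ring.inverse (Om P₀)
    (∫ s in P₀.1..p.1, ∑ c : Fin N, f (s, p.2) c • star (φ (s, p.2) c)))

/-- The functions in `C¹([0,Y] × [0,T]; C^∞(ℝ; ℂᴺ))` whose `x`-derivatives of all orders vanish at
`x = x₀` (extended by zero outside the domain). On this space, which contains
`C¹([0,Y] × [0,T]; C_c^∞(ℝ ∖ {x₀}; ℂᴺ))`, `∂/∂x` is invertible and its inverse is the integration
from `x₀`. -/
def flatFunctions (Y T : ℝ) (N : ℕ) (x₀ : ℝ) : Set (Pt → Fin N → ℂ) :=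
  {f | C1Smooth Y T f ∧ (∀ p, p ∉ region Y T → f p = 0) ∧
    ∀ k : ℕ, ∀ p ∈ region Y T, p.1 = x₀ → dX k f p = 0}

/-- The functions in `C¹([0,Y] × [0,T]; C^∞(ℝ; ℂᴺ))` for which the boundary term `Z_L[φ, f]` at
`x = x₀` vanishes. -/
def lagrangeDomain (Y T : ℝ) (a : Coeff n N) (φ : Pt → Fin N → Lp ℂ 2 ρ) (x₀ : ℝ) :
    Set (Pt → Fin N → ℂ) :=
  {f | C1Smooth Y T f ∧ ∀ p ∈ region Y T, p.1 = x₀ →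
    concomitant (fun (v : Lp ℂ 2 ρ) (z : ℂ) => z • v) a φ f p = 0}

end Generator

/-- `W A f = A' W f` on `ℝ × [0,Y] × [0,T]` for all `f ∈ D`. If `W` maps `D` bijectively onto
itself, this says that `A' = W A W⁻¹` on `D`. -/
def Intertwines (Y T : ℝ) {N : ℕ} (W A A' : (Pt → Fin N → ℂ) → Pt → Fin N → ℂ)
    (D : Set (Pt → Fin N → ℂ)) : Prop :=
  ∀ f ∈ D, ∀ p ∈ region Y T, W (A f) p = A' (W f) p

end DelsarteDarboux

end

/-!
The Delsarte–Darboux operator does not depend on the point `P₀` beyond `x₀`: the factors `Ω₀` cancel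
and `𝛀 f = f - Ψ Ω⁻¹ u` with `u = ∂⁻¹(φ̄ᵀ f)`, where `Ψ` is the column of the functionals given by
`ψ`. Everything follows from this formula, for data `Φ = φ̄ᵀ`, `Ψ`, `Ω` in an arbitrary complex
Banach space (`Dressing`, `Evolves`); the space `L²(ρ)` enters only at the end.

*Inversion.* Let `g = 𝛀 f` and `v = Ω⁻¹ u`. From `∂Ω/∂x = φ̄ᵀψ` one gets `∂v/∂x = Ω⁻¹ φ̄ᵀ g`, and
`v` vanishes at `x = x₀`. So `f = g + Ψ ∂⁻¹(Ω⁻¹ φ̄ᵀ g)`, which is an explicit inverse of `𝛀`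
(`Dressing.undress_dress`, `Dressing.dress_undress`).

*Intertwining.* Differentiation of `f = g + Ψ v` gives `∂ʲf = Pⱼ g + (∂ʲΨ) v` with differential
expressions `Pⱼ` (`dX_eq_dressPow`). By the Lagrange identity,
`∂⁻¹(φ̄ᵀ 𝓛 f) = ∂u/∂y - Z_L[φ, f]` when `Z_L[φ, f] = 0` at `x₀` (`Dressing.potential_opD`). Therefore
the derivative of `u` cancels in `∂(𝛀 f)/∂y - 𝛀 𝓛 f`, and there remains
`L f - (LΨ) v - Ψ Ω⁻¹ (Z_L[φ, f] - Z_L[φ, ψ] v)`. This contains the derivatives of `f` and of `Ψ`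
only in the combinations `∂ʲf - (∂ʲΨ) v = Pⱼ g`, so it is a differential expression in `g`, whose
coefficients are `dressCoeff` (`Dressing.diffOp_dressCoeff`, `Dressing.dress_opD`).
The nonlocal term has order less than that of the local one, so that the top coefficient is
unchanged.

*Coefficients.* A smooth function of `x` may have any jet at a point with `x ≠ x₀` and be flat at
`x₀`. A differential expression that annihilates such functions has vanishing coefficients for `x ≠ x₀`,
and by continuity everywhere. This gives the uniqueness. It also gives the compatibility: the
commutator of two evolution operators is a differential expression in `x` with the coefficients of
`∂L/∂t - ∂M/∂y + [L, M]` (`commutator_eq`), and on the range of `𝛀` the commutator of the dressed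
operators is the transform of that of the original ones.

*Regularity.* Smoothness, flatness at `x₀`, polynomial growth and rapid decay are treated together
through classes of functions closed under domination (`Growth`): each rule for sums, products and
inverses is proved once, for functions all of whose `x`-derivatives are of a given class. For the
Schwartz class one needs in addition that the growth hypotheses, which concern `x`-derivatives only,
extend to the `y`- and `t`-derivatives, which the evolution equations express by `x`-derivatives
(`c1X_of_evolves`).
-/

namespace DelsarteDarboux

/-! ### Two facts on functions of two real variables -/

section Calculus

open Filter Topology

variable {E : Type*} [NormedAddCommGroup E] [NormedSpace ℝ E]

/-- The mean value inequality for `z ↦ h z - z • c`. -/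
theorem norm_sub_sub_smul_le {h h' : ℝ → E} {s : Set ℝ} (hs : Convex ℝ s) {a b : ℝ} (ha : a ∈ s)
    (hb : b ∈ s) (c : E) {ε : ℝ} (hd : ∀ z ∈ s, HasDerivWithinAt h (h' z) s z)
    (hε : ∀ z ∈ s, |z - a| ≤ |b - a| → ‖h' z - c‖ ≤ ε) :
    ‖h b - h a - (b - a) • c‖ ≤ ε * |b - a| := by
  have hsub : uIcc a b ⊆ s := by
    rw [← segment_eq_uIcc]; exact hs.segment_subset ha hb
  have key := (convex_uIcc a b).norm_image_sub_le_of_norm_hasDerivWithin_le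
    (f := fun z => h z - z • c) (f' := fun z => h' z - c) (C := ε) (x := a) (y := b)
    (fun z hz => by
      have h1 := (hd z (hsub hz)).mono hsub
      have h2 := ((hasDerivAt_id z).smul_const c).hasDerivWithinAt (s := uIcc a b)
      simpa using h1.fun_sub h2)
    (fun z hz => hε z (hsub hz) (abs_sub_left_of_mem_uIcc hz)) left_mem_uIcc right_mem_uIcc
  have e : h b - h a - (b - a) • c = (h b - b • c) - (h a - a • c) := by
    rw [sub_smul]; abel
  rw [e]; simpa using key

/-- Interchange of mixed partial derivatives on a rectangle `s × t`: only one of the two mixed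
derivatives has to exist and to be continuous. -/
theorem hasDerivWithinAt_of_mixed {g g₁ g₂ g₁₂ : ℝ → ℝ → E} {s t : Set ℝ} (hs : Convex ℝ s)
    (ht : Convex ℝ t) (htn : t.Nontrivial)
    (h₁ : ∀ x ∈ s, ∀ y ∈ t, HasDerivWithinAt (fun x => g x y) (g₁ x y) s x)
    (h₁₂ : ∀ x ∈ s, ∀ y ∈ t, HasDerivWithinAt (fun y => g₁ x y) (g₁₂ x y) t y)
    (h₂ : ∀ x ∈ s, ∀ y ∈ t, HasDerivWithinAt (fun y => g x y) (g₂ x y) t y)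
    (hc : ContinuousOn (fun q : ℝ × ℝ => g₁₂ q.1 q.2) (s ×ˢ t))
    {x₀ y₀ : ℝ} (hx₀ : x₀ ∈ s) (hy₀ : y₀ ∈ t) :
    HasDerivWithinAt (fun x => g₂ x y₀) (g₁₂ x₀ y₀) s x₀ := by
  rw [hasDerivWithinAt_iff_isLittleO, Asymptotics.isLittleO_iff]
  intro ε hε
  obtain ⟨δ, hδ, hball⟩ := Metric.continuousOn_iff.1 hc (x₀, y₀) ⟨hx₀, hy₀⟩ ε hε
  have hev : ∀ᶠ x in 𝓝[s] x₀, x ∈ s ∧ |x - x₀| < δ := by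
    filter_upwards [self_mem_nhdsWithin, mem_nhdsWithin_of_mem_nhds (Metric.ball_mem_nhds x₀ hδ)]
      with x h1 h2 using ⟨h1, by simpa [Real.dist_eq] using h2⟩
  filter_upwards [hev] with x ⟨hx, hxδ⟩
  -- the second difference of `g`, divided by `y - y₀`, is controlled by `g₁₂`
  have hdiff : ∀ y ∈ t, |y - y₀| < δ →
      ‖(g x y - g x₀ y) - (g x y₀ - g x₀ y₀) - (x - x₀) • (y - y₀) • g₁₂ x₀ y₀‖
        ≤ ε * |y - y₀| * |x - x₀| := by
    intro y hy hyδ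
    have := norm_sub_sub_smul_le (h := fun z => g z y - g z y₀)
      (h' := fun z => g₁ z y - g₁ z y₀) hs hx₀ hx ((y - y₀) • g₁₂ x₀ y₀) (ε := ε * |y - y₀|)
      (fun z hz => (h₁ z hz y hy).sub (h₁ z hz y₀ hy₀))
      (fun z hz hzx => norm_sub_sub_smul_le (h := fun w => g₁ z w) (h' := fun w => g₁₂ z w)
        ht hy₀ hy _ (fun w hw => h₁₂ z hz w hw) (fun w hw hwy => by
          have := hball (z, w) ⟨hz, hw⟩ (by
            rw [Prod.dist_eq, Real.dist_eq, Real.dist_eq]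
            exact max_lt (hzx.trans_lt hxδ) (hwy.trans_lt hyδ))
          rw [← dist_eq_norm]; exact this.le))
    have e : (g x y - g x₀ y) - (g x y₀ - g x₀ y₀) = (g x y - g x y₀) - (g x₀ y - g x₀ y₀) := by
      abel
    rw [e]; exact this
  have hne : (𝓝[t \ {y₀}] y₀).NeBot := by
    have hu : AccPt y₀ (𝓟 t) := (ht.isPreconnected).preperfect_of_nontrivial htn y₀ hy₀
    rw [accPt_principal_iff_nhdsWithin] at hu
    exact hu
  have hlim : Tendsto (fun y => slope (fun y => g x y) y₀ y - slope (fun y => g x₀ y) y₀ y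
      - (x - x₀) • g₁₂ x₀ y₀) (𝓝[t \ {y₀}] y₀)
      (𝓝 (g₂ x y₀ - g₂ x₀ y₀ - (x - x₀) • g₁₂ x₀ y₀)) :=
    ((hasDerivWithinAt_iff_tendsto_slope.1 (h₂ x hx y₀ hy₀)).sub
      (hasDerivWithinAt_iff_tendsto_slope.1 (h₂ x₀ hx₀ y₀ hy₀))).sub tendsto_const_nhds
  rw [Real.norm_eq_abs]
  refine le_of_tendsto hlim.norm ?_
  filter_upwards [self_mem_nhdsWithin, mem_nhdsWithin_of_mem_nhds (Metric.ball_mem_nhds y₀ hδ)]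
    with y h1 h2
  have hyne : y - y₀ ≠ 0 := sub_ne_zero.2 h1.2
  have h3 := hdiff y h1.1 (by simpa [Real.dist_eq] using h2)
  have e : slope (fun y => g x y) y₀ y - slope (fun y => g x₀ y) y₀ y - (x - x₀) • g₁₂ x₀ y₀
      = (y - y₀)⁻¹ •
        ((g x y - g x₀ y) - (g x y₀ - g x₀ y₀) - (x - x₀) • (y - y₀) • g₁₂ x₀ y₀) := by
    simp only [slope_def_module, smul_sub]
    rw [smul_comm (x - x₀) (y - y₀), inv_smul_smul₀ hyne]
    abel
  rw [e, norm_smul, norm_inv, Real.norm_eq_abs, inv_mul_le_iff₀ (abs_pos.2 hyne)]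
  linarith

/-- Differentiation under the integral sign over a compact interval, one-sided at the boundary of
the parameter set `s`. -/
theorem hasDerivWithinAt_intervalIntegral {h h' : ℝ → ℝ → E} {a b : ℝ} {s : Set ℝ}
    (hs : Convex ℝ s) (hcont : ∀ y ∈ s, Continuous fun x => h x y)
    (hd : ∀ x, ∀ y ∈ s, HasDerivWithinAt (fun y => h x y) (h' x y) s y)
    (hc : ContinuousOn (fun q : ℝ × ℝ => h' q.2 q.1) (s ×ˢ univ)) {y₀ : ℝ} (hy₀ : y₀ ∈ s) :
    HasDerivWithinAt (fun y => ∫ x in a..b, h x y) (∫ x in a..b, h' x y₀) s y₀ := by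
  rw [hasDerivWithinAt_iff_isLittleO, Asymptotics.isLittleO_iff]
  intro ε hε
  have hε' : 0 < ε / (|b - a| + 1) := by positivity
  obtain ⟨v, hv, hvu⟩ := isCompact_uIcc.mem_uniformity_of_prod (f := fun y x => h' x y)
    (k := uIcc a b) (hc.mono (prod_mono_right (subset_univ _))) hy₀ (Metric.dist_mem_uniformity hε')
  obtain ⟨δ, hδ, hδv⟩ := Metric.mem_nhdsWithin_iff.1 hv
  have hc' : Continuous fun x => h' x y₀ :=
    continuousOn_univ.1 (hc.comp (by fun_prop : ContinuousOn (fun x : ℝ => (y₀, x)) univ)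
      fun x _ => ⟨hy₀, mem_univ _⟩)
  filter_upwards [self_mem_nhdsWithin, mem_nhdsWithin_of_mem_nhds (Metric.ball_mem_nhds y₀ hδ)]
    with y hy hyδ
  have hyδ' : |y - y₀| < δ := by simpa [Real.dist_eq] using hyδ
  have e : (∫ x in a..b, h x y) - (∫ x in a..b, h x y₀) - (y - y₀) • ∫ x in a..b, h' x y₀
      = ∫ x in a..b, (h x y - h x y₀ - (y - y₀) • h' x y₀) := by
    rw [intervalIntegral.integral_sub, intervalIntegral.integral_sub,
      intervalIntegral.integral_smul]
    · exact (hcont y hy).intervalIntegrable _ _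
    · exact (hcont y₀ hy₀).intervalIntegrable _ _
    · exact ((hcont y hy).sub (hcont y₀ hy₀)).intervalIntegrable _ _
    · exact (hc'.const_smul _).intervalIntegrable _ _
  rw [e]
  have hb := intervalIntegral.norm_integral_le_of_norm_le_const (a := a) (b := b)
    (f := fun x => h x y - h x y₀ - (y - y₀) • h' x y₀) (C := ε / (|b - a| + 1) * |y - y₀|)
    (fun x hx => norm_sub_sub_smul_le hs hy₀ hy _ (fun z hz => hd x z hz) (fun z hz hzy => by
      have := hvu z (hδv ⟨by simpa [Real.dist_eq] using hzy.trans_lt hyδ', hz⟩) x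
        (uIoc_subset_uIcc hx)
      rw [← dist_eq_norm]; exact le_of_lt this))
  refine hb.trans ?_
  rw [Real.norm_eq_abs]
  have h1 : |b - a| / (|b - a| + 1) ≤ 1 := by
    rw [div_le_one (by positivity)]; linarith
  calc ε / (|b - a| + 1) * |y - y₀| * |b - a|
      = ε * |y - y₀| * (|b - a| / (|b - a| + 1)) := by ring
    _ ≤ ε * |y - y₀| * 1 := by gcongr
    _ = ε * |y - y₀| := by ring

end Calculus

/-! ### Growth classes -/

/-- A class of functions on `ℝ × [0,Y] × [0,T]` that is closed under sums and under domination.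
It is used to impose a common condition on the norms of all `x`-derivatives of a function: vanishing
on a given set, moderate growth, or rapid decay. -/
structure Growth (Y T : ℝ) where
  mem : (Pt → ℝ) → Prop
  of_le : ∀ {f g : Pt → ℝ} (C : ℝ), mem g → (∀ p ∈ region Y T, |f p| ≤ C * |g p|) → mem f
  add : ∀ {f g : Pt → ℝ}, mem f → mem g → mem fun p => |f p| + |g p|
  zero : mem fun _ => 0

/-- Multiplication by functions of class `ν` preserves the class `κ`. -/
def Growth.Acts {Y T : ℝ} (ν κ : Growth Y T) : Prop :=
  ∀ f g : Pt → ℝ, ν.mem f → κ.mem g → κ.mem fun p => f p * g p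

namespace Growth

variable {Y T : ℝ}

/-- The functions that vanish on `A`. -/
def vanishing (Y T : ℝ) (A : Set Pt) : Growth Y T where
  mem f := ∀ p ∈ region Y T, p ∈ A → f p = 0
  of_le C hg h p hp hA := by simpa [hg p hp hA] using h p hp
  add hf hg p hp hA := by simp [hf p hp hA, hg p hp hA]
  zero := fun _ _ _ => rfl

/-- The class without any condition. -/
def free (Y T : ℝ) : Growth Y T := vanishing Y T ∅

theorem free_mem (f : Pt → ℝ) : (free Y T).mem f := fun _ _ h => h.elim

theorem acts_vanishing (ν : Growth Y T) (A : Set Pt) : ν.Acts (vanishing Y T A) :=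
  fun f g _ hg p hp hA => by simp [hg p hp hA]

theorem acts_free (ν : Growth Y T) : ν.Acts (free Y T) := acts_vanishing ν ∅

/-- The functions of at most polynomial growth in `x`. -/
def moderate (Y T : ℝ) : Growth Y T where
  mem f := ∃ (C : ℝ) (m : ℕ), ∀ p ∈ region Y T, |f p| ≤ C * (1 + |p.1|) ^ m
  of_le := by
    rintro f g C ⟨C', m, hg⟩ h
    refine ⟨|C| * C', m, fun p hp => (h p hp).trans ?_⟩
    calc C * |g p| ≤ |C| * |g p| := by gcongr; exact le_abs_self C
      _ ≤ |C| * (C' * (1 + |p.1|) ^ m) := by gcongr; exact hg p hp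
      _ = _ := by ring
  add := by
    rintro f g ⟨C, m, hf⟩ ⟨C', m', hg⟩
    refine ⟨|C| + |C'|, m + m', fun p hp => ?_⟩
    have h1 : (1 : ℝ) ≤ 1 + |p.1| := by linarith [abs_nonneg p.1]
    have e1 : C * (1 + |p.1|) ^ m ≤ |C| * (1 + |p.1|) ^ (m + m') := by
      gcongr
      · exact le_abs_self C
      · omega
    have e2 : C' * (1 + |p.1|) ^ m' ≤ |C'| * (1 + |p.1|) ^ (m + m') := by
      gcongr
      · exact le_abs_self C'
      · omega
    rw [abs_of_nonneg (by positivity), add_mul]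
    linarith [hf p hp, hg p hp]
  zero := ⟨0, 0, by simp⟩

/-- The functions that decay faster than any power of `x`. -/
def rapid (Y T : ℝ) : Growth Y T where
  mem f := ∀ m : ℕ, ∃ C : ℝ, ∀ p ∈ region Y T, (1 + |p.1|) ^ m * |f p| ≤ C
  of_le := by
    intro f g C hg h m
    obtain ⟨C', hC'⟩ := hg m
    refine ⟨|C| * C', fun p hp => ?_⟩
    calc (1 + |p.1|) ^ m * |f p| ≤ (1 + |p.1|) ^ m * (|C| * |g p|) := by
          gcongr
          exact (h p hp).trans (by gcongr; exact le_abs_self C)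
      _ = |C| * ((1 + |p.1|) ^ m * |g p|) := by ring
      _ ≤ |C| * C' := by gcongr; exact hC' p hp
  add := by
    intro f g hf hg m
    obtain ⟨C, hC⟩ := hf m
    obtain ⟨C', hC'⟩ := hg m
    refine ⟨C + C', fun p hp => ?_⟩
    rw [abs_of_nonneg (a := |f p| + |g p|) (by positivity), mul_add]
    exact add_le_add (hC p hp) (hC' p hp)
  zero := fun m => ⟨0, by simp⟩

theorem moderate_acts_moderate : (moderate Y T).Acts (moderate Y T) := by
  rintro f g ⟨C, m, hf⟩ ⟨C', m', hg⟩
  refine ⟨C * C', m + m', fun p hp => ?_⟩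
  rw [abs_mul, pow_add]
  calc |f p| * |g p| ≤ (C * (1 + |p.1|) ^ m) * (C' * (1 + |p.1|) ^ m') :=
        mul_le_mul (hf p hp) (hg p hp) (abs_nonneg _) ((abs_nonneg _).trans (hf p hp))
    _ = _ := by ring

theorem moderate_acts_rapid : (moderate Y T).Acts (rapid Y T) := by
  rintro f g ⟨C, m, hf⟩ hg l
  obtain ⟨C', hC'⟩ := hg (m + l)
  refine ⟨|C| * C', fun p hp => ?_⟩
  rw [abs_mul]
  calc (1 + |p.1|) ^ l * (|f p| * |g p|)
      ≤ (1 + |p.1|) ^ l * ((|C| * (1 + |p.1|) ^ m) * |g p|) := by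
        gcongr
        exact (hf p hp).trans (by gcongr; exact le_abs_self C)
    _ = |C| * ((1 + |p.1|) ^ (m + l) * |g p|) := by ring
    _ ≤ |C| * C' := by gcongr; exact hC' p hp

theorem moderate_of_rapid {f : Pt → ℝ} (hf : (rapid Y T).mem f) : (moderate Y T).mem f := by
  obtain ⟨C, hC⟩ := hf 0
  exact ⟨C, 0, fun p hp => by simpa using hC p hp⟩

theorem norm_congr {E : Type*} [Norm E] {κ : Growth Y T} {f g : Pt → E}
    (h : EqOn f g (region Y T)) (hg : κ.mem fun p => ‖g p‖) : κ.mem fun p => ‖f p‖ :=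
  κ.of_le 1 hg fun p hp => by rw [h hp, one_mul]

theorem moderate_const (C : ℝ) : (moderate Y T).mem fun _ => C :=
  ⟨|C|, 0, fun p _ => by simp⟩

end Growth

/-! ### The `x`-derivatives -/

section XDerivatives

variable {E F G : Type*} [NormedAddCommGroup E] [NormedSpace ℝ E] [NormedAddCommGroup F]
  [NormedSpace ℝ F] [NormedAddCommGroup G] [NormedSpace ℝ G] {Y T : ℝ}

theorem line_mem_region {p : Pt} (hp : p ∈ region Y T) (x : ℝ) : (x, p.2) ∈ region Y T :=
  ⟨mem_univ _, hp.2⟩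

theorem dX_zero (f : Pt → E) : dX 0 f = f := by ext p; simp [dX]

theorem dX_succ (k : ℕ) (f : Pt → E) : dX (k + 1) f = dX k (dX 1 f) := by
  ext p
  simp only [dX, iteratedDeriv_succ']
  rfl

theorem dX_one_dX (k : ℕ) (f : Pt → E) : dX 1 (dX k f) = dX (k + 1) f := by
  ext p
  simp only [dX, iteratedDeriv_succ]
  rfl

theorem dX_dX (j k : ℕ) (f : Pt → E) : dX j (dX k f) = dX (j + k) f := by
  induction j generalizing k f with
  | zero => rw [dX_zero, Nat.zero_add]
  | succ j ih => rw [dX_succ j, dX_one_dX, ih, show j + (k + 1) = j + 1 + k by omega]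

theorem HasDerivAt.dX_one_eq {f : Pt → E} {f' : E} {p : Pt}
    (h : HasDerivAt (fun x => f (x, p.2)) f' p.1) : dX 1 f p = f' := by
  rw [dX, iteratedDeriv_one]; exact h.deriv

theorem dX_congr {f g : Pt → E} (h : EqOn f g (region Y T)) (k : ℕ) :
    EqOn (dX k f) (dX k g) (region Y T) := by
  intro p hp
  have : (fun x => f (x, p.2)) = fun x => g (x, p.2) :=
    funext fun x => h (line_mem_region hp x)
  simp only [dX, this]

/-- `f` is `n` times differentiable in `x`, with jointly continuous `x`-derivatives of class `κ`. -/
def XSmoothUpTo (κ : Growth Y T) : ℕ → (Pt → E) → Prop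
  | 0, f => ContinuousOn f (region Y T) ∧ κ.mem fun p => ‖f p‖
  | n + 1, f => (ContinuousOn f (region Y T) ∧ κ.mem fun p => ‖f p‖) ∧
      (∀ p ∈ region Y T, DifferentiableAt ℝ (fun x => f (x, p.2)) p.1) ∧
      XSmoothUpTo κ n (dX 1 f)

/-- `f` is smooth in `x`, with jointly continuous `x`-derivatives of class `κ`. -/
def XSmooth (κ : Growth Y T) (f : Pt → E) : Prop := ∀ n, XSmoothUpTo κ n f

variable {κ ν : Growth Y T} {f g : Pt → E}

namespace XSmoothUpTo

theorem congr {n : ℕ} (hf : XSmoothUpTo κ n f) (h : EqOn g f (region Y T)) :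
    XSmoothUpTo κ n g := by
  induction n generalizing f g with
  | zero => exact ⟨hf.1.congr h, κ.norm_congr h hf.2⟩
  | succ n ih =>
    refine ⟨⟨hf.1.1.congr h, κ.norm_congr h hf.1.2⟩, fun p hp => ?_, ih hf.2.2 (dX_congr h 1)⟩
    have e : (fun x => g (x, p.2)) = fun x => f (x, p.2) :=
      funext fun x => h (line_mem_region hp x)
    rw [e]; exact hf.2.1 p hp

theorem of_succ {n : ℕ} (hf : XSmoothUpTo κ (n + 1) f) : XSmoothUpTo κ n f := by
  induction n generalizing f with
  | zero => exact hf.1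
  | succ n ih => exact ⟨hf.1, hf.2.1, ih hf.2.2⟩

theorem hasDerivAt {n : ℕ} (hf : XSmoothUpTo κ (n + 1) f) {p : Pt} (hp : p ∈ region Y T) :
    HasDerivAt (fun x => f (x, p.2)) (dX 1 f p) p.1 := by
  rw [dX, iteratedDeriv_one]
  exact (hf.2.1 p hp).hasDerivAt

theorem succ {n : ℕ} {f' : Pt → E} (hc : ContinuousOn f (region Y T)) (hm : κ.mem fun p => ‖f p‖)
    (hd : ∀ p ∈ region Y T, HasDerivAt (fun x => f (x, p.2)) (f' p) p.1)
    (hf' : XSmoothUpTo κ n f') : XSmoothUpTo κ (n + 1) f :=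
  ⟨⟨hc, hm⟩, fun p hp => (hd p hp).differentiableAt,
    hf'.congr fun p hp => HasDerivAt.dX_one_eq (hd p hp)⟩

theorem add {n : ℕ} (hf : XSmoothUpTo κ n f) (hg : XSmoothUpTo κ n g) :
    XSmoothUpTo κ n fun p => f p + g p := by
  have base : ∀ {f g : Pt → E}, (ContinuousOn f (region Y T) ∧ κ.mem fun p => ‖f p‖) →
      (ContinuousOn g (region Y T) ∧ κ.mem fun p => ‖g p‖) →
      (ContinuousOn (fun p => f p + g p) (region Y T) ∧ κ.mem fun p => ‖f p + g p‖) :=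
    fun hf hg => ⟨hf.1.add hg.1, κ.of_le 1 (κ.add hf.2 hg.2) fun p _ => by
      rw [one_mul, abs_norm, abs_norm, abs_norm, abs_of_nonneg (by positivity)]
      exact norm_add_le _ _⟩
  induction n generalizing f g with
  | zero => exact base hf hg
  | succ n ih =>
    exact succ (base hf.1 hg.1).1 (base hf.1 hg.1).2
      (fun p hp => (hf.hasDerivAt hp).add (hg.hasDerivAt hp)) (ih hf.2.2 hg.2.2)

theorem clm {n : ℕ} (A : E →L[ℝ] F) (hf : XSmoothUpTo κ n f) :
    XSmoothUpTo κ n fun p => A (f p) := by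
  have base : ∀ {f : Pt → E}, (ContinuousOn f (region Y T) ∧ κ.mem fun p => ‖f p‖) →
      (ContinuousOn (fun p => A (f p)) (region Y T) ∧ κ.mem fun p => ‖A (f p)‖) :=
    fun hf => ⟨A.continuous.comp_continuousOn hf.1, κ.of_le ‖A‖ hf.2 fun p _ => by
      rw [abs_norm, abs_norm]; exact A.le_opNorm _⟩
  induction n generalizing f with
  | zero => exact base hf
  | succ n ih =>
    exact succ (base hf.1).1 (base hf.1).2
      (fun p hp => A.hasFDerivAt.comp_hasDerivAt _ (hf.hasDerivAt hp)) (ih hf.2.2)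

theorem bilin {n : ℕ} {m : E → F → G} (hm : IsBoundedBilinearMap ℝ fun q : E × F => m q.1 q.2)
    (hνκ : ν.Acts κ) {g : Pt → F} (hf : XSmoothUpTo ν n f) (hg : XSmoothUpTo κ n g) :
    XSmoothUpTo κ n fun p => m (f p) (g p) := by
  have base : ∀ {f : Pt → E} {g : Pt → F},
      (ContinuousOn f (region Y T) ∧ ν.mem fun p => ‖f p‖) →
      (ContinuousOn g (region Y T) ∧ κ.mem fun p => ‖g p‖) →
      (ContinuousOn (fun p => m (f p) (g p)) (region Y T) ∧ κ.mem fun p => ‖m (f p) (g p)‖) :=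
    fun {f g} hf hg => ⟨hm.continuous.comp_continuousOn (hf.1.prodMk hg.1), by
      obtain ⟨C, _, hC⟩ := hm.bound
      refine κ.of_le C (hνκ _ _ hf.2 hg.2) fun p _ => ?_
      rw [abs_norm, abs_of_nonneg (by positivity), ← mul_assoc]
      exact hC _ _⟩
  induction n generalizing f g with
  | zero => exact base hf hg
  | succ n ih =>
    refine succ (base hf.1 hg.1).1 (base hf.1 hg.1).2 (fun p hp => ?_)
      ((ih hf.of_succ hg.2.2).add (ih hf.2.2 hg.of_succ))
    exact hm.toContinuousLinearMap.hasDerivAt_of_bilinear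
      (fun _ => hf.hasDerivAt hp) (fun _ => hg.hasDerivAt hp)

end XSmoothUpTo

namespace XSmooth

theorem continuousOn (hf : XSmooth κ f) : ContinuousOn f (region Y T) := (hf 0).1

theorem mem (hf : XSmooth κ f) : κ.mem fun p => ‖f p‖ := (hf 0).2

theorem congr (hf : XSmooth κ f) (h : EqOn g f (region Y T)) : XSmooth κ g :=
  fun n => (hf n).congr h

theorem dX (hf : XSmooth κ f) (k : ℕ) : XSmooth κ (dX k f) := by
  induction k generalizing f with
  | zero => rwa [dX_zero]
  | succ k ih => rw [dX_succ]; exact ih fun n => (hf (n + 1)).2.2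

theorem hasDerivAt (hf : XSmooth κ f) {p : Pt} (hp : p ∈ region Y T) :
    HasDerivAt (fun x => f (x, p.2)) (DelsarteDarboux.dX 1 f p) p.1 := (hf 1).hasDerivAt hp

theorem hasDerivAt_dX (hf : XSmooth κ f) (k : ℕ) {p : Pt} (hp : p ∈ region Y T) :
    HasDerivAt (fun x => DelsarteDarboux.dX k f (x, p.2)) (DelsarteDarboux.dX (k + 1) f p) p.1 := by
  rw [← dX_one_dX]; exact (hf.dX k).hasDerivAt hp

theorem of_hasDerivAt {f' : Pt → E} (hc : ContinuousOn f (region Y T)) (hm : κ.mem fun p => ‖f p‖)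
    (hd : ∀ p ∈ region Y T, HasDerivAt (fun x => f (x, p.2)) (f' p) p.1) (hf' : XSmooth κ f') :
    XSmooth κ f
  | 0 => ⟨hc, hm⟩
  | n + 1 => XSmoothUpTo.succ hc hm hd (hf' n)

theorem of_dX (hc : ∀ k, ContinuousOn (DelsarteDarboux.dX k f) (region Y T))
    (hm : ∀ k, κ.mem fun p => ‖DelsarteDarboux.dX k f p‖)
    (hd : ∀ k, ∀ p ∈ region Y T,
      DifferentiableAt ℝ (fun x => DelsarteDarboux.dX k f (x, p.2)) p.1) : XSmooth κ f := by
  intro n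
  induction n generalizing f with
  | zero => exact ⟨dX_zero f ▸ hc 0, by simpa only [dX_zero] using hm 0⟩
  | succ n ih =>
    refine ⟨⟨dX_zero f ▸ hc 0, by simpa only [dX_zero] using hm 0⟩,
      by simpa only [dX_zero] using hd 0, ih ?_ ?_ ?_⟩ <;>
    · intro k
      rw [← dX_succ]
      first
        | exact hc (k + 1)
        | exact hm (k + 1)
        | exact hd (k + 1)

theorem contDiff (hf : XSmooth κ f) {p : Pt} (hp : p ∈ region Y T) :
    ContDiff ℝ ∞ fun x => f (x, p.2) :=
  contDiff_of_differentiable_iteratedDeriv fun m _ x =>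
    ((hf.hasDerivAt_dX m (line_mem_region hp x))).differentiableAt

theorem contDiffAt (hf : XSmooth κ f) {p : Pt} (hp : p ∈ region Y T) {n : ℕ} {x : ℝ} :
    ContDiffAt ℝ n (fun x => f (x, p.2)) x :=
  ((hf.contDiff hp).of_le (mod_cast le_top)).contDiffAt

theorem mono (hf : XSmooth ν f) (h : ∀ g, ν.mem g → κ.mem g) : XSmooth κ f :=
  of_dX (fun k => (hf.dX k).continuousOn) (fun k => h _ (hf.dX k).mem)
    fun k _ hp => (hf.hasDerivAt_dX k hp).differentiableAt

theorem free (hf : XSmooth κ f) : XSmooth (Growth.free Y T) f :=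
  hf.mono fun g _ => Growth.free_mem g

theorem zero : XSmooth κ fun _ => (0 : E)
  | 0 => ⟨continuousOn_const, by simpa using κ.zero⟩
  | n + 1 => XSmoothUpTo.succ (f' := fun _ => (0 : E)) continuousOn_const (by simpa using κ.zero)
      (fun _ _ => hasDerivAt_const _ _) (zero n)

theorem const (c : E) (hc : κ.mem fun _ => ‖c‖) : XSmooth κ fun _ => c :=
  of_hasDerivAt continuousOn_const hc (fun _ _ => hasDerivAt_const _ _) zero

theorem add (hf : XSmooth κ f) (hg : XSmooth κ g) : XSmooth κ fun p => f p + g p :=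
  fun n => (hf n).add (hg n)

theorem clm (A : E →L[ℝ] F) (hf : XSmooth κ f) : XSmooth κ fun p => A (f p) :=
  fun n => (hf n).clm A

theorem neg (hf : XSmooth κ f) : XSmooth κ fun p => -f p :=
  hf.clm (-ContinuousLinearMap.id ℝ E)

theorem sub (hf : XSmooth κ f) (hg : XSmooth κ g) : XSmooth κ fun p => f p - g p := by
  simpa only [sub_eq_add_neg] using hf.add hg.neg

theorem bilin {m : E → F → G} (hm : IsBoundedBilinearMap ℝ fun q : E × F => m q.1 q.2)
    (hνκ : ν.Acts κ) {g : Pt → F} (hf : XSmooth ν f) (hg : XSmooth κ g) :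
    XSmooth κ fun p => m (f p) (g p) :=
  fun n => (hf n).bilin hm hνκ (hg n)

/-- Variant of `XSmooth.bilin` in which the second factor is the multiplier. -/
theorem bilin' {m : E → F → G} (hm : IsBoundedBilinearMap ℝ fun q : E × F => m q.1 q.2)
    (hνκ : ν.Acts κ) {g : Pt → F} (hf : XSmooth κ f) (hg : XSmooth ν g) :
    XSmooth κ fun p => m (f p) (g p) :=
  bilin (m := fun y x => m x y)
    ⟨fun y y' x => hm.add_right x y y', fun c y x => hm.smul_right c x y,
      fun y x x' => hm.add_left x x' y, fun c y x => hm.smul_left c x y, by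
        obtain ⟨C, hC, h⟩ := hm.bound
        exact ⟨C, hC, fun y x => (h x y).trans_eq (by ring)⟩⟩ hνκ hg hf

theorem sum {ι : Type*} {s : Finset ι} {f : ι → Pt → E} (h : ∀ i ∈ s, XSmooth κ (f i)) :
    XSmooth κ fun p => ∑ i ∈ s, f i p := by
  classical
  induction s using Finset.induction_on with
  | empty => simpa using zero
  | insert i s hi ih =>
    simp only [Finset.sum_insert hi]
    exact (h i (Finset.mem_insert_self i s)).add
      (ih fun j hj => h j (Finset.mem_insert_of_mem hj))

theorem pi {ι : Type*} [Fintype ι] {f : Pt → ι → E} (h : ∀ i, XSmooth κ fun p => f p i) :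
    XSmooth κ f := by
  classical
  have e : f = fun p => ∑ i, ContinuousLinearMap.single ℝ (fun _ : ι => E) i (f p i) := by
    ext p j
    simp [Finset.sum_apply, Pi.single_apply]
  rw [e]
  exact sum fun i _ => (h i).clm _

theorem comp {ι : Type*} [Fintype ι] {f : Pt → ι → E} (h : XSmooth κ f) (i : ι) :
    XSmooth κ fun p => f p i :=
  h.clm (ContinuousLinearMap.proj (R := ℝ) (φ := fun _ : ι => E) i)

end XSmooth

section Rules

theorem dX_clm (A : E →L[ℝ] F) (hf : XSmooth κ f) (k : ℕ) {p : Pt} (hp : p ∈ region Y T) :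
    dX k (fun q => A (f q)) p = A (dX k f p) := by
  induction k generalizing f with
  | zero => simp [dX_zero]
  | succ k ih =>
    rw [dX_succ k, dX_succ k f, ← ih (hf.dX 1)]
    exact dX_congr (fun q hq => HasDerivAt.dX_one_eq
      (A.hasFDerivAt.comp_hasDerivAt _ (hf.hasDerivAt hq))) k hp

theorem dX_apply {ι : Type*} [Fintype ι] {f : Pt → ι → E} (hf : XSmooth κ f) (i : ι) (k : ℕ)
    {p : Pt} (hp : p ∈ region Y T) : dX k f p i = dX k (fun q => f q i) p :=
  (dX_clm (ContinuousLinearMap.proj (R := ℝ) (φ := fun _ : ι => E) i) hf k hp).symm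

theorem dX_sub (hf : XSmooth κ f) (hg : XSmooth ν g) (k : ℕ) {p : Pt} (hp : p ∈ region Y T) :
    dX k (fun q => f q - g q) p = dX k f p - dX k g p :=
  iteratedDeriv_fun_sub (hf.contDiffAt hp) (hg.contDiffAt hp)

theorem dX_sum {ι : Type*} {s : Finset ι} {f : ι → Pt → E} (hf : ∀ i ∈ s, XSmooth κ (f i)) (k : ℕ)
    {p : Pt} (hp : p ∈ region Y T) :
    dX k (fun q => ∑ i ∈ s, f i q) p = ∑ i ∈ s, dX k (f i) p :=
  iteratedDeriv_fun_sum fun i hi => (hf i hi).contDiffAt hp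

theorem hasDerivAt_bilin {m : E → F → G} (hm : IsBoundedBilinearMap ℝ fun q : E × F => m q.1 q.2)
    {f : ℝ → E} {g : ℝ → F} {f' : E} {g' : F} {x : ℝ} (hf : HasDerivAt f f' x)
    (hg : HasDerivAt g g' x) :
    HasDerivAt (fun x => m (f x) (g x)) (m f' (g x) + m (f x) g') x := by
  rw [add_comm]
  exact hm.toContinuousLinearMap.hasDerivAt_of_bilinear (fun _ => hf) (fun _ => hg)

theorem hasDerivWithinAt_bilin {m : E → F → G}
    (hm : IsBoundedBilinearMap ℝ fun q : E × F => m q.1 q.2)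
    {f : ℝ → E} {g : ℝ → F} {f' : E} {g' : F} {x : ℝ} {s : Set ℝ} (hf : HasDerivWithinAt f f' s x)
    (hg : HasDerivWithinAt g g' s x) :
    HasDerivWithinAt (fun x => m (f x) (g x)) (m f' (g x) + m (f x) g') s x := by
  rw [add_comm]
  exact hm.toContinuousLinearMap.hasDerivWithinAt_of_bilinear hf hg

end Rules

end XDerivatives

/-! ### The two evolution directions -/

/-- The coordinate `y` (for `false`) or `t` (for `true`) of a point. -/
def coord (d : Bool) (p : Pt) : ℝ := bif d then p.2.2 else p.2.1

/-- The point `p` with its coordinate in the direction `d` replaced by `s`. -/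
def slice (d : Bool) (p : Pt) (s : ℝ) : Pt := bif d then (p.1, p.2.1, s) else (p.1, s, p.2.2)

/-- The range of the coordinate in the direction `d`. -/
def side (Y T : ℝ) (d : Bool) : ℝ := bif d then T else Y

section Directions

variable {E F G : Type*} [NormedAddCommGroup E] [NormedSpace ℝ E] [NormedAddCommGroup F]
  [NormedSpace ℝ F] [NormedAddCommGroup G] [NormedSpace ℝ G] {Y T : ℝ}

/-- `∂f/∂y` (for `false`) or `∂f/∂t` (for `true`). -/
noncomputable def dD (Y T : ℝ) (d : Bool) (f : Pt → E) (p : Pt) : E :=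
  derivWithin (fun s => f (slice d p s)) (Icc 0 (side Y T d)) (coord d p)

/-- At `p`, the function `f` has the partial derivative `f'` in the direction `d`. -/
def HasD (Y T : ℝ) (d : Bool) (f : Pt → E) (f' : E) (p : Pt) : Prop :=
  HasDerivWithinAt (fun s => f (slice d p s)) f' (Icc 0 (side Y T d)) (coord d p)

theorem dD_false (f : Pt → E) : dD Y T false f = dY Y f := rfl

theorem dD_true (f : Pt → E) : dD Y T true f = dT T f := rfl

theorem slice_coord (d : Bool) (p : Pt) : slice d p (coord d p) = p := by cases d <;> rfl

theorem coord_slice (d : Bool) (p : Pt) (s : ℝ) : coord d (slice d p s) = s := by cases d <;> rfl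

theorem slice_slice (d : Bool) (p : Pt) (s s' : ℝ) : slice d (slice d p s) s' = slice d p s' := by
  cases d <;> rfl

theorem slice_mk (d : Bool) (x : ℝ) (p : Pt) (s : ℝ) :
    slice d (x, p.2) s = (x, (slice d p s).2) := by cases d <;> rfl

theorem slice_fst (d : Bool) (p : Pt) (s : ℝ) : (slice d p s).1 = p.1 := by cases d <;> rfl

theorem coord_mk (d : Bool) (x : ℝ) (p : Pt) : coord d (x, p.2) = coord d p := by cases d <;> rfl

theorem coord_mem {p : Pt} (hp : p ∈ region Y T) (d : Bool) : coord d p ∈ Icc 0 (side Y T d) := by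
  cases d
  · exact hp.2.1
  · exact hp.2.2

theorem slice_mem {p : Pt} (hp : p ∈ region Y T) {d : Bool} {s : ℝ}
    (hs : s ∈ Icc 0 (side Y T d)) : slice d p s ∈ region Y T := by
  cases d
  · exact ⟨hp.1, hs, hp.2.2⟩
  · exact ⟨hp.1, hp.2.1, hs⟩

theorem HasD.congr {d : Bool} {f g : Pt → E} {f' : E} {p : Pt} (h : HasD Y T d f f' p)
    (hp : p ∈ region Y T) (hfg : EqOn g f (region Y T)) : HasD Y T d g f' p :=
  HasDerivWithinAt.congr h (fun s hs => hfg (slice_mem hp hs)) (by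
    rw [slice_coord]; exact hfg hp)

theorem HasD.bilin {m : E → F → G} (hm : IsBoundedBilinearMap ℝ fun q : E × F => m q.1 q.2)
    {d : Bool} {f : Pt → E} {g : Pt → F} {f' : E} {g' : F} {p : Pt} (hf : HasD Y T d f f' p)
    (hg : HasD Y T d g g' p) :
    HasD Y T d (fun q => m (f q) (g q)) (m f' (g p) + m (f p) g') p := by
  have := hasDerivWithinAt_bilin hm hf hg
  rwa [slice_coord] at this

theorem HasD.add {d : Bool} {f g : Pt → E} {f' g' : E} {p : Pt} (hf : HasD Y T d f f' p)
    (hg : HasD Y T d g g' p) : HasD Y T d (fun q => f q + g q) (f' + g') p :=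
  HasDerivWithinAt.fun_add hf hg

theorem HasD.sub {d : Bool} {f g : Pt → E} {f' g' : E} {p : Pt} (hf : HasD Y T d f f' p)
    (hg : HasD Y T d g g' p) : HasD Y T d (fun q => f q - g q) (f' - g') p :=
  HasDerivWithinAt.fun_sub hf hg

theorem HasD.clm (A : E →L[ℝ] F) {d : Bool} {f : Pt → E} {f' : E} {p : Pt}
    (hf : HasD Y T d f f' p) : HasD Y T d (fun q => A (f q)) (A f') p :=
  A.hasFDerivAt.comp_hasDerivWithinAt _ hf

theorem HasD.sum {ι : Type*} {s : Finset ι} {d : Bool} {f : ι → Pt → E} {f' : ι → E} {p : Pt}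
    (hf : ∀ i ∈ s, HasD Y T d (f i) (f' i) p) :
    HasD Y T d (fun q => ∑ i ∈ s, f i q) (∑ i ∈ s, f' i) p :=
  HasDerivWithinAt.fun_sum hf

variable [hY : Fact (0 < Y)] [hT : Fact (0 < T)]

omit hY hT in
theorem side_pos (hY : 0 < Y) (hT : 0 < T) (d : Bool) : 0 < side Y T d := by
  cases d
  · exact hY
  · exact hT

theorem HasD.dD_eq {d : Bool} {f : Pt → E} {f' : E} {p : Pt} (hp : p ∈ region Y T)
    (h : HasD Y T d f f' p) : dD Y T d f p = f' :=
  HasDerivWithinAt.derivWithin h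
    (uniqueDiffOn_Icc (side_pos hY.out hT.out d) _ (coord_mem hp d))

omit hY hT in
theorem dD_congr {f g : Pt → E} (h : EqOn f g (region Y T)) (d : Bool) :
    EqOn (dD Y T d f) (dD Y T d g) (region Y T) := fun p hp =>
  derivWithin_congr (fun s hs => h (slice_mem hp hs)) (by rw [slice_coord]; exact h hp)

omit hY hT in
theorem continuous_slice (d : Bool) (p : Pt) : Continuous (slice d p) := by
  cases d
  · exact (by fun_prop : Continuous fun s : ℝ => ((p.1, s, p.2.2) : Pt))
  · exact (by fun_prop : Continuous fun s : ℝ => ((p.1, p.2.1, s) : Pt))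

/-! ### Continuously differentiable functions with values in smooth functions -/

/-- `f` is continuously differentiable in `(y, t)` with values in the functions that are smooth in
`x`, and the `x`-derivatives of `f`, `∂f/∂y` and `∂f/∂t` are of class `κ`. -/
structure C1X (κ : Growth Y T) (f : Pt → E) : Prop where
  xSmooth : XSmooth κ f
  xSmooth_dD : ∀ d, XSmooth κ (dD Y T d f)
  hasD : ∀ d, ∀ p ∈ region Y T, HasD Y T d f (dD Y T d f p) p

namespace C1X

variable {κ ν : Growth Y T} {f g : Pt → E}

theorem of_hasD {f' : Bool → Pt → E} (hf : XSmooth κ f) (hf' : ∀ d, XSmooth κ (f' d))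
    (h : ∀ d, ∀ p ∈ region Y T, HasD Y T d f (f' d p) p) : C1X κ f where
  xSmooth := hf
  xSmooth_dD d := (hf' d).congr fun p hp => (h d p hp).dD_eq hp
  hasD d p hp := by rw [(h d p hp).dD_eq hp]; exact h d p hp

omit hY hT in
theorem congr (hf : C1X κ f) (h : EqOn g f (region Y T)) : C1X κ g where
  xSmooth := hf.xSmooth.congr h
  xSmooth_dD d := (hf.xSmooth_dD d).congr (dD_congr h d)
  hasD d p hp := by rw [dD_congr h d hp]; exact (hf.hasD d p hp).congr hp h

omit hY hT in
theorem mono (hf : C1X ν f) (h : ∀ g, ν.mem g → κ.mem g) : C1X κ f :=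
  ⟨hf.xSmooth.mono h, fun d => (hf.xSmooth_dD d).mono h, hf.hasD⟩

theorem const (c : E) (hc : κ.mem fun _ => ‖c‖) : C1X κ fun _ => c :=
  of_hasD (.const c hc) (fun _ => .zero) fun _ _ _ => hasDerivWithinAt_const _ _ _

theorem zero : C1X κ fun _ => (0 : E) := const 0 (by simpa using κ.zero)

theorem add (hf : C1X κ f) (hg : C1X κ g) : C1X κ fun p => f p + g p :=
  of_hasD (hf.xSmooth.add hg.xSmooth) (fun d => (hf.xSmooth_dD d).add (hg.xSmooth_dD d))
    fun d p hp => (hf.hasD d p hp).add (hg.hasD d p hp)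

theorem clm (A : E →L[ℝ] F) (hf : C1X κ f) : C1X κ fun p => A (f p) :=
  of_hasD (hf.xSmooth.clm A) (fun d => (hf.xSmooth_dD d).clm A) fun d p hp => (hf.hasD d p hp).clm A

theorem neg (hf : C1X κ f) : C1X κ fun p => -f p := hf.clm (-ContinuousLinearMap.id ℝ E)

theorem sub (hf : C1X κ f) (hg : C1X κ g) : C1X κ fun p => f p - g p := by
  simpa only [sub_eq_add_neg] using hf.add hg.neg

theorem bilin {m : E → F → G} (hm : IsBoundedBilinearMap ℝ fun q : E × F => m q.1 q.2)
    (hνκ : ν.Acts κ) {g : Pt → F} (hf : C1X ν f) (hg : C1X κ g) :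
    C1X κ fun p => m (f p) (g p) :=
  of_hasD (hf.xSmooth.bilin hm hνκ hg.xSmooth)
    (fun d => ((hf.xSmooth_dD d).bilin hm hνκ hg.xSmooth).add
      (hf.xSmooth.bilin hm hνκ (hg.xSmooth_dD d)))
    fun d p hp => (hf.hasD d p hp).bilin hm (hg.hasD d p hp)

/-- Variant of `C1X.bilin` in which the second factor is the multiplier. -/
theorem bilin' {m : E → F → G} (hm : IsBoundedBilinearMap ℝ fun q : E × F => m q.1 q.2)
    (hνκ : ν.Acts κ) {g : Pt → F} (hf : C1X κ f) (hg : C1X ν g) :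
    C1X κ fun p => m (f p) (g p) :=
  of_hasD (hf.xSmooth.bilin' hm hνκ hg.xSmooth)
    (fun d => ((hf.xSmooth_dD d).bilin' hm hνκ hg.xSmooth).add
      (hf.xSmooth.bilin' hm hνκ (hg.xSmooth_dD d)))
    fun d p hp => (hf.hasD d p hp).bilin hm (hg.hasD d p hp)

theorem sum {ι : Type*} {s : Finset ι} {f : ι → Pt → E} (h : ∀ i ∈ s, C1X κ (f i)) :
    C1X κ fun p => ∑ i ∈ s, f i p :=
  of_hasD (.sum fun i hi => (h i hi).xSmooth) (fun d => .sum fun i hi => (h i hi).xSmooth_dD d)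
    fun d p hp => .sum fun i hi => (h i hi).hasD d p hp

theorem pi {ι : Type*} [Fintype ι] {f : Pt → ι → E} (h : ∀ i, C1X κ fun p => f p i) :
    C1X κ f :=
  of_hasD (f' := fun d p i => dD Y T d (fun p => f p i) p) (.pi fun i => (h i).xSmooth)
    (fun d => .pi fun i => (h i).xSmooth_dD d)
    fun d p hp => hasDerivWithinAt_pi.2 fun i => (h i).hasD d p hp

theorem comp {ι : Type*} [Fintype ι] {f : Pt → ι → E} (h : C1X κ f) (i : ι) :
    C1X κ fun p => f p i :=
  h.clm (ContinuousLinearMap.proj (R := ℝ) (φ := fun _ : ι => E) i)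

theorem dD_apply {ι : Type*} [Fintype ι] {f : Pt → ι → E} (h : C1X κ f) (d : Bool) (i : ι) {p : Pt}
    (hp : p ∈ region Y T) : dD Y T d f p i = dD Y T d (fun q => f q i) p :=
  (HasD.dD_eq (f := fun q => f q i) hp (hasDerivWithinAt_pi.1 (h.hasD d p hp) i)).symm

omit hY hT in
/-- `∂/∂x` commutes with `∂/∂y` and with `∂/∂t`. -/
theorem hasD_dX_one (hf : C1X κ f) (d : Bool) {p : Pt} (hp : p ∈ region Y T) :
    HasD Y T d (dX 1 f) (dX 1 (dD Y T d f) p) p := by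
  have key := hasDerivWithinAt_of_mixed (s := Icc 0 (side Y T d)) (t := univ)
    (g := fun s x => f (x, (slice d p s).2)) (g₁ := fun s x => dD Y T d f (x, (slice d p s).2))
    (g₂ := fun s x => dX 1 f (x, (slice d p s).2))
    (g₁₂ := fun s x => dX 1 (dD Y T d f) (x, (slice d p s).2)) (x₀ := coord d p) (y₀ := p.1)
    (convex_Icc _ _) convex_univ nontrivial_univ
    (fun s hs x _ => by
      have := hf.hasD d (x, (slice d p s).2) (line_mem_region (slice_mem hp hs) x)
      simp only [HasD, slice_mk, slice_slice, coord_mk, coord_slice] at this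
      exact this)
    (fun s hs x _ => ((hf.xSmooth_dD d).hasDerivAt
      (line_mem_region (slice_mem hp hs) x)).hasDerivWithinAt)
    (fun s hs x _ => (hf.xSmooth.hasDerivAt
      (line_mem_region (slice_mem hp hs) x)).hasDerivWithinAt)
    (((hf.xSmooth_dD d).dX 1).continuousOn.comp
      (((continuous_snd.prodMk
        (continuous_snd.comp ((continuous_slice d p).comp continuous_fst)))).continuousOn)
      fun q hq => line_mem_region (slice_mem hp hq.1) _)
    (coord_mem hp d) (mem_univ _)
  simp only [slice_coord] at key
  have e : ∀ s, slice d p s = (p.1, (slice d p s).2) := fun s => by rw [← slice_fst d p s]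
  simp only [HasD]
  rw [funext fun s => congrArg (dX 1 f) (e s)]
  exact key

theorem dX_one (hf : C1X κ f) : C1X κ (DelsarteDarboux.dX 1 f) :=
  of_hasD (hf.xSmooth.dX 1) (fun d => (hf.xSmooth_dD d).dX 1) fun d _ hp => hf.hasD_dX_one d hp

theorem dX (hf : C1X κ f) (k : ℕ) : C1X κ (DelsarteDarboux.dX k f) := by
  induction k generalizing f with
  | zero => rwa [dX_zero]
  | succ k ih => rw [dX_succ]; exact ih hf.dX_one

theorem dD_dX (hf : C1X κ f) (k : ℕ) (d : Bool) :
    EqOn (dD Y T d (DelsarteDarboux.dX k f)) (DelsarteDarboux.dX k (dD Y T d f))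
      (region Y T) := by
  induction k generalizing f with
  | zero => rw [dX_zero, dX_zero]; exact fun _ _ => rfl
  | succ k ih =>
    intro p hp
    rw [dX_succ k f, dX_succ k (dD Y T d f), ih hf.dX_one hp]
    exact dX_congr (fun q hq => (hf.hasD_dX_one d hq).dD_eq hq) k hp

end C1X

end Directions

/-! ### Joint differentiability from partial derivatives -/

section Joint

variable {E : Type*} [NormedAddCommGroup E] [NormedSpace ℝ E] {Y T : ℝ}

/-- The linear map `(u, v, w) ↦ u e₁ + v e₂ + w e₃`. -/
noncomputable def linMap (e₁ e₂ e₃ : E) : Pt →L[ℝ] E :=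
  (ContinuousLinearMap.fst ℝ ℝ (ℝ × ℝ)).smulRight e₁ +
    (((ContinuousLinearMap.fst ℝ ℝ ℝ).comp (ContinuousLinearMap.snd ℝ ℝ (ℝ × ℝ))).smulRight e₂ +
      ((ContinuousLinearMap.snd ℝ ℝ ℝ).comp (ContinuousLinearMap.snd ℝ ℝ (ℝ × ℝ))).smulRight e₃)

theorem linMap_apply (e₁ e₂ e₃ : E) (q : Pt) :
    linMap e₁ e₂ e₃ q = q.1 • e₁ + (q.2.1 • e₂ + q.2.2 • e₃) := rfl

theorem hasFDerivWithinAt_of_partials {f fx : Pt → E} {fd : Bool → Pt → E}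
    (hx : ∀ p ∈ region Y T, HasDerivAt (fun x => f (x, p.2)) (fx p) p.1)
    (hd : ∀ d, ∀ p ∈ region Y T, HasD Y T d f (fd d p) p)
    (hcx : ContinuousOn fx (region Y T)) (hcd : ∀ d, ContinuousOn (fd d) (region Y T))
    {p : Pt} (hp : p ∈ region Y T) :
    HasFDerivWithinAt f (linMap (fx p) (fd false p) (fd true p)) (region Y T) p := by
  rw [hasFDerivWithinAt_iff_isLittleO, Asymptotics.isLittleO_iff]
  intro ε hε
  have hε3 : 0 < ε / 3 := by positivity
  obtain ⟨δ₁, hδ₁, h₁⟩ := Metric.continuousOn_iff.1 hcx p hp _ hε3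
  obtain ⟨δ₂, hδ₂, h₂⟩ := Metric.continuousOn_iff.1 (hcd false) p hp _ hε3
  obtain ⟨δ₃, hδ₃, h₃⟩ := Metric.continuousOn_iff.1 (hcd true) p hp _ hε3
  filter_upwards [self_mem_nhdsWithin,
    mem_nhdsWithin_of_mem_nhds (Metric.ball_mem_nhds p hδ₁),
    mem_nhdsWithin_of_mem_nhds (Metric.ball_mem_nhds p hδ₂),
    mem_nhdsWithin_of_mem_nhds (Metric.ball_mem_nhds p hδ₃)] with q hq hq₁ hq₂ hq₃
  obtain ⟨x₀, y₀, t₀⟩ := p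
  obtain ⟨x, y, t⟩ := q
  have hy : y ∈ Icc 0 Y := hq.2.1
  have ht : t ∈ Icc 0 T := hq.2.2
  have hy₀ : y₀ ∈ Icc 0 Y := hp.2.1
  have ht₀ : t₀ ∈ Icc 0 T := hp.2.2
  have near : ∀ {δ : ℝ} {x' y' t' : ℝ}, (x, y, t) ∈ Metric.ball ((x₀, y₀, t₀) : Pt) δ →
      |x' - x₀| ≤ |x - x₀| → |y' - y₀| ≤ |y - y₀| → |t' - t₀| ≤ |t - t₀| →
      dist ((x', y', t') : Pt) (x₀, y₀, t₀) < δ := by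
    intro δ x' y' t' h h1 h2 h3
    rw [Metric.mem_ball] at h
    refine lt_of_le_of_lt ?_ h
    simp only [Prod.dist_eq, Real.dist_eq]
    exact max_le_max h1 (max_le_max h2 h3)
  have zero_le : ∀ a b : ℝ, |b - b| ≤ |a - b| := fun a b => by simp
  have ex := norm_sub_sub_smul_le (h := fun z => f (z, y, t)) (h' := fun z => fx (z, y, t))
    convex_univ (mem_univ x₀) (mem_univ x) (fx (x₀, y₀, t₀)) (ε := ε / 3)
    (fun z _ => (hx (z, y, t) ⟨mem_univ _, hy, ht⟩).hasDerivWithinAt)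
    (fun z _ hz => by
      rw [← dist_eq_norm]
      exact (h₁ (z, y, t) ⟨mem_univ _, hy, ht⟩ (near hq₁ hz le_rfl le_rfl)).le)
  have ey := norm_sub_sub_smul_le (h := fun z => f (x₀, z, t)) (h' := fun z => fd false (x₀, z, t))
    (convex_Icc 0 Y) hy₀ hy (fd false (x₀, y₀, t₀)) (ε := ε / 3)
    (fun z hz => hd false (x₀, z, t) ⟨mem_univ _, hz, ht⟩)
    (fun z hz hzy => by
      rw [← dist_eq_norm]
      exact (h₂ (x₀, z, t) ⟨mem_univ _, hz, ht⟩ (near hq₂ (zero_le _ _) hzy le_rfl)).le)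
  have et := norm_sub_sub_smul_le (h := fun z => f (x₀, y₀, z)) (h' := fun z => fd true (x₀, y₀, z))
    (convex_Icc 0 T) ht₀ ht (fd true (x₀, y₀, t₀)) (ε := ε / 3)
    (fun z hz => hd true (x₀, y₀, z) ⟨mem_univ _, hy₀, hz⟩)
    (fun z hz hzt => by
      rw [← dist_eq_norm]
      exact (h₃ (x₀, y₀, z) ⟨mem_univ _, hy₀, hz⟩
        (near hq₃ (zero_le _ _) (zero_le _ _) hzt)).le)
  have e : f (x, y, t) - f (x₀, y₀, t₀)
      - linMap (fx (x₀, y₀, t₀)) (fd false (x₀, y₀, t₀)) (fd true (x₀, y₀, t₀))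
        ((x, y, t) - (x₀, y₀, t₀))
      = (f (x, y, t) - f (x₀, y, t) - (x - x₀) • fx (x₀, y₀, t₀))
        + ((f (x₀, y, t) - f (x₀, y₀, t) - (y - y₀) • fd false (x₀, y₀, t₀))
        + (f (x₀, y₀, t) - f (x₀, y₀, t₀) - (t - t₀) • fd true (x₀, y₀, t₀))) := by
    simp only [linMap_apply, Prod.mk_sub_mk]
    abel
  rw [e]
  have n1 : |x - x₀| ≤ ‖((x, y, t) : Pt) - (x₀, y₀, t₀)‖ :=
    norm_fst_le (((x, y, t) : Pt) - (x₀, y₀, t₀))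
  have n2 : |y - y₀| ≤ ‖((x, y, t) : Pt) - (x₀, y₀, t₀)‖ :=
    (norm_fst_le _).trans (norm_snd_le (((x, y, t) : Pt) - (x₀, y₀, t₀)))
  have n3 : |t - t₀| ≤ ‖((x, y, t) : Pt) - (x₀, y₀, t₀)‖ :=
    (norm_snd_le _).trans (norm_snd_le (((x, y, t) : Pt) - (x₀, y₀, t₀)))
  calc _ ≤ ε / 3 * |x - x₀| + (ε / 3 * |y - y₀| + ε / 3 * |t - t₀|) :=
        norm_add_le_of_le ex (norm_add_le_of_le ey et)
    _ ≤ ε / 3 * ‖((x, y, t) : Pt) - (x₀, y₀, t₀)‖ + (ε / 3 * ‖((x, y, t) : Pt) - (x₀, y₀, t₀)‖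
        + ε / 3 * ‖((x, y, t) : Pt) - (x₀, y₀, t₀)‖) := by gcongr
    _ = _ := by ring

variable [hY : Fact (0 < Y)] [hT : Fact (0 < T)]

variable (Y T) in
theorem uniqueDiffOn_region : UniqueDiffOn ℝ (region Y T) :=
  uniqueDiffOn_univ.prod ((uniqueDiffOn_Icc hY.out).prod (uniqueDiffOn_Icc hT.out))

/-- A function with continuous partial derivatives is continuously differentiable, also at the
boundary of the domain. -/
theorem contDiffOn_of_partials {f fx : Pt → E} {fd : Bool → Pt → E}
    (hx : ∀ p ∈ region Y T, HasDerivAt (fun x => f (x, p.2)) (fx p) p.1)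
    (hd : ∀ d, ∀ p ∈ region Y T, HasD Y T d f (fd d p) p)
    (hcx : ContinuousOn fx (region Y T)) (hcd : ∀ d, ContinuousOn (fd d) (region Y T)) :
    ContDiffOn ℝ 1 f (region Y T) := by
  have h := fun p hp => hasFDerivWithinAt_of_partials hx hd hcx hcd (p := p) hp
  have hc : ContinuousOn (fun p => linMap (fx p) (fd false p) (fd true p)) (region Y T) := by
    have hs : ∀ (L : Pt →L[ℝ] ℝ) {g : Pt → E}, ContinuousOn g (region Y T) →
        ContinuousOn (fun p => L.smulRight (g p)) (region Y T) := fun L g hg =>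
      (ContinuousLinearMap.smulRightL ℝ Pt E L).continuous.comp_continuousOn hg
    exact (hs _ hcx).add ((hs _ (hcd false)).add (hs _ (hcd true)))
  rw [show (1 : WithTop ℕ∞) = 0 + 1 from rfl,
    contDiffOn_succ_iff_fderivWithin (uniqueDiffOn_region Y T)]
  refine ⟨fun p hp => (h p hp).differentiableWithinAt, by simp, contDiffOn_zero.2 ?_⟩
  exact hc.congr fun p hp => (h p hp).fderivWithin (uniqueDiffOn_region Y T p hp)

/-- The unit vector in the direction `d`. -/
def unitVec (d : Bool) : Pt := bif d then (0, 0, 1) else (0, 1, 0)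

omit hY hT in
theorem ContDiffOn.hasDerivAt_line {f : Pt → E} (hf : ContDiffOn ℝ 1 f (region Y T)) {p : Pt}
    (hp : p ∈ region Y T) :
    HasDerivAt (fun x => f (x, p.2)) (fderivWithin ℝ f (region Y T) p (1, 0)) p.1 := by
  have h1 := (hf.differentiableOn (by simp) p hp).hasFDerivWithinAt
  have h2 : HasDerivWithinAt (fun x : ℝ => ((x, p.2) : Pt)) (1, 0) univ p.1 :=
    ((hasDerivAt_id p.1).prodMk (hasDerivAt_const p.1 p.2)).hasDerivWithinAt
  exact hasDerivWithinAt_univ.1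
    (h1.comp_hasDerivWithinAt p.1 h2 fun x _ => line_mem_region hp x)

omit hY hT in
theorem ContDiffOn.hasD {f : Pt → E} (hf : ContDiffOn ℝ 1 f (region Y T)) (d : Bool) {p : Pt}
    (hp : p ∈ region Y T) : HasD Y T d f (fderivWithin ℝ f (region Y T) p (unitVec d)) p := by
  have h1 := (hf.differentiableOn (by simp) p hp).hasFDerivWithinAt
  have h2 : HasDerivWithinAt (slice d p) (unitVec d) (Icc 0 (side Y T d)) (coord d p) := by
    cases d
    · exact ((hasDerivAt_const _ p.1).prodMk
        ((hasDerivAt_id p.2.1).prodMk (hasDerivAt_const _ p.2.2))).hasDerivWithinAt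
    · exact ((hasDerivAt_const _ p.1).prodMk
        ((hasDerivAt_const _ p.2.1).prodMk (hasDerivAt_id p.2.2))).hasDerivWithinAt
  exact HasFDerivWithinAt.comp_hasDerivWithinAt_of_eq (coord d p) h1 h2
    (fun s hs => slice_mem hp hs) (slice_coord d p).symm

theorem ContDiffOn.continuousOn_dD {f : Pt → E} (hf : ContDiffOn ℝ 1 f (region Y T)) (d : Bool) :
    ContinuousOn (dD Y T d f) (region Y T) :=
  ((hf.continuousOn_fderivWithin (uniqueDiffOn_region Y T) (by simp)).clm_apply
    continuousOn_const).congr fun _ hp => (ContDiffOn.hasD hf d hp).dD_eq hp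

theorem C1X.c1Smooth {κ : Growth Y T} {f : Pt → E} (hf : C1X κ f) : C1Smooth Y T f := fun k =>
  contDiffOn_of_partials (fun _ hp => hf.xSmooth.hasDerivAt_dX k hp)
    (fun d _ hp => (hf.dX k).hasD d _ hp) (hf.xSmooth.dX (k + 1)).continuousOn
    (fun d => ((hf.dX k).xSmooth_dD d).continuousOn)

/-- The joint `C¹` property of all `x`-derivatives implies that `∂f/∂y` and `∂f/∂t` are smooth in
`x`: the interchange of derivatives shows that `∂/∂x` maps `∂(∂ᵏf)/∂y` to `∂(∂ᵏ⁺¹f)/∂y`. -/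
theorem C1Smooth.c1X {f : Pt → E} (hf : C1Smooth Y T f) : C1X (Growth.free Y T) f := by
  have hx : ∀ k, ∀ p ∈ region Y T,
      HasDerivAt (fun x => dX k f (x, p.2)) (dX (k + 1) f p) p.1 := fun k p hp => by
    rw [← dX_one_dX, dX, iteratedDeriv_one]
    exact (ContDiffOn.hasDerivAt_line (hf k) hp).differentiableAt.hasDerivAt
  have hd : ∀ k d, ∀ p ∈ region Y T, HasD Y T d (dX k f) (dD Y T d (dX k f) p) p :=
    fun k d p hp => by
      have := ContDiffOn.hasD (hf k) d hp
      rwa [this.dD_eq hp]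
  have hc : ∀ k d, ContinuousOn (dD Y T d (dX k f)) (region Y T) :=
    fun k d => ContDiffOn.continuousOn_dD (hf k) d
  have hxd : ∀ k d, ∀ p ∈ region Y T,
      HasDerivAt (fun x => dD Y T d (dX k f) (x, p.2)) (dD Y T d (dX (k + 1) f) p) p.1 := by
    intro k d p hp
    have key := hasDerivWithinAt_of_mixed (s := univ) (t := Icc 0 (side Y T d))
      (g := fun x s => dX k f (x, (slice d p s).2))
      (g₁ := fun x s => dX (k + 1) f (x, (slice d p s).2))
      (g₂ := fun x s => dD Y T d (dX k f) (x, (slice d p s).2))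
      (g₁₂ := fun x s => dD Y T d (dX (k + 1) f) (x, (slice d p s).2))
      (x₀ := p.1) (y₀ := coord d p) convex_univ (convex_Icc _ _)
      ⟨0, left_mem_Icc.2 (side_pos hY.out hT.out d).le, _,
        right_mem_Icc.2 (side_pos hY.out hT.out d).le, (side_pos hY.out hT.out d).ne⟩
      (fun x _ s hs => (hx k _ (line_mem_region (slice_mem hp hs) x)).hasDerivWithinAt)
      (fun x _ s hs => by
        have := hd (k + 1) d (x, (slice d p s).2) (line_mem_region (slice_mem hp hs) x)
        simp only [HasD, slice_mk, slice_slice, coord_mk, coord_slice] at this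
        exact this)
      (fun x _ s hs => by
        have := hd k d (x, (slice d p s).2) (line_mem_region (slice_mem hp hs) x)
        simp only [HasD, slice_mk, slice_slice, coord_mk, coord_slice] at this
        exact this)
      ((hc (k + 1) d).comp
        ((continuous_fst.prodMk
          (continuous_snd.comp ((continuous_slice d p).comp continuous_snd))).continuousOn)
        fun q hq => line_mem_region (slice_mem hp hq.2) _)
      (mem_univ _) (coord_mem hp d)
    simp only [slice_coord] at key
    exact hasDerivWithinAt_univ.1 key
  refine ⟨XSmooth.of_dX (fun k => (hf k).continuousOn) (fun _ => Growth.free_mem _)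
    fun k p hp => (hx k p hp).differentiableAt, fun d => ?_, fun d p hp => ?_⟩
  · have : ∀ n k, XSmoothUpTo (Growth.free Y T) n (dD Y T d (dX k f)) := by
      intro n
      induction n with
      | zero => exact fun k => ⟨hc k d, Growth.free_mem _⟩
      | succ n ih =>
        exact fun k => XSmoothUpTo.succ (hc k d) (Growth.free_mem _) (hxd k d) (ih (k + 1))
    intro n
    simpa only [dX_zero] using this n 0
  · simpa only [dX_zero] using hd 0 d p hp

end Joint

/-! ### Integration in `x` -/

section Primitive

variable {E : Type*} [NormedAddCommGroup E] [NormedSpace ℝ E] {Y T : ℝ}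

/-- `∂⁻¹`, the integration in `x` from `x₀`. -/
noncomputable def prim (x₀ : ℝ) (h : Pt → E) (p : Pt) : E := ∫ s in x₀..p.1, h (s, p.2)

omit [NormedSpace ℝ E] in
theorem continuous_line {h : Pt → E} (hc : ContinuousOn h (region Y T)) {p : Pt}
    (hp : p ∈ region Y T) : Continuous fun s => h (s, p.2) :=
  continuousOn_univ.1 (hc.comp (by fun_prop : ContinuousOn (fun s : ℝ => (s, p.2)) univ)
    fun s _ => line_mem_region hp s)

theorem prim_congr {x₀ : ℝ} {h h' : Pt → E} (e : EqOn h h' (region Y T)) :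
    EqOn (prim x₀ h) (prim x₀ h') (region Y T) := fun _ hp =>
  intervalIntegral.integral_congr fun s _ => e (line_mem_region hp s)

theorem prim_base {x₀ : ℝ} (h : Pt → E) {p : Pt} (hp : p.1 = x₀) : prim x₀ h p = 0 := by
  simp [prim, hp]

variable [CompleteSpace E]

theorem hasDerivAt_prim (x₀ : ℝ) {h : Pt → E} (hc : ContinuousOn h (region Y T)) {p : Pt}
    (hp : p ∈ region Y T) : HasDerivAt (fun x => prim x₀ h (x, p.2)) (h p) p.1 :=
  (continuous_line hc hp).integral_hasStrictDerivAt x₀ p.1 |>.hasDerivAt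

theorem prim_eq_sub (x₀ : ℝ) {g h : Pt → E} (hc : ContinuousOn h (region Y T))
    (hg : ∀ p ∈ region Y T, HasDerivAt (fun x => g (x, p.2)) (h p) p.1) {p : Pt}
    (hp : p ∈ region Y T) : prim x₀ h p = g p - g (x₀, p.2) :=
  intervalIntegral.integral_eq_sub_of_hasDerivAt (f := fun x => g (x, p.2))
    (fun x _ => hg (x, p.2) (line_mem_region hp x))
    ((continuous_line hc hp).intervalIntegrable _ _)

omit [CompleteSpace E] in
theorem continuousOn_prim (x₀ : ℝ) {h : Pt → E} (hY : 0 ≤ Y) (hT : 0 ≤ T)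
    (hc : ContinuousOn h (region Y T)) : ContinuousOn (prim x₀ h) (region Y T) := by
  -- outside the rectangle, `h` is replaced by its values at the nearest points
  let r : ℝ × ℝ → ℝ × ℝ := fun q => (projIcc 0 Y hY q.1, projIcc 0 T hT q.2)
  have hr : Continuous r := by
    refine Continuous.prodMk ?_ ?_
    · exact continuous_subtype_val.comp (continuous_projIcc.comp continuous_fst)
    · exact continuous_subtype_val.comp (continuous_projIcc.comp continuous_snd)
  have hrp : ∀ p ∈ region Y T, r p.2 = p.2 := fun p hp => by
    simp only [r, projIcc_of_mem hY hp.2.1, projIcc_of_mem hT hp.2.2]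
  have hcr : Continuous (Function.uncurry fun (q : ℝ × ℝ) (s : ℝ) => h (s, r q)) :=
    continuousOn_univ.1 (hc.comp
      (by fun_prop : Continuous fun z : (ℝ × ℝ) × ℝ => ((z.2, r z.1) : Pt)).continuousOn
      fun z _ => ⟨mem_univ _, (projIcc 0 Y hY z.1.1).2, (projIcc 0 T hT z.1.2).2⟩)
  have h2 := intervalIntegral.continuous_parametric_primitive_of_continuous (μ := volume)
    (a₀ := x₀) hcr
  refine ((h2.comp (by fun_prop : Continuous fun p : Pt => (p.2, p.1))).continuousOn).congr
    fun p hp => ?_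
  simp only [prim, Function.comp_apply, hrp p hp]

omit [CompleteSpace E] in
theorem hasD_prim (x₀ : ℝ) {d : Bool} {h h' : Pt → E} (hc : ContinuousOn h (region Y T))
    (hc' : ContinuousOn h' (region Y T)) (hd : ∀ p ∈ region Y T, HasD Y T d h (h' p) p) {p : Pt}
    (hp : p ∈ region Y T) : HasD Y T d (prim x₀ h) (prim x₀ h' p) p := by
  have key := hasDerivWithinAt_intervalIntegral (s := Icc 0 (side Y T d)) (a := x₀) (b := p.1)
    (h := fun x s => h (x, (slice d p s).2)) (h' := fun x s => h' (x, (slice d p s).2))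
    (y₀ := coord d p) (convex_Icc _ _)
    (fun s hs => continuous_line hc (slice_mem hp hs))
    (fun x s hs => by
      have := hd (x, (slice d p s).2) (line_mem_region (slice_mem hp hs) x)
      simp only [HasD, slice_mk, slice_slice, coord_mk, coord_slice] at this
      exact this)
    (hc'.comp ((continuous_snd.prodMk
        (continuous_snd.comp ((continuous_slice d p).comp continuous_fst))).continuousOn)
        fun q hq => line_mem_region (slice_mem hp hq.1) _)
    (coord_mem hp d)
  simp only [slice_coord] at key
  simp only [HasD, prim, slice_fst]
  exact key

/-- Integration from `x₀` preserves vanishing on any subset of `{x = x₀}`; for the empty set this is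
the preservation of smoothness. -/
theorem XSmooth.prim {A : Set Pt} {x₀ : ℝ} (hA : ∀ p ∈ A, p.1 = x₀) (hY : 0 ≤ Y) (hT : 0 ≤ T)
    {h : Pt → E} (hh : XSmooth (Growth.vanishing Y T A) h) :
    XSmooth (Growth.vanishing Y T A) (prim x₀ h) :=
  .of_hasDerivAt (continuousOn_prim x₀ hY hT hh.continuousOn)
    (fun p _ hpA => by beta_reduce; rw [prim_base h (hA p hpA), norm_zero])
    (fun _ hp => hasDerivAt_prim x₀ hh.continuousOn hp) hh

variable [hY : Fact (0 < Y)] [hT : Fact (0 < T)]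

theorem C1X.prim (x₀ : ℝ) {h : Pt → E} (hh : C1X (Growth.free Y T) h) :
    C1X (Growth.free Y T) (prim x₀ h) :=
  .of_hasD (hh.xSmooth.prim (fun _ hp => hp.elim) hY.out.le hT.out.le)
    (fun d => (hh.xSmooth_dD d).prim (fun _ hp => hp.elim) hY.out.le hT.out.le)
    fun d _ hp => hasD_prim x₀ hh.xSmooth.continuousOn (hh.xSmooth_dD d).continuousOn
      (hh.hasD d) hp

end Primitive

/-! ### Inversion in a Banach algebra -/

section Inverse

variable {A : Type*} [NormedRing A] [NormedAlgebra ℝ A] [CompleteSpace A] {Y T : ℝ}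
  {κ : Growth Y T} {f : Pt → A}

omit [CompleteSpace A] in
theorem isBoundedBilinearMap_mul' : IsBoundedBilinearMap ℝ fun q : A × A => q.1 * q.2 :=
  (ContinuousLinearMap.mul ℝ A).isBoundedBilinearMap

theorem hasDerivWithinAt_inverse {g : ℝ → A} {g' : A} {s : Set ℝ} {x : ℝ} (hu : IsUnit (g x))
    (hg : HasDerivWithinAt g g' s x) :
    HasDerivWithinAt (fun z => Ring.inverse (g z))
      (-(Ring.inverse (g x) * (g' * Ring.inverse (g x)))) s x := by
  obtain ⟨u, hu⟩ := hu
  have h := (hu ▸ hasFDerivAt_ringInverse (𝕜 := ℝ) u).comp_hasDerivWithinAt x hg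
  rw [← hu, Ring.inverse_unit]
  exact h.congr_deriv (by simp [mul_assoc])

/-- Only `f⁻¹` and the derivatives of `f` have to be of class `κ`, but not `f` itself, because
`∂(f⁻¹) = -f⁻¹ (∂f) f⁻¹`. -/
theorem XSmooth.inverse (hκ : κ.Acts κ) (hf : XSmooth (Growth.free Y T) f)
    (hf1 : XSmooth κ (DelsarteDarboux.dX 1 f)) (hu : ∀ p ∈ region Y T, IsUnit (f p))
    (hm : κ.mem fun p => ‖Ring.inverse (f p)‖) : XSmooth κ fun p => Ring.inverse (f p) := by
  have hc : ContinuousOn (fun p => Ring.inverse (f p)) (region Y T) := fun p hp => by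
    obtain ⟨u, hu⟩ := hu p hp
    exact ContinuousAt.comp_continuousWithinAt (g := Ring.inverse)
      (hu ▸ NormedRing.inverse_continuousAt u) (hf.continuousOn p hp)
  intro n
  induction n with
  | zero => exact ⟨hc, hm⟩
  | succ n ih =>
    refine XSmoothUpTo.succ (f' := fun p => (-ContinuousLinearMap.id ℝ A)
      (Ring.inverse (f p) * (DelsarteDarboux.dX 1 f p * Ring.inverse (f p)))) hc hm
      (fun p hp => ?_)
      ((XSmoothUpTo.bilin isBoundedBilinearMap_mul' hκ ih
        (XSmoothUpTo.bilin isBoundedBilinearMap_mul' hκ (hf1 n) ih)).clm _)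
    exact hasDerivWithinAt_univ.1
      (hasDerivWithinAt_inverse (hu p hp) (hf.hasDerivAt hp).hasDerivWithinAt)

theorem HasD.inverse {d : Bool} {f' : A} {p : Pt} (hu : IsUnit (f p)) (h : HasD Y T d f f' p) :
    HasD Y T d (fun q => Ring.inverse (f q))
      (-(Ring.inverse (f p) * (f' * Ring.inverse (f p)))) p := by
  have := hasDerivWithinAt_inverse (by rwa [slice_coord]) h
  rwa [slice_coord] at this

theorem C1X.inverse [hY : Fact (0 < Y)] [hT : Fact (0 < T)] (hκ : κ.Acts κ)
    (hf : C1X (Growth.free Y T) f) (hf1 : XSmooth κ (DelsarteDarboux.dX 1 f))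
    (hfd : ∀ d, XSmooth κ (dD Y T d f)) (hu : ∀ p ∈ region Y T, IsUnit (f p))
    (hm : κ.mem fun p => ‖Ring.inverse (f p)‖) : C1X κ fun p => Ring.inverse (f p) := by
  have hR := hf.xSmooth.inverse hκ hf1 hu hm
  exact .of_hasD hR (fun d => (hR.bilin isBoundedBilinearMap_mul' hκ
    ((hfd d).bilin isBoundedBilinearMap_mul' hκ hR)).neg)
    fun d p hp => (hf.hasD d p hp).inverse (hu p hp)

end Inverse

/-! ### Schwartz functions and moderate growth -/

section Schwartz

variable {E : Type*} [NormedAddCommGroup E] [NormedSpace ℝ E] {Y T : ℝ}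

theorem c1Schwartz_of_c1X [hY : Fact (0 < Y)] [hT : Fact (0 < T)] {f : Pt → E}
    (hf : C1X (Growth.rapid Y T) f) : C1Schwartz Y T f := by
  refine ⟨hf.c1Smooth, fun k m => ?_⟩
  have key : ∀ {g : Pt → E}, XSmooth (Growth.rapid Y T) g →
      ∃ C : ℝ, ∀ p ∈ region Y T, |p.1| ^ m * ‖dX k g p‖ ≤ C := by
    intro g hg
    obtain ⟨C, hC⟩ := (hg.dX k).mem m
    refine ⟨C, fun p hp => le_trans ?_ (hC p hp)⟩
    rw [abs_norm]
    gcongr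
    linarith
  obtain ⟨C₁, h₁⟩ := key hf.xSmooth
  obtain ⟨C₂, h₂⟩ := key (hf.xSmooth_dD false)
  obtain ⟨C₃, h₃⟩ := key (hf.xSmooth_dD true)
  exact ⟨max C₁ (max C₂ C₃), fun p hp => ⟨(h₁ p hp).trans (le_max_left _ _),
    (h₂ p hp).trans ((le_max_left _ _).trans (le_max_right _ _)),
    (h₃ p hp).trans ((le_max_right _ _).trans (le_max_right _ _))⟩⟩

theorem C1Schwartz.c1X [hY : Fact (0 < Y)] [hT : Fact (0 < T)] {f : Pt → E}
    (hf : C1Schwartz Y T f) : C1X (Growth.rapid Y T) f := by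
  have h := hf.1.c1X
  have key : ∀ {g : Pt → E}, XSmooth (Growth.free Y T) g →
      (∀ k m : ℕ, ∃ C : ℝ, ∀ p ∈ region Y T, |p.1| ^ m * ‖dX k g p‖ ≤ C) →
      XSmooth (Growth.rapid Y T) g := by
    intro g hg hb
    refine .of_dX (fun k => (hg.dX k).continuousOn) (fun k m => ?_)
      fun k p hp => (hg.hasDerivAt_dX k hp).differentiableAt
    obtain ⟨C₀, h₀⟩ := hb k 0
    obtain ⟨C, hC⟩ := hb k m
    refine ⟨2 ^ (m - 1) * (C₀ + C), fun p hp => ?_⟩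
    rw [abs_norm]
    have h0 := h₀ p hp
    have h1 := hC p hp
    rw [pow_zero, one_mul] at h0
    calc (1 + |p.1|) ^ m * ‖dX k g p‖
        ≤ (2 ^ (m - 1) * (1 ^ m + |p.1| ^ m)) * ‖dX k g p‖ := by
          gcongr
          exact add_pow_le zero_le_one (abs_nonneg _) m
      _ = 2 ^ (m - 1) * (‖dX k g p‖ + |p.1| ^ m * ‖dX k g p‖) := by ring
      _ ≤ _ := by gcongr
  refine ⟨key h.xSmooth fun k m => ?_, fun d => key (h.xSmooth_dD d) fun k m => ?_, h.hasD⟩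
  · obtain ⟨C, hC⟩ := hf.2 k m
    exact ⟨C, fun p hp => (hC p hp).1⟩
  · obtain ⟨C, hC⟩ := hf.2 k m
    cases d
    · exact ⟨C, fun p hp => (hC p hp).2.1⟩
    · exact ⟨C, fun p hp => (hC p hp).2.2⟩

theorem XSmooth.of_moderateGrowth {f : Pt → E} (hf : XSmooth (Growth.free Y T) f)
    (hm : ModerateGrowth Y T f) : XSmooth (Growth.moderate Y T) f :=
  .of_dX (fun k => (hf.dX k).continuousOn) (fun k => by
    obtain ⟨C, m, h⟩ := hm k
    exact ⟨C, m, fun p hp => by rw [abs_norm]; exact h p hp⟩)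
    fun k _ hp => (hf.hasDerivAt_dX k hp).differentiableAt

end Schwartz

/-! ### Dressing in an abstract Banach space -/

section Bilinear

/-- A bounded complex-bilinear map is bounded and bilinear over the reals. -/
theorem restrictReal {E F G : Type*} [NormedAddCommGroup E] [NormedSpace ℂ E]
    [NormedAddCommGroup F] [NormedSpace ℂ F] [NormedAddCommGroup G] [NormedSpace ℂ G]
    {m : E × F → G} (h : IsBoundedBilinearMap ℂ m) : IsBoundedBilinearMap ℝ m where
  add_left := h.add_left
  smul_left c x y := by
    rw [← Complex.coe_smul, h.smul_left, Complex.coe_smul]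
  add_right := h.add_right
  smul_right c x y := by
    rw [← Complex.coe_smul, h.smul_right, Complex.coe_smul]
  bound := h.bound

variable {H G : Type*} [NormedAddCommGroup H] [NormedSpace ℂ H] [NormedAddCommGroup G]
  [NormedSpace ℂ G]

theorem bilin_mul : IsBoundedBilinearMap ℝ fun q : ℂ × ℂ => q.1 * q.2 := isBoundedBilinearMap_mul'

theorem bilin_smul : IsBoundedBilinearMap ℝ fun q : ℂ × H => q.1 • q.2 :=
  restrictReal isBoundedBilinearMap_smul

theorem bilin_apply : IsBoundedBilinearMap ℝ fun q : (H →L[ℂ] G) × H => q.1 q.2 :=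
  restrictReal isBoundedBilinearMap_apply

theorem bilin_smulRight :
    IsBoundedBilinearMap ℝ fun q : (H →L[ℂ] ℂ) × G => q.1.smulRight q.2 :=
  restrictReal isBoundedBilinearMap_smulRight

theorem bilin_smulRight' :
    IsBoundedBilinearMap ℝ fun q : G × (H →L[ℂ] ℂ) => q.2.smulRight q.1 where
  add_left x x' y := bilin_smulRight.add_right y x x'
  smul_left c x y := bilin_smulRight.smul_right c y x
  add_right x y y' := bilin_smulRight.add_left y y' x
  smul_right c x y := bilin_smulRight.smul_left c y x
  bound := by
    obtain ⟨C, hC, h⟩ := (bilin_smulRight (H := H) (G := G)).bound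
    exact ⟨C, hC, fun x y => (h y x).trans_eq (by ring)⟩

end Bilinear

section Abstract

variable {H : Type*} [NormedAddCommGroup H] [NormedSpace ℂ H] {n N : ℕ} {Y T : ℝ}

/-- The entry `c` of the row `φ̄ᵀ A`, where `Φ` stands for `φ̄`. -/
def rowMul (A : Pt → Matrix (Fin N) (Fin N) ℂ) (Φ : Fin N → Pt → H) (c : Fin N) (q : Pt) : H :=
  ∑ r, A q r c • Φ r q

/-- The bilinear concomitant `Z[φ, h]` of `∑ᵢ aᵢ ∂ⁱ`, where `Φ` stands for `φ̄` and the products of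
entries are formed with `m`. -/
noncomputable def conc {E G : Type*} [NormedAddCommGroup E] [NormedSpace ℝ E] [AddCommGroup G]
    (m : H → E → G) (a : Coeff n N) (Φ : Fin N → Pt → H) (h : Fin N → Pt → E) (p : Pt) : G :=
  ∑ i : Fin (n + 1), ∑ k ∈ Finset.range (i : ℕ), (-1 : ℤ) ^ k • ∑ c,
    m (dX k (rowMul (a i) Φ c) p) (dX ((i : ℕ) - 1 - k) (h c) p)

/-- `∂/∂y - L` (for `false`) or `∂/∂t - L` (for `true`); these are `opY` and `opT` by definition. -/
noncomputable def opD (Y T : ℝ) (d : Bool) (a : Coeff n N) (f : Pt → Fin N → ℂ) (p : Pt) :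
    Fin N → ℂ :=
  dD Y T d f p - diffOp a f p

/-- The data of the dressing: a row `Φ = φ̄ᵀ` with entries in a Banach space `H`, a column `Ψ` of
functionals on `H`, and operators `Om` on `H` with `∂Om/∂x = φ̄ᵀψ`. -/
structure Dressing (Y T : ℝ) (Φ : Fin N → Pt → H) (Ψ : Fin N → Pt → H →L[ℂ] ℂ)
    (Om : Pt → H →L[ℂ] H) : Prop where
  c1X_Φ : ∀ c, C1X (Growth.free Y T) (Φ c)
  c1X_Ψ : ∀ c, C1X (Growth.free Y T) (Ψ c)
  c1X_Om : C1X (Growth.free Y T) Om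
  isUnit : ∀ p ∈ region Y T, IsUnit (Om p)
  hasDerivAt : ∀ p ∈ region Y T,
    HasDerivAt (fun x => Om (x, p.2)) (∑ c, (Ψ c p).smulRight (Φ c p)) p.1

/-- The evolution of the data in the direction `d` under the differential expression `a`: the
equations `𝓛 ψ = 0` and `𝓛* φ = 0`, the latter conjugated, and `∂Om/∂y = Z_L[φ, ψ]`. -/
structure Evolves (Y T : ℝ) (d : Bool) (a : Coeff n N) (Φ : Fin N → Pt → H)
    (Ψ : Fin N → Pt → H →L[ℂ] ℂ) (Om : Pt → H →L[ℂ] H) : Prop where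
  coeff : ∀ i r c, C1X (Growth.free Y T) fun p => a i p r c
  dD_Ψ : ∀ r, ∀ p ∈ region Y T,
    dD Y T d (Ψ r) p = ∑ i : Fin (n + 1), ∑ c, a i p r c • dX (i : ℕ) (Ψ c) p
  dD_Φ : ∀ c, ∀ p ∈ region Y T,
    dD Y T d (Φ c) p = -∑ i : Fin (n + 1), (-1 : ℤ) ^ (i : ℕ) • dX (i : ℕ) (rowMul (a i) Φ c) p
  dD_Om : ∀ p ∈ region Y T,
    dD Y T d Om p = conc (fun v (l : H →L[ℂ] ℂ) => l.smulRight v) a Φ Ψ p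

variable (Φ : Fin N → Pt → H) (Ψ : Fin N → Pt → H →L[ℂ] ℂ) (Om : Pt → H →L[ℂ] H)

/-- `∂⁻¹ (φ̄ᵀ f)`, the integration being from `x₀`. -/
noncomputable def potential (x₀ : ℝ) (f : Pt → Fin N → ℂ) : Pt → H :=
  prim x₀ fun q => ∑ c, f q c • Φ c q

/-- The Delsarte–Darboux operator `f ↦ f - Ψ Om⁻¹ ∂⁻¹ (φ̄ᵀ f)`. -/
noncomputable def dress (x₀ : ℝ) (f : Pt → Fin N → ℂ) (p : Pt) : Fin N → ℂ := fun r =>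
  f p r - Ψ r p (Ring.inverse (Om p) (potential Φ x₀ f p))

/-- The entries of the row `Om⁻¹ φ̄ᵀ`. -/
noncomputable def theta (c : Fin N) (p : Pt) : H := Ring.inverse (Om p) (Φ c p)

/-- If `f = g + Ψ v` with `∂v/∂x = (Om⁻¹ φ̄ᵀ) g`, then `∂ʲf = ∑ₖ Pⱼₖ ∂ᵏg + (∂ʲΨ) v`; these are the
matrix entries of `Pⱼₖ`. The recursion is that for the `x`-derivative of the right-hand side. -/
noncomputable def dressPow : ℕ → ℕ → Fin N → Fin N → Pt → ℂ
  | 0, k, r, c => fun _ => if k = 0 ∧ r = c then 1 else 0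
  | j + 1, 0, r, c => fun p =>
      dX 1 (dressPow j 0 r c) p + dX j (Ψ r) p (theta Φ Om c p)
  | j + 1, k + 1, r, c => fun p => dX 1 (dressPow j (k + 1) r c) p + dressPow j k r c p

/-- The coefficient of `∂ᵏ` in the dressed form of the monomial `A ∂ⁱ`. -/
noncomputable def dressTerm (i : ℕ) (A : Pt → Matrix (Fin N) (Fin N) ℂ) (k : ℕ) (r c : Fin N)
    (p : Pt) : ℂ :=
  ∑ s, A p r s * dressPow Φ Ψ Om i k s c p -
    Ψ r p (Ring.inverse (Om p) (∑ l ∈ Finset.range i, (-1 : ℤ) ^ l • ∑ s,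
      dressPow Φ Ψ Om (i - 1 - l) k s c p • dX l (rowMul A Φ s) p))

/-- The coefficients of the dressed differential expression. -/
noncomputable def dressCoeff (a : Coeff n N) : Coeff n N := fun k p => Matrix.of fun r c =>
  ∑ i : Fin (n + 1), dressTerm Φ Ψ Om i (a i) k r c p

variable {Φ Ψ Om}

theorem dressPow_of_lt {j k : ℕ} (h : j < k) (r c : Fin N) :
    dressPow Φ Ψ Om j k r c = fun _ => 0 := by
  induction j generalizing k with
  | zero =>
    obtain ⟨k, rfl⟩ := Nat.exists_eq_succ_of_ne_zero h.ne'
    simp [dressPow]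
  | succ j ih =>
    obtain ⟨k, rfl⟩ := Nat.exists_eq_succ_of_ne_zero (by omega : k ≠ 0)
    ext p
    rw [dressPow, ih (by omega), ih (by omega)]
    simp [dX]

/-- The expression `Pⱼ` has order `j` and leading coefficient `1`. -/
theorem dressPow_self (j : ℕ) (r c : Fin N) :
    dressPow Φ Ψ Om j j r c = fun _ => if r = c then 1 else 0 := by
  induction j with
  | zero => simp [dressPow]
  | succ j ih =>
    ext p
    rw [dressPow, dressPow_of_lt (by omega), ih]
    simp [dX]

section Regularity

variable [hY : Fact (0 < Y)] [hT : Fact (0 < T)] {κ ν : Growth Y T}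

theorem C1X.rowMul (hνκ : ν.Acts κ) {A : Pt → Matrix (Fin N) (Fin N) ℂ}
    (hA : ∀ r c, C1X κ fun p => A p r c) (hΦ : ∀ c, C1X ν (Φ c)) (c : Fin N) :
    C1X κ (rowMul A Φ c) :=
  .sum fun r _ => .bilin' bilin_smul hνκ (hA r c) (hΦ r)

theorem C1X.zsmul {E : Type*} [NormedAddCommGroup E] [NormedSpace ℝ E] {f : Pt → E}
    (hf : C1X κ f) (z : ℤ) : C1X κ fun p => z • f p := by
  simpa using hf.clm (z • ContinuousLinearMap.id ℝ E)

theorem C1X.conc {E G : Type*} [NormedAddCommGroup E] [NormedSpace ℝ E] [NormedAddCommGroup G]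
    [NormedSpace ℝ G] {m : H → E → G} (hm : IsBoundedBilinearMap ℝ fun q : H × E => m q.1 q.2)
    (hνκ : ν.Acts κ) {a : Coeff n N} (ha : ∀ i r c, C1X κ fun p => a i p r c)
    (hΦ : ∀ c, C1X ν (Φ c)) {h : Fin N → Pt → E} (hh : ∀ c, C1X ν (h c)) :
    C1X κ (conc m a Φ h) :=
  .sum fun i _ => .sum fun k _ => .zsmul (.sum fun c _ =>
    .bilin' hm hνκ ((C1X.rowMul hνκ (ha i) hΦ c).dX k) ((hh c).dX _)) _

theorem C1X.dressPow (hν : ν.Acts ν) (h1 : ∀ C : ℝ, ν.mem fun _ => C) (hΦ : ∀ c, C1X ν (Φ c))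
    (hΨ : ∀ c, C1X ν (Ψ c)) (hR : C1X ν fun p => Ring.inverse (Om p)) (j k : ℕ) (r c : Fin N) :
    C1X ν (dressPow Φ Ψ Om j k r c) := by
  induction j generalizing k with
  | zero => exact .const _ (h1 _)
  | succ j ih =>
    cases k with
    | zero =>
      exact ((ih 0).dX 1).add (.bilin bilin_apply hν ((hΨ r).dX j)
        (.bilin (m := fun (B : H →L[ℂ] H) (v : H) => B v) bilin_apply hν hR (hΦ c)))
    | succ k => exact ((ih (k + 1)).dX 1).add (ih k)

theorem C1X.dressTerm (hν : ν.Acts ν) (hνκ : ν.Acts κ) (h1 : ∀ C : ℝ, ν.mem fun _ => C)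
    (hΦ : ∀ c, C1X ν (Φ c)) (hΨ : ∀ c, C1X ν (Ψ c)) (hR : C1X ν fun p => Ring.inverse (Om p))
    {A : Pt → Matrix (Fin N) (Fin N) ℂ} (hA : ∀ r c, C1X κ fun p => A p r c) (i k : ℕ)
    (r c : Fin N) : C1X κ (dressTerm Φ Ψ Om i A k r c) := by
  have hP := C1X.dressPow hν h1 hΦ hΨ hR
  refine .sub (.sum fun s _ => .bilin' bilin_mul hνκ (hA r s) (hP i k s c)) ?_
  refine .bilin bilin_apply hνκ (hΨ r) (.bilin bilin_apply hνκ hR ?_)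
  exact .sum fun l _ => .zsmul (.sum fun s _ => .bilin bilin_smul hνκ (hP _ k s c)
    ((C1X.rowMul hνκ hA hΦ s).dX l)) _

theorem C1X.dressCoeff (hν : ν.Acts ν) (hνκ : ν.Acts κ) (h1 : ∀ C : ℝ, ν.mem fun _ => C)
    (hΦ : ∀ c, C1X ν (Φ c)) (hΨ : ∀ c, C1X ν (Ψ c)) (hR : C1X ν fun p => Ring.inverse (Om p))
    {a : Coeff n N} (ha : ∀ i r c, C1X κ fun p => a i p r c) (k : Fin (n + 1)) (r c : Fin N) :
    C1X κ fun p => dressCoeff Φ Ψ Om a k p r c := by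
  change C1X κ fun p => ∑ i : Fin (n + 1), DelsarteDarboux.dressTerm Φ Ψ Om i (a i) k r c p
  exact .sum fun i _ => .dressTerm hν hνκ h1 hΦ hΨ hR (ha i) i k r c

end Regularity

section Identities

variable {κ ν : Growth Y T}

/-- The Lagrange identity for a monomial: the sum telescopes. -/
theorem hasDerivAt_lagrange {w : Pt → H} {h : Pt → ℂ} (hw : XSmooth κ w) (hh : XSmooth ν h) (i : ℕ)
    {p : Pt} (hp : p ∈ region Y T) :
    HasDerivAt (fun x => ∑ k ∈ Finset.range i,
        (-1 : ℤ) ^ k • (dX (i - 1 - k) h (x, p.2) • dX k w (x, p.2)))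
      (dX i h p • w p - (-1 : ℤ) ^ i • (h p • dX i w p)) p.1 := by
  have h1 := HasDerivAt.fun_sum (u := Finset.range i) fun k _ =>
    (hasDerivAt_bilin bilin_smul (hh.hasDerivAt_dX (i - 1 - k) hp)
      (hw.hasDerivAt_dX k hp)).fun_const_smul ((-1 : ℝ) ^ k)
  have cast : ∀ (k : ℕ) (e : H), ((-1 : ℝ) ^ k) • e = ((-1 : ℤ) ^ k) • e := fun k e => by
    rw [← Int.cast_smul_eq_zsmul ℝ]; push_cast; rfl
  simp only [cast] at h1
  refine h1.congr_deriv ?_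
  have h2 := Finset.sum_range_sub' (fun k => (-1 : ℤ) ^ k • (dX (i - k) h p • dX k w p)) i
  simp only [Nat.sub_zero, pow_zero, one_smul, dX_zero, Nat.sub_self] at h2
  rw [← h2]
  refine Finset.sum_congr rfl fun k hk => ?_
  have hk := Finset.mem_range.1 hk
  rw [show i - 1 - k + 1 = i - k by omega, show i - 1 - k = i - (k + 1) by omega, pow_succ,
    mul_neg_one, neg_smul, sub_neg_eq_add, smul_add]

/-- The Lagrange identity `∂Z_L[φ, f]/∂x = φ̄ᵀ L f - (conj (L* φ))ᵀ f`. -/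
theorem hasDerivAt_conc {a : Coeff n N} {f : Pt → Fin N → ℂ}
    (ha : ∀ i c, XSmooth κ (rowMul (a i) Φ c)) (hf : ∀ c, XSmooth ν fun q => f q c)
    {p : Pt} (hp : p ∈ region Y T) :
    HasDerivAt (fun x => conc (fun v z => z • v) a Φ (fun c q => f q c) (x, p.2))
      (∑ c, (∑ i : Fin (n + 1), ∑ s, a i p c s • dX (i : ℕ) (fun q => f q s) p) • Φ c p
        - ∑ c, f p c • ∑ i : Fin (n + 1),
          (-1 : ℤ) ^ (i : ℕ) • dX (i : ℕ) (rowMul (a i) Φ c) p) p.1 := by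
  have h1 := HasDerivAt.fun_sum (u := Finset.univ) fun (i : Fin (n + 1)) _ =>
    HasDerivAt.fun_sum (u := Finset.univ) fun (c : Fin N) _ =>
      hasDerivAt_lagrange (ha i c) (hf c) i hp
  have e : (fun x => conc (fun v z => z • v) a Φ (fun c q => f q c) (x, p.2)) = fun x =>
      ∑ i : Fin (n + 1), ∑ c, ∑ k ∈ Finset.range (i : ℕ), (-1 : ℤ) ^ k •
        (dX ((i : ℕ) - 1 - k) (fun q => f q c) (x, p.2) • dX k (rowMul (a i) Φ c) (x, p.2)) := by
    funext x
    refine Finset.sum_congr rfl fun i _ => ?_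
    rw [Finset.sum_comm]
    exact Finset.sum_congr rfl fun k _ => Finset.smul_sum
  rw [e]
  refine h1.congr_deriv ?_
  simp only [Finset.sum_sub_distrib]
  congr 1
  · rw [Finset.sum_comm]
    simp only [rowMul, Finset.smul_sum, Finset.sum_smul]
    conv_rhs => rw [Finset.sum_comm]
    rw [Finset.sum_comm]
    refine Finset.sum_congr rfl fun i _ => ?_
    rw [Finset.sum_comm]
    refine Finset.sum_congr rfl fun r _ => Finset.sum_congr rfl fun s _ => ?_
    rw [smul_smul, smul_eq_mul, mul_comm]
  · rw [Finset.sum_comm]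
    refine Finset.sum_congr rfl fun c _ => ?_
    rw [Finset.smul_sum]
    exact Finset.sum_congr rfl fun i _ => smul_comm _ _ _

/-- The derivatives of `f = g + Ψ v` in terms of those of `g`. -/
theorem dX_eq_dressPow {f g : Pt → Fin N → ℂ} {v : Pt → H}
    (hP : ∀ j k r c, XSmooth κ (dressPow Φ Ψ Om j k r c)) (hΨ : ∀ c, XSmooth κ (Ψ c))
    (hf : ∀ c, XSmooth κ fun q => f q c) (hg : ∀ c, XSmooth κ fun q => g q c)
    (hfg : ∀ p ∈ region Y T, ∀ r, f p r = g p r + Ψ r p (v p))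
    (hv : ∀ p ∈ region Y T,
      HasDerivAt (fun x => v (x, p.2)) (∑ c, g p c • theta Φ Om c p) p.1)
    (K j : ℕ) (hj : j < K) (r : Fin N) {p : Pt} (hp : p ∈ region Y T) :
    dX j (fun q => f q r) p =
      ∑ k ∈ Finset.range K, ∑ c, dressPow Φ Ψ Om j k r c p * dX k (fun q => g q c) p
        + dX j (Ψ r) p (v p) := by
  induction j generalizing p with
  | zero =>
    rw [dX_zero, dX_zero, hfg p hp, Finset.sum_eq_single_of_mem 0 (Finset.mem_range.2 hj)]
    · simp [dressPow, dX_zero]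
    · intro k _ hk
      simp [dressPow, hk]
  | succ j ih =>
    have h1 : HasDerivAt (fun x => dX j (fun q => f q r) (x, p.2))
        (∑ k ∈ Finset.range K, ∑ c, (dX 1 (dressPow Φ Ψ Om j k r c) p * dX k (fun q => g q c) p
          + dressPow Φ Ψ Om j k r c p * dX (k + 1) (fun q => g q c) p)
          + (dX (j + 1) (Ψ r) p (v p) + dX j (Ψ r) p (∑ c, g p c • theta Φ Om c p))) p.1 := by
      have e : (fun x => dX j (fun q => f q r) (x, p.2)) = fun x =>
          ∑ k ∈ Finset.range K, ∑ c, dressPow Φ Ψ Om j k r c (x, p.2)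
            * dX k (fun q => g q c) (x, p.2) + dX j (Ψ r) (x, p.2) (v (x, p.2)) :=
        funext fun x => ih (by omega) (line_mem_region hp x)
      rw [e]
      refine HasDerivAt.fun_add (.fun_sum fun k _ => .fun_sum fun c _ => ?_) ?_
      · exact hasDerivAt_bilin bilin_mul ((hP j k r c).hasDerivAt hp) ((hg c).hasDerivAt_dX k hp)
      · exact hasDerivAt_bilin bilin_apply ((hΨ r).hasDerivAt_dX j hp) (hv p hp)
    rw [← ((hf r).hasDerivAt_dX j hp).unique h1 |>.symm]
    obtain ⟨K, rfl⟩ := Nat.exists_eq_succ_of_ne_zero (by omega : K ≠ 0)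
    simp only [Nat.succ_eq_add_one, Finset.sum_add_distrib]
    rw [Finset.sum_range_succ' (fun k => ∑ c, dX 1 (dressPow Φ Ψ Om j k r c) p * _),
      Finset.sum_range_succ (fun k => ∑ c, dressPow Φ Ψ Om j k r c p * _),
      Finset.sum_range_succ' (fun k => ∑ c, dressPow Φ Ψ Om (j + 1) k r c p * _)]
    simp only [dressPow, dressPow_of_lt (show j < K by omega), zero_mul, Finset.sum_const_zero,
      add_mul, Finset.sum_add_distrib, dX_zero, map_sum, map_smul, smul_eq_mul, add_zero]
    have e2 : ∑ c, dX j (Ψ r) p (theta Φ Om c p) * g p c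
        = ∑ c, g p c * dX j (Ψ r) p (theta Φ Om c p) :=
      Finset.sum_congr rfl fun c _ => mul_comm _ _
    rw [e2]
    ring

end Identities

end Abstract

/-! ### The Delsarte–Darboux operator: inversion and intertwining -/

section Intertwining

variable {H : Type*} [NormedAddCommGroup H] [NormedSpace ℂ H] {n N : ℕ} {Y T : ℝ}

/-- The inverse `g ↦ g + Ψ ∂⁻¹ (Om⁻¹ φ̄ᵀ g)` of the Delsarte–Darboux operator. -/
noncomputable def undress (Φ : Fin N → Pt → H) (Ψ : Fin N → Pt → H →L[ℂ] ℂ)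
    (Om : Pt → H →L[ℂ] H) (x₀ : ℝ) (g : Pt → Fin N → ℂ) (p : Pt) : Fin N → ℂ := fun r =>
  g p r + Ψ r p (potential (theta Φ Om) x₀ g p)

theorem potential_base (Φ : Fin N → Pt → H) {x₀ : ℝ} (f : Pt → Fin N → ℂ) {p : Pt}
    (hp : p.1 = x₀) : potential Φ x₀ f p = 0 := prim_base _ hp

theorem potential_congr {Φ : Fin N → Pt → H} {x₀ : ℝ} {f g : Pt → Fin N → ℂ}
    (h : EqOn f g (region Y T)) : EqOn (potential Φ x₀ f) (potential Φ x₀ g) (region Y T) :=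
  prim_congr fun p hp => by simp only [h hp]

theorem dress_congr {Φ : Fin N → Pt → H} {Ψ : Fin N → Pt → H →L[ℂ] ℂ} {Om : Pt → H →L[ℂ] H}
    {x₀ : ℝ} {f g : Pt → Fin N → ℂ} (h : EqOn f g (region Y T)) :
    EqOn (dress Φ Ψ Om x₀ f) (dress Φ Ψ Om x₀ g) (region Y T) := fun p hp => by
  ext r
  simp only [dress, h hp, potential_congr h hp]

theorem diffOp_congr {a : Coeff n N} {f g : Pt → Fin N → ℂ} (h : EqOn f g (region Y T)) :
    EqOn (diffOp a f) (diffOp a g) (region Y T) := fun p hp => by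
  ext r
  simp only [diffOp, dX_congr h _ hp]

theorem opD_congr {a : Coeff n N} {d : Bool} {f g : Pt → Fin N → ℂ} (h : EqOn f g (region Y T)) :
    EqOn (opD Y T d a f) (opD Y T d a g) (region Y T) := fun p hp => by
  simp only [opD, dD_congr h d hp, diffOp_congr h hp]

theorem diffOp_apply {κ : Growth Y T} {a : Coeff n N} {f : Pt → Fin N → ℂ}
    (hf : XSmooth κ f) {p : Pt} (hp : p ∈ region Y T) (r : Fin N) :
    diffOp a f p r = ∑ i : Fin (n + 1), ∑ s, a i p r s * dX (i : ℕ) (fun q => f q s) p := by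
  simp only [diffOp, dX_apply hf _ _ hp, smul_eq_mul]

theorem C1X.potential [hY : Fact (0 < Y)] [hT : Fact (0 < T)] [CompleteSpace H]
    {Φ : Fin N → Pt → H} (hΦ : ∀ c, C1X (Growth.free Y T) (Φ c)) (x₀ : ℝ) {f : Pt → Fin N → ℂ}
    (hf : C1X (Growth.free Y T) f) : C1X (Growth.free Y T) (potential Φ x₀ f) :=
  .prim x₀ (.sum fun c _ => .bilin bilin_smul (Growth.acts_free _) (hf.comp c) (hΦ c))

theorem XSmooth.potential [hY : Fact (0 < Y)] [hT : Fact (0 < T)] [CompleteSpace H]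
    {Φ : Fin N → Pt → H} (hΦ : ∀ c, XSmooth (Growth.free Y T) (Φ c)) {A : Set Pt} {x₀ : ℝ}
    (hA : ∀ p ∈ A, p.1 = x₀) {f : Pt → Fin N → ℂ} (hf : XSmooth (Growth.vanishing Y T A) f) :
    XSmooth (Growth.vanishing Y T A) (potential Φ x₀ f) :=
  .prim hA hY.out.le hT.out.le (.sum fun c _ =>
    .bilin' bilin_smul (Growth.acts_vanishing _ _) (hf.comp c) (hΦ c))

theorem continuousOn_pairing {Φ : Fin N → Pt → H} {f : Pt → Fin N → ℂ} {s : Set Pt}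
    (hΦ : ∀ c, ContinuousOn (Φ c) s) (hf : ContinuousOn f s) :
    ContinuousOn (fun q => ∑ c, f q c • Φ c q) s :=
  continuousOn_finsetSum _ fun c _ => ((continuous_apply c).comp_continuousOn hf).smul (hΦ c)

namespace Dressing

variable [hY : Fact (0 < Y)] [hT : Fact (0 < T)] [CompleteSpace H] {Φ : Fin N → Pt → H}
  {Ψ : Fin N → Pt → H →L[ℂ] ℂ} {Om : Pt → H →L[ℂ] H}

omit hY hT [CompleteSpace H] in
theorem Om_inverse (D : Dressing Y T Φ Ψ Om) {p : Pt} (hp : p ∈ region Y T) (v : H) :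
    Om p (Ring.inverse (Om p) v) = v :=
  DFunLike.congr_fun (Ring.mul_inverse_cancel _ (D.isUnit p hp)) v

omit hY hT [CompleteSpace H] in
theorem inverse_Om (D : Dressing Y T Φ Ψ Om) {p : Pt} (hp : p ∈ region Y T) (v : H) :
    Ring.inverse (Om p) (Om p v) = v :=
  DFunLike.congr_fun (Ring.inverse_mul_cancel _ (D.isUnit p hp)) v

theorem c1X_inverse (D : Dressing Y T Φ Ψ Om) :
    C1X (Growth.free Y T) fun p => Ring.inverse (Om p) :=
  D.c1X_Om.inverse (Growth.acts_free _) (D.c1X_Om.xSmooth.dX 1) D.c1X_Om.xSmooth_dD D.isUnit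
    (Growth.free_mem _)

theorem c1X_theta (D : Dressing Y T Φ Ψ Om) (c : Fin N) : C1X (Growth.free Y T) (theta Φ Om c) :=
  .bilin (m := fun (B : H →L[ℂ] H) (v : H) => B v) bilin_apply (Growth.acts_free _) D.c1X_inverse
    (D.c1X_Φ c)

theorem c1X_dressPow (D : Dressing Y T Φ Ψ Om) (j k : ℕ) (r c : Fin N) :
    C1X (Growth.free Y T) (dressPow Φ Ψ Om j k r c) :=
  .dressPow (Growth.acts_free _) (fun _ => Growth.free_mem _) D.c1X_Φ D.c1X_Ψ D.c1X_inverse j k r c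

theorem c1X_correction (D : Dressing Y T Φ Ψ Om) (x₀ : ℝ) {f : Pt → Fin N → ℂ}
    (hf : C1X (Growth.free Y T) f) :
    C1X (Growth.free Y T) fun p => Ring.inverse (Om p) (potential Φ x₀ f p) :=
  .bilin (m := fun (B : H →L[ℂ] H) (v : H) => B v) bilin_apply (Growth.acts_free _) D.c1X_inverse
    (.potential D.c1X_Φ x₀ hf)

theorem c1X_dress (D : Dressing Y T Φ Ψ Om) (x₀ : ℝ) {f : Pt → Fin N → ℂ}
    (hf : C1X (Growth.free Y T) f) : C1X (Growth.free Y T) (dress Φ Ψ Om x₀ f) :=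
  .pi fun r => (hf.comp r).sub (.bilin bilin_apply (Growth.acts_free _) (D.c1X_Ψ r)
    (D.c1X_correction x₀ hf))

theorem c1X_undress (D : Dressing Y T Φ Ψ Om) (x₀ : ℝ) {f : Pt → Fin N → ℂ}
    (hf : C1X (Growth.free Y T) f) : C1X (Growth.free Y T) (undress Φ Ψ Om x₀ f) :=
  .pi fun r => (hf.comp r).add (.bilin bilin_apply (Growth.acts_free _) (D.c1X_Ψ r)
    (.potential D.c1X_theta x₀ hf))

theorem xSmooth_dress (D : Dressing Y T Φ Ψ Om) {A : Set Pt} {x₀ : ℝ} (hA : ∀ p ∈ A, p.1 = x₀)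
    {f : Pt → Fin N → ℂ} (hf : XSmooth (Growth.vanishing Y T A) f) :
    XSmooth (Growth.vanishing Y T A) (dress Φ Ψ Om x₀ f) :=
  .pi fun r => (hf.comp r).sub (.bilin bilin_apply (Growth.acts_vanishing _ _)
    (D.c1X_Ψ r).xSmooth (.bilin (m := fun (B : H →L[ℂ] H) (v : H) => B v) bilin_apply
      (Growth.acts_vanishing _ _) D.c1X_inverse.xSmooth
      (.potential (fun c => (D.c1X_Φ c).xSmooth) hA hf)))

theorem xSmooth_undress (D : Dressing Y T Φ Ψ Om) {A : Set Pt} {x₀ : ℝ} (hA : ∀ p ∈ A, p.1 = x₀)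
    {f : Pt → Fin N → ℂ} (hf : XSmooth (Growth.vanishing Y T A) f) :
    XSmooth (Growth.vanishing Y T A) (undress Φ Ψ Om x₀ f) :=
  .pi fun r => (hf.comp r).add (.bilin bilin_apply (Growth.acts_vanishing _ _)
    (D.c1X_Ψ r).xSmooth (.potential (fun c => (D.c1X_theta c).xSmooth) hA hf))

omit hY hT in
/-- `v = Om⁻¹ ∂⁻¹(φ̄ᵀ f)` satisfies `∂v/∂x = Om⁻¹ φ̄ᵀ 𝛀 f`: the derivative of `Om⁻¹` contributes
`-Om⁻¹ φ̄ᵀ ψ v`. -/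
theorem hasDerivAt_correction (D : Dressing Y T Φ Ψ Om) (x₀ : ℝ) {f : Pt → Fin N → ℂ}
    (hf : ContinuousOn f (region Y T)) {p : Pt} (hp : p ∈ region Y T) :
    HasDerivAt (fun x => Ring.inverse (Om (x, p.2)) (potential Φ x₀ f (x, p.2)))
      (∑ c, dress Φ Ψ Om x₀ f p c • theta Φ Om c p) p.1 := by
  have h1 := hasDerivWithinAt_univ.1 (hasDerivWithinAt_inverse (D.isUnit p hp)
    (D.hasDerivAt p hp).hasDerivWithinAt)
  have h2 := hasDerivAt_prim x₀ (continuousOn_pairing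
    (fun c => (D.c1X_Φ c).xSmooth.continuousOn) hf) hp
  refine (hasDerivAt_bilin bilin_apply h1 h2).congr_deriv ?_
  change -(Ring.inverse (Om p) ((∑ c, (Ψ c p).smulRight (Φ c p))
    (Ring.inverse (Om p) (potential Φ x₀ f p)))) + Ring.inverse (Om p) (∑ c, f p c • Φ c p) = _
  simp only [sum_apply, ContinuousLinearMap.smulRight_apply, map_sum, map_smul,
    dress, theta, sub_smul, Finset.sum_sub_distrib]
  abel

theorem correction_eq (D : Dressing Y T Φ Ψ Om) (x₀ : ℝ) {f : Pt → Fin N → ℂ}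
    (hf : C1X (Growth.free Y T) f) {p : Pt} (hp : p ∈ region Y T) :
    Ring.inverse (Om p) (potential Φ x₀ f p)
      = potential (theta Φ Om) x₀ (dress Φ Ψ Om x₀ f) p := by
  have h := prim_eq_sub x₀ (g := fun p => Ring.inverse (Om p) (potential Φ x₀ f p))
    (continuousOn_pairing (fun c => (D.c1X_theta c).xSmooth.continuousOn)
      (D.c1X_dress x₀ hf).xSmooth.continuousOn)
    (fun p hp => D.hasDerivAt_correction x₀ hf.xSmooth.continuousOn hp) hp
  simp only [potential_base Φ f (p := (x₀, p.2)) rfl, map_zero, sub_zero] at h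
  exact h.symm

theorem undress_dress (D : Dressing Y T Φ Ψ Om) (x₀ : ℝ) {f : Pt → Fin N → ℂ}
    (hf : C1X (Growth.free Y T) f) {p : Pt} (hp : p ∈ region Y T) :
    undress Φ Ψ Om x₀ (dress Φ Ψ Om x₀ f) p = f p := by
  ext r
  rw [undress, ← D.correction_eq x₀ hf hp, dress, sub_add_cancel]

theorem dress_undress (D : Dressing Y T Φ Ψ Om) (x₀ : ℝ) {g : Pt → Fin N → ℂ}
    (hg : C1X (Growth.free Y T) g) {p : Pt} (hp : p ∈ region Y T) :
    dress Φ Ψ Om x₀ (undress Φ Ψ Om x₀ g) p = g p := by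
  have hcg := continuousOn_pairing (fun c => (D.c1X_theta c).xSmooth.continuousOn)
    hg.xSmooth.continuousOn
  have hcf := continuousOn_pairing (fun c => (D.c1X_Φ c).xSmooth.continuousOn)
    (D.c1X_undress x₀ hg).xSmooth.continuousOn
  have h := prim_eq_sub x₀ (g := fun p => Om p (potential (theta Φ Om) x₀ g p)) hcf
    (fun q hq => by
      refine (hasDerivAt_bilin bilin_apply (D.hasDerivAt q hq)
        (hasDerivAt_prim x₀ hcg hq)).congr_deriv ?_
      change (∑ c, (Ψ c q).smulRight (Φ c q)) (potential (theta Φ Om) x₀ g q)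
        + Om q (∑ c, g q c • theta Φ Om c q) = _
      simp only [sum_apply, ContinuousLinearMap.smulRight_apply, map_sum,
        map_smul, undress, theta, D.Om_inverse hq, add_smul, Finset.sum_add_distrib]
      abel) hp
  simp only [potential_base (theta Φ Om) g (p := (x₀, p.2)) rfl, map_zero, sub_zero] at h
  ext r
  rw [dress, potential, h, D.inverse_Om hp, undress, add_sub_cancel_right]

variable {d : Bool} {a : Coeff n N}

theorem c1X_dressCoeff (D : Dressing Y T Φ Ψ Om) (V : Evolves Y T d a Φ Ψ Om) (k : Fin (n + 1))
    (r c : Fin N) : C1X (Growth.free Y T) fun p => dressCoeff Φ Ψ Om a k p r c :=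
  .dressCoeff (Growth.acts_free _) (Growth.acts_free _) (fun _ => Growth.free_mem _) D.c1X_Φ
    D.c1X_Ψ D.c1X_inverse V.coeff k r c

omit [CompleteSpace H] in
theorem c1X_rowMul (D : Dressing Y T Φ Ψ Om) (V : Evolves Y T d a Φ Ψ Om) (i : Fin (n + 1))
    (c : Fin N) : C1X (Growth.free Y T) (rowMul (a i) Φ c) :=
  .rowMul (Growth.acts_free _) (V.coeff i) D.c1X_Φ c

/-- The dressed differential expression applied to `𝛀 f`, in terms of `f`: it is
`L f - (LΨ) v - Ψ Om⁻¹ (Z_L[φ, f] - Z_L[φ, ψ] v)` with `v = Om⁻¹ ∂⁻¹(φ̄ᵀ f)`. -/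
theorem diffOp_dressCoeff (D : Dressing Y T Φ Ψ Om) (x₀ : ℝ) {f : Pt → Fin N → ℂ}
    (hf : C1X (Growth.free Y T) f) {p : Pt} (hp : p ∈ region Y T) (r : Fin N) :
    diffOp (dressCoeff Φ Ψ Om a) (dress Φ Ψ Om x₀ f) p r = diffOp a f p r
      - (∑ i : Fin (n + 1), ∑ c, a i p r c • dX (i : ℕ) (Ψ c) p)
          (Ring.inverse (Om p) (potential Φ x₀ f p))
      - Ψ r p (Ring.inverse (Om p) (conc (fun v z => z • v) a Φ (fun c q => f q c) p
          - conc (fun v (l : H →L[ℂ] ℂ) => l.smulRight v) a Φ Ψ p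
            (Ring.inverse (Om p) (potential Φ x₀ f p)))) := by
  have hg := D.c1X_dress x₀ hf
  have key := dX_eq_dressPow (v := fun p => Ring.inverse (Om p) (potential Φ x₀ f p))
    (f := f) (g := dress Φ Ψ Om x₀ f)
    (fun j k r c => (D.c1X_dressPow j k r c).xSmooth) (fun c => (D.c1X_Ψ c).xSmooth)
    (fun c => (hf.comp c).xSmooth) (fun c => (hg.comp c).xSmooth)
    (fun p _ r => by rw [dress, sub_add_cancel])
    (fun p hp => D.hasDerivAt_correction x₀ hf.xSmooth.continuousOn hp) (n + 1)
  set v := Ring.inverse (Om p) (potential Φ x₀ f p) with hv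
  -- the action of the `j`-th matrix power on `𝛀 f`
  have hS : ∀ j < n + 1, ∀ s, ∑ k : Fin (n + 1), ∑ c, dressPow Φ Ψ Om j k s c p
      * dX (k : ℕ) (fun q => dress Φ Ψ Om x₀ f q c) p
      = dX j (fun q => f q s) p - dX j (Ψ s) p v := fun j hj s => by
    rw [key j hj s hp, add_sub_cancel_right]
    exact Fin.sum_univ_eq_sum_range (fun k => ∑ c, dressPow Φ Ψ Om j k s c p
      * dX k (fun q => dress Φ Ψ Om x₀ f q c) p) (n + 1)
  -- the dressed form of `aᵢ ∂ⁱ`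
  have hT' : ∀ i : Fin (n + 1), ∑ k : Fin (n + 1), ∑ c, dressTerm Φ Ψ Om i (a i) k r c p
      * dX (k : ℕ) (fun q => dress Φ Ψ Om x₀ f q c) p
      = ∑ s, a i p r s * (dX (i : ℕ) (fun q => f q s) p - dX (i : ℕ) (Ψ s) p v)
        - Ψ r p (Ring.inverse (Om p) (∑ l ∈ Finset.range (i : ℕ), (-1 : ℤ) ^ l • ∑ s,
          (dX ((i : ℕ) - 1 - l) (fun q => f q s) p - dX ((i : ℕ) - 1 - l) (Ψ s) p v)
            • dX l (rowMul (a i) Φ s) p)) := by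
    intro i
    have e1 : ∑ s, a i p r s * (dX (i : ℕ) (fun q => f q s) p - dX (i : ℕ) (Ψ s) p v)
        = ∑ k : Fin (n + 1), ∑ c, (∑ s, a i p r s * dressPow Φ Ψ Om i k s c p)
          * dX (k : ℕ) (fun q => dress Φ Ψ Om x₀ f q c) p := by
      simp only [← hS i i.2, Finset.mul_sum, Finset.sum_mul]
      rw [Finset.sum_comm]
      refine Finset.sum_congr rfl fun k _ => ?_
      rw [Finset.sum_comm]
      exact Finset.sum_congr rfl fun c _ => Finset.sum_congr rfl fun s _ => by ring
    have e2 : ∑ l ∈ Finset.range (i : ℕ), (-1 : ℤ) ^ l • ∑ s,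
          (dX ((i : ℕ) - 1 - l) (fun q => f q s) p - dX ((i : ℕ) - 1 - l) (Ψ s) p v)
            • dX l (rowMul (a i) Φ s) p
        = ∑ k : Fin (n + 1), ∑ c, dX (k : ℕ) (fun q => dress Φ Ψ Om x₀ f q c) p •
          ∑ l ∈ Finset.range (i : ℕ), (-1 : ℤ) ^ l • ∑ s,
            dressPow Φ Ψ Om ((i : ℕ) - 1 - l) k s c p • dX l (rowMul (a i) Φ s) p := by
      simp only [Finset.smul_sum]
      have e3 : ∀ l ∈ Finset.range (i : ℕ), ∑ s, (-1 : ℤ) ^ l •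
          (dX ((i : ℕ) - 1 - l) (fun q => f q s) p - dX ((i : ℕ) - 1 - l) (Ψ s) p v)
            • dX l (rowMul (a i) Φ s) p
          = ∑ k : Fin (n + 1), ∑ c, ∑ s, dX (k : ℕ) (fun q => dress Φ Ψ Om x₀ f q c) p •
            (-1 : ℤ) ^ l • dressPow Φ Ψ Om ((i : ℕ) - 1 - l) k s c p
              • dX l (rowMul (a i) Φ s) p := by
        intro l hl
        have hl' : (i : ℕ) - 1 - l < n + 1 := by omega
        simp only [← hS _ hl', Finset.sum_smul, Finset.smul_sum]
        rw [Finset.sum_comm]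
        refine Finset.sum_congr rfl fun k _ => ?_
        rw [Finset.sum_comm]
        refine Finset.sum_congr rfl fun c _ => Finset.sum_congr rfl fun s _ => ?_
        rw [mul_smul, smul_comm (dX _ _ _) ((-1 : ℤ) ^ l), smul_comm (dX _ _ _)]
      rw [Finset.sum_congr rfl e3, Finset.sum_comm]
      refine Finset.sum_congr rfl fun k _ => ?_
      rw [Finset.sum_comm]
    rw [e1, e2]
    simp only [map_sum (Ring.inverse (Om p)), map_sum (Ψ r p), map_smul, smul_eq_mul,
      ← Finset.sum_sub_distrib]
    refine Finset.sum_congr rfl fun k _ => Finset.sum_congr rfl fun c _ => ?_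
    rw [dressTerm, sub_mul]
    simp only [map_sum]
    ring
  rw [diffOp_apply hg.xSmooth hp, diffOp_apply hf.xSmooth hp]
  have e4 : ∑ k : Fin (n + 1), ∑ c, dressCoeff Φ Ψ Om a k p r c
      * dX (k : ℕ) (fun q => dress Φ Ψ Om x₀ f q c) p
      = ∑ i : Fin (n + 1), ∑ k : Fin (n + 1), ∑ c, dressTerm Φ Ψ Om i (a i) k r c p
        * dX (k : ℕ) (fun q => dress Φ Ψ Om x₀ f q c) p := by
    simp only [dressCoeff, Matrix.of_apply, Finset.sum_mul]
    rw [Finset.sum_comm]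
    conv_rhs => rw [Finset.sum_comm]
    rw [Finset.sum_comm]
    refine Finset.sum_congr rfl fun k _ => ?_
    rw [Finset.sum_comm]
  rw [e4, Finset.sum_congr rfl fun i _ => hT' i, Finset.sum_sub_distrib]
  congr 1
  · simp only [mul_sub, Finset.sum_sub_distrib, sum_apply,
      smul_apply, smul_eq_mul]
  · rw [← map_sum, ← map_sum]
    congr 2
    simp only [conc, sum_apply, smul_apply,
      ContinuousLinearMap.smulRight_apply, sub_smul, Finset.sum_sub_distrib, smul_sub]

/-- `∂⁻¹(φ̄ᵀ 𝓛 f)` differs from the derivative of `∂⁻¹(φ̄ᵀ f)` in `y` or `t` only by the concomitant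
`Z_L[φ, f]`, if this vanishes at `x₀`. -/
theorem potential_opD (D : Dressing Y T Φ Ψ Om) (V : Evolves Y T d a Φ Ψ Om) (x₀ : ℝ)
    {f : Pt → Fin N → ℂ} (hf : C1X (Growth.free Y T) f)
    (h₀ : ∀ p ∈ region Y T, p.1 = x₀ → conc (fun v z => z • v) a Φ (fun c q => f q c) p = 0)
    {p : Pt} (hp : p ∈ region Y T) :
    potential Φ x₀ (opD Y T d a f) p = dD Y T d (potential Φ x₀ f) p
      - conc (fun v z => z • v) a Φ (fun c q => f q c) p := by
  have hF : C1X (Growth.free Y T) fun q => ∑ c, f q c • Φ c q :=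
    .sum fun c _ => .bilin bilin_smul (Growth.acts_free _) (hf.comp c) (D.c1X_Φ c)
  have h1 : dD Y T d (potential Φ x₀ f) p = prim x₀ (dD Y T d fun q => ∑ c, f q c • Φ c q) p :=
    (hasD_prim x₀ hF.xSmooth.continuousOn (hF.xSmooth_dD d).continuousOn
      (fun p hp => hF.hasD d p hp) hp).dD_eq hp
  have hdF : ∀ q ∈ region Y T, dD Y T d (fun q => ∑ c, f q c • Φ c q) q
      = ∑ c, (dD Y T d f q c • Φ c q + f q c • dD Y T d (Φ c) q) := fun q hq => by
    refine HasD.dD_eq hq (.sum fun c _ => ?_)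
    rw [hf.dD_apply d c hq]
    exact .bilin (m := fun (z : ℂ) (v : H) => z • v) bilin_smul ((hf.comp c).hasD d q hq)
      ((D.c1X_Φ c).hasD d q hq)
  have hopD : ContinuousOn (fun q => ∑ c, opD Y T d a f q c • Φ c q) (region Y T) := by
    refine continuousOn_pairing (fun c => (D.c1X_Φ c).xSmooth.continuousOn) ?_
    refine (hf.xSmooth_dD d).continuousOn.sub (continuousOn_pi.2 fun r => ?_)
    exact continuousOn_finsetSum _ fun i _ => continuousOn_finsetSum _ fun s _ =>
      (V.coeff i r s).xSmooth.continuousOn.smul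
        ((continuous_apply s).comp_continuousOn (hf.xSmooth.dX i).continuousOn)
  have hL := prim_eq_sub x₀ (g := conc (fun v z => z • v) a Φ fun c q => f q c)
    (h := fun q => dD Y T d (fun q => ∑ c, f q c • Φ c q) q - ∑ c, opD Y T d a f q c • Φ c q)
    ((hF.xSmooth_dD d).continuousOn.sub hopD) (fun q hq => by
      refine (hasDerivAt_conc (fun i c => (D.c1X_rowMul V i c).xSmooth)
        (fun c => (hf.comp c).xSmooth) hq).congr_deriv ?_
      rw [hdF q hq]
      simp only [opD, Pi.sub_apply, diffOp_apply hf.xSmooth hq, V.dD_Φ _ q hq, smul_neg, sub_smul,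
        smul_eq_mul,
        Finset.sum_add_distrib, Finset.sum_sub_distrib, Finset.sum_neg_distrib]
      abel) hp
  have hsub : prim x₀ (fun q => dD Y T d (fun q => ∑ c, f q c • Φ c q) q
      - ∑ c, opD Y T d a f q c • Φ c q) p
      = prim x₀ (dD Y T d fun q => ∑ c, f q c • Φ c q) p
        - prim x₀ (fun q => ∑ c, opD Y T d a f q c • Φ c q) p :=
    intervalIntegral.integral_sub
      ((continuous_line (hF.xSmooth_dD d).continuousOn hp).intervalIntegrable _ _)
      ((continuous_line hopD hp).intervalIntegrable _ _)
  rw [h₀ (x₀, p.2) (line_mem_region hp x₀) rfl, sub_zero, hsub] at hL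
  rw [h1, potential, ← hL]
  abel

/-- The intertwining relation `𝛀 𝓛 f = 𝓛̃ 𝛀 f` for functions without boundary term. -/
theorem dress_opD (D : Dressing Y T Φ Ψ Om) (V : Evolves Y T d a Φ Ψ Om) (x₀ : ℝ)
    {f : Pt → Fin N → ℂ} (hf : C1X (Growth.free Y T) f)
    (h₀ : ∀ p ∈ region Y T, p.1 = x₀ → conc (fun v z => z • v) a Φ (fun c q => f q c) p = 0)
    {p : Pt} (hp : p ∈ region Y T) :
    dress Φ Ψ Om x₀ (opD Y T d a f) p
      = opD Y T d (dressCoeff Φ Ψ Om a) (dress Φ Ψ Om x₀ f) p := by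
  ext r
  have hg := D.c1X_dress x₀ hf
  have hu := C1X.potential D.c1X_Φ x₀ hf
  have hgd : dD Y T d (fun q => dress Φ Ψ Om x₀ f q r) p = dD Y T d f p r
      - (dD Y T d (Ψ r) p (Ring.inverse (Om p) (potential Φ x₀ f p))
        + Ψ r p ((-(Ring.inverse (Om p) * (dD Y T d Om p * Ring.inverse (Om p))))
            (potential Φ x₀ f p)
          + Ring.inverse (Om p) (dD Y T d (potential Φ x₀ f) p))) := by
    rw [hf.dD_apply d r hp]
    exact HasD.dD_eq hp (.sub ((hf.comp r).hasD d p hp)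
      (.bilin (m := fun (l : H →L[ℂ] ℂ) (v : H) => l v) bilin_apply ((D.c1X_Ψ r).hasD d p hp)
        (.bilin (m := fun (B : H →L[ℂ] H) (v : H) => B v) bilin_apply
          ((D.c1X_Om.hasD d p hp).inverse (D.isUnit p hp)) (hu.hasD d p hp))))
  rw [dress, D.potential_opD V x₀ hf h₀ hp]
  simp only [opD, Pi.sub_apply]
  rw [hg.dD_apply d r hp, hgd, D.diffOp_dressCoeff x₀ hf hp r, V.dD_Ψ r p hp, V.dD_Om p hp]
  simp only [neg_apply, mul_apply_eq_comp, map_sub, map_add,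
    map_neg]
  ring

end Dressing

end Intertwining

/-! ### The commutator of two evolution operators -/

section Commutator

open Filter Topology

variable {n m N : ℕ} {Y T : ℝ}

section Regularity

variable [hY : Fact (0 < Y)] [hT : Fact (0 < T)]

theorem C1X.of_contDiff {E : Type*} [NormedAddCommGroup E] [NormedSpace ℝ E] {f : Pt → E}
    (hf : ContDiff ℝ ∞ f) : C1X (Growth.free Y T) f ∧ ∀ d, C1X (Growth.free Y T) (dD Y T d f) := by
  have hfd : ∀ {f : Pt → E}, ContDiff ℝ ∞ f → ∀ v : Pt, ContDiff ℝ ∞ fun p => fderiv ℝ f p v :=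
    fun hf v => (hf.fderiv_right (m := ∞) (by simp)).clm_apply contDiff_const
  have hx : ∀ {f : Pt → E}, ContDiff ℝ ∞ f → XSmooth (Growth.free Y T) f := by
    intro f hf k
    induction k generalizing f with
    | zero => exact ⟨hf.continuous.continuousOn, Growth.free_mem _⟩
    | succ k ih =>
      refine .succ hf.continuous.continuousOn (Growth.free_mem _) (fun p _ => ?_)
        (ih (hfd hf (1, 0)))
      exact (hf.differentiable (by simp) p).hasFDerivAt.comp_hasDerivAt p.1
        ((hasDerivAt_id p.1).prodMk (hasDerivAt_const p.1 p.2))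
  have hD : ∀ {f : Pt → E}, ContDiff ℝ ∞ f → ∀ d, ∀ p ∈ region Y T,
      HasD Y T d f (fderiv ℝ f p (unitVec d)) p := fun {f} hf d p hp => by
    have := ContDiffOn.hasD ((hf.of_le (by simp)).contDiffOn (s := region Y T)) d hp
    rwa [fderivWithin_eq_fderiv (uniqueDiffOn_region Y T p hp)
      (hf.differentiable (by simp) p)] at this
  have h : ∀ {f : Pt → E}, ContDiff ℝ ∞ f → C1X (Growth.free Y T) f := fun hf =>
    .of_hasD (hx hf) (fun d => hx (hfd hf (unitVec d))) (hD hf)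
  exact ⟨h hf, fun d => (h (hfd hf (unitVec d))).congr fun p hp => (hD hf d p hp).dD_eq hp⟩

/-- `∂/∂y` and `∂/∂t` commute. -/
theorem dD_dD_comm {E : Type*} [NormedAddCommGroup E] [NormedSpace ℝ E] {κ : Growth Y T}
    {f : Pt → E} (hf : C1X κ f) (hfd : C1X κ (dD Y T false f)) {p : Pt} (hp : p ∈ region Y T) :
    dD Y T false (dD Y T true f) p = dD Y T true (dD Y T false f) p := by
  obtain ⟨x, y, t⟩ := p
  have h := hasDerivWithinAt_of_mixed (s := Icc 0 Y) (t := Icc 0 T)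
    (g := fun y t => f (x, y, t)) (g₁ := fun y t => dD Y T false f (x, y, t))
    (g₂ := fun y t => dD Y T true f (x, y, t))
    (g₁₂ := fun y t => dD Y T true (dD Y T false f) (x, y, t)) (x₀ := y) (y₀ := t)
    (convex_Icc _ _) (convex_Icc _ _)
    ⟨0, left_mem_Icc.2 hT.out.le, T, right_mem_Icc.2 hT.out.le, hT.out.ne⟩
    (fun y hy t ht => hf.hasD false (x, y, t) ⟨mem_univ _, hy, ht⟩)
    (fun y hy t ht => hfd.hasD true (x, y, t) ⟨mem_univ _, hy, ht⟩)
    (fun y hy t ht => hf.hasD true (x, y, t) ⟨mem_univ _, hy, ht⟩)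
    ((hfd.xSmooth_dD true).continuousOn.comp
      (by fun_prop : Continuous fun q : ℝ × ℝ => ((x, q.1, q.2) : Pt)).continuousOn
      fun q hq => ⟨mem_univ _, hq.1, hq.2⟩) hp.2.1 hp.2.2
  exact HasD.dD_eq (d := false) (f := dD Y T true f) hp h

omit hY hT in
theorem XSmooth.diffOp {κ ν : Growth Y T} (hνκ : ν.Acts κ) {a : Coeff n N}
    (ha : ∀ i r c, XSmooth ν fun p => a i p r c) {f : Pt → Fin N → ℂ} (hf : XSmooth κ f) :
    XSmooth κ (diffOp a f) :=
  .pi fun r => .sum fun i _ => .sum fun s _ => .bilin bilin_smul hνκ (ha i r s) ((hf.dX i).comp s)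

theorem C1X.diffOp {a : Coeff n N} (ha : ∀ i r c, C1X (Growth.free Y T) fun p => a i p r c)
    {f : Pt → Fin N → ℂ} (hf : C1X (Growth.free Y T) f) : C1X (Growth.free Y T) (diffOp a f) :=
  .pi fun r => .sum fun i _ => .sum fun s _ =>
    .bilin bilin_smul (Growth.acts_free _) (ha i r s) ((hf.dX i).comp s)

theorem dD_diffOp {a : Coeff n N} (ha : ∀ i r c, C1X (Growth.free Y T) fun p => a i p r c)
    {f : Pt → Fin N → ℂ} (hf : C1X (Growth.free Y T) f) (d : Bool) {p : Pt}
    (hp : p ∈ region Y T) (r : Fin N) :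
    dD Y T d (DelsarteDarboux.diffOp a f) p r
      = ∑ i : Fin (n + 1), ∑ s, dD Y T d (fun q => a i q r s) p * dX (i : ℕ) (fun q => f q s) p
        + DelsarteDarboux.diffOp a (dD Y T d f) p r := by
  rw [(C1X.diffOp ha hf).dD_apply d r hp]
  simp only [diffOp, ← Finset.sum_add_distrib]
  refine HasD.dD_eq hp (.sum fun i _ => .sum fun s _ => ?_)
  have h := HasD.bilin (m := fun (z w : ℂ) => z • w) bilin_smul ((ha i r s).hasD d p hp)
    ((hf.dX i).comp s |>.hasD d p hp)
  refine HasDerivWithinAt.congr_deriv h ?_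
  rw [← dX_apply hf.xSmooth _ _ hp, ← (hf.dX i).dD_apply d s hp, hf.dD_dX i d hp]
  rfl

end Regularity

theorem diffOp_sub {κ ν : Growth Y T} {a : Coeff n N} {f g : Pt → Fin N → ℂ} (hf : XSmooth κ f)
    (hg : XSmooth ν g) {p : Pt} (hp : p ∈ region Y T) :
    diffOp a (fun q => f q - g q) p = diffOp a f p - diffOp a g p := by
  ext r
  simp only [diffOp, dX_sub hf hg _ hp, Pi.sub_apply, smul_sub, Finset.sum_sub_distrib]

/-- The Leibniz rule for the composition of two differential expressions. -/
theorem diffOp_diffOp {κ : Growth Y T} {a : Coeff n N} {b : Coeff m N}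
    (hb : ∀ i r c, XSmooth (Growth.free Y T) fun p => b i p r c) {f : Pt → Fin N → ℂ}
    (hf : XSmooth κ f) {K : ℕ} (hK : n + m < K) {p : Pt} (hp : p ∈ region Y T) (r : Fin N) :
    diffOp a (diffOp b f) p r
      = ∑ k ∈ Finset.range K, ∑ c, compCoeff a b k p r c * dX k (fun q => f q c) p := by
  have h1 : ∀ (i : ℕ) (s : Fin N), dX i (fun q => diffOp b f q s) p
      = ∑ j : Fin (m + 1), ∑ c, ∑ l ∈ Finset.range (i + 1),
        (i.choose l : ℂ) * dX l (fun q => b j q s c) p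
          * dX (i - l + j) (fun q => f q c) p := by
    intro i s
    have hpr : ∀ (j : Fin (m + 1)) (c : Fin N), XSmooth (Growth.free Y T)
        fun q => b j q s c * dX (j : ℕ) (fun q => f q c) q := fun j c =>
      .bilin bilin_mul (Growth.acts_free _) (hb j s c) ((hf.free.comp c).dX j)
    rw [dX_congr (g := fun q => ∑ j : Fin (m + 1), ∑ c, b j q s c
      * dX (j : ℕ) (fun q => f q c) q) (fun q hq => diffOp_apply hf hq s) i hp,
      dX_sum (fun j _ => .sum fun c _ => hpr j c) i hp]
    refine Finset.sum_congr rfl fun j _ => ?_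
    rw [dX_sum (fun c _ => hpr j c) i hp]
    refine Finset.sum_congr rfl fun c _ => ?_
    refine (iteratedDeriv_fun_mul ((hb j s c).contDiffAt hp)
      (((hf.comp c).dX j).contDiffAt hp)).trans (Finset.sum_congr rfl fun l _ => ?_)
    rw [← dX_dX]
    rfl
  have hfab : XSmooth (Growth.free Y T) (diffOp b f) := .pi fun r => .sum fun i _ => .sum fun s _ =>
    .bilin bilin_smul (Growth.acts_free _) (hb i r s) ((hf.free.dX i).comp s)
  rw [diffOp_apply hfab hp]
  simp only [h1, compCoeff, Matrix.sum_apply, Finset.sum_mul, Finset.mul_sum]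
  conv_rhs =>
    enter [2, k]
    rw [Finset.sum_comm]
  rw [Finset.sum_comm (s := Finset.range K)]
  refine Finset.sum_congr rfl fun i _ => ?_
  conv_rhs =>
    enter [2, k]
    rw [Finset.sum_comm]
  rw [Finset.sum_comm (s := Finset.range K), Finset.sum_comm]
  refine Finset.sum_congr rfl fun j _ => ?_
  conv_rhs => rw [Finset.sum_comm]
  rw [Finset.sum_comm]
  refine Finset.sum_congr rfl fun c _ => ?_
  conv_rhs => rw [Finset.sum_comm]
  rw [Finset.sum_comm]
  refine Finset.sum_congr rfl fun l hl => ?_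
  have hl' : l ≤ i := Nat.lt_succ_iff.1 (Finset.mem_range.1 hl)
  have hi := i.2
  have hj := j.2
  rw [Finset.sum_eq_single_of_mem ((i : ℕ) - l + j) (Finset.mem_range.2 (by omega))]
  · rw [if_pos (by omega)]
    simp only [Matrix.smul_apply, Matrix.mul_apply, Matrix.of_apply, smul_eq_mul, Finset.mul_sum,
      Finset.sum_mul]
    exact Finset.sum_congr rfl fun s _ => by ring
  · intro k _ hk
    rw [if_neg (by omega)]
    simp

/-- The coefficient of `∂ᵏ` in `∂L/∂t - ∂M/∂y + [L, M]`, which the Zakharov–Shabat system equates to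
zero. -/
noncomputable def zsCoeff (Y T : ℝ) (a : Coeff n N) (b : Coeff m N) (k : ℕ) (p : Pt) :
    Matrix (Fin N) (Fin N) ℂ :=
  (Matrix.of fun r c => dT T (fun q => coeffAt a k q r c) p)
    - (Matrix.of fun r c => dY Y (fun q => coeffAt b k q r c) p)
    + (compCoeff a b k p - compCoeff b a k p)

theorem coeffAt_val (a : Coeff n N) (i : Fin (n + 1)) : coeffAt a i = a i := by
  simp [coeffAt, i.2]

theorem sum_dD_coeffAt (a : Coeff n N) (d : Bool) {K : ℕ} (hK : n < K) (p : Pt) (r : Fin N)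
    (F : ℕ → Fin N → ℂ) :
    ∑ k ∈ Finset.range K, ∑ c, dD Y T d (fun q => coeffAt a k q r c) p * F k c
      = ∑ i : Fin (n + 1), ∑ c, dD Y T d (fun q => a i q r c) p * F i c := by
  rw [← Finset.sum_subset (Finset.range_mono (by omega : n + 1 ≤ K)), ← Fin.sum_univ_eq_sum_range
    (fun k => ∑ c, dD Y T d (fun q => coeffAt a k q r c) p * F k c)]
  · simp only [coeffAt_val]
  · intro k _ hk
    rw [Finset.mem_range] at hk
    simp [coeffAt, hk, dD]

variable [hY : Fact (0 < Y)] [hT : Fact (0 < T)]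

/-- The commutator of `∂/∂y - L` and `∂/∂t - M` is a differential expression in `x` alone. -/
theorem commutator_eq {a : Coeff n N} {b : Coeff m N}
    (ha : ∀ i r c, C1X (Growth.free Y T) fun p => a i p r c)
    (hb : ∀ i r c, C1X (Growth.free Y T) fun p => b i p r c) {f : Pt → Fin N → ℂ}
    (hf : C1X (Growth.free Y T) f) (hfd : ∀ d, C1X (Growth.free Y T) (dD Y T d f)) {K : ℕ}
    (hK : n + m < K) {p : Pt} (hp : p ∈ region Y T) (r : Fin N) :
    opD Y T false a (opD Y T true b f) p r - opD Y T true b (opD Y T false a f) p r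
      = ∑ k ∈ Finset.range K, ∑ c, zsCoeff Y T a b k p r c * dX k (fun q => f q c) p := by
  have hD : ∀ {l : ℕ} {e : Coeff l N}, (∀ i r c, C1X (Growth.free Y T) fun p => e i p r c) →
      ∀ d d', dD Y T d (opD Y T d' e f) p = dD Y T d (dD Y T d' f) p - dD Y T d (diffOp e f) p :=
    fun he d d' => HasD.dD_eq hp (.sub ((hfd d').hasD d p hp) ((C1X.diffOp he hf).hasD d p hp))
  have hZ : ∑ k ∈ Finset.range K, ∑ c, zsCoeff Y T a b k p r c * dX k (fun q => f q c) p
      = ∑ i : Fin (n + 1), ∑ c, dD Y T true (fun q => a i q r c) p * dX i (fun q => f q c) p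
        - ∑ i : Fin (m + 1), ∑ c, dD Y T false (fun q => b i q r c) p * dX i (fun q => f q c) p
        + (diffOp a (diffOp b f) p r - diffOp b (diffOp a f) p r) := by
    rw [diffOp_diffOp (fun i r c => (hb i r c).xSmooth) hf.xSmooth hK hp,
      diffOp_diffOp (fun i r c => (ha i r c).xSmooth) hf.xSmooth (by omega : m + n < K) hp,
      ← sum_dD_coeffAt a true (by omega : n < K) p r fun k c => dX k (fun q => f q c) p,
      ← sum_dD_coeffAt b false (by omega : m < K) p r fun k c => dX k (fun q => f q c) p]
    simp only [← Finset.sum_sub_distrib, ← Finset.sum_add_distrib]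
    refine Finset.sum_congr rfl fun k _ => Finset.sum_congr rfl fun c _ => ?_
    simp only [zsCoeff, Matrix.add_apply, Matrix.sub_apply, Matrix.of_apply, dD_true, dD_false]
    ring
  rw [hZ]
  have e1 : diffOp a (opD Y T true b f) p = diffOp a (dD Y T true f) p - diffOp a (diffOp b f) p :=
    diffOp_sub (hfd true).xSmooth (C1X.diffOp hb hf).xSmooth hp
  have e2 : diffOp b (opD Y T false a f) p
      = diffOp b (dD Y T false f) p - diffOp b (diffOp a f) p :=
    diffOp_sub (hfd false).xSmooth (C1X.diffOp ha hf).xSmooth hp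
  rw [opD, opD, hD hb, hD ha, e1, e2, dD_dD_comm hf (hfd false) hp]
  simp only [Pi.sub_apply, dD_diffOp ha hf true hp, dD_diffOp hb hf false hp]
  ring

theorem commuting_of_zsCoeff {a : Coeff n N} {b : Coeff m N}
    (ha : ∀ i r c, C1X (Growth.free Y T) fun p => a i p r c)
    (hb : ∀ i r c, C1X (Growth.free Y T) fun p => b i p r c)
    (h : ∀ k, ∀ p ∈ region Y T, zsCoeff Y T a b k p = 0) : Commuting Y T a b := by
  intro f hf p hp
  obtain ⟨h1, h2⟩ := C1X.of_contDiff (Y := Y) (T := T) hf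
  ext r
  have := commutator_eq ha hb h1 h2 (Nat.lt_succ_self (n + m)) hp r
  simp only [h _ p hp, Matrix.zero_apply, zero_mul, Finset.sum_const_zero] at this
  exact sub_eq_zero.1 this

/-- The function is `(x - x₁)ᵏ / k!` times a bump function at `x₁` that vanishes near `x₀`. -/
theorem exists_testFunction {x₁ x₀ : ℝ} (hne : x₁ ≠ x₀) (k : ℕ) :
    ∃ τ : ℝ → ℂ, ContDiff ℝ ∞ τ ∧ (∀ j, iteratedDeriv j τ x₁ = if j = k then 1 else 0) ∧
      ∀ j, iteratedDeriv j τ x₀ = 0 := by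
  have hd : 0 < dist x₀ x₁ := dist_pos.2 hne.symm
  let B : ContDiffBump x₁ := ⟨dist x₀ x₁ / 4, dist x₀ x₁ / 2, by positivity, by linarith⟩
  let μ : ℕ → ℝ → ℂ := fun k x => ((x - x₁ : ℝ) : ℂ) ^ k / (k.factorial : ℂ)
  have hμ : ∀ j k, iteratedDeriv j (μ k) x₁ = if j = k then 1 else 0 := by
    intro j
    induction j with
    | zero =>
      intro k
      cases k <;> simp [μ]
    | succ j ih =>
      intro k
      rw [iteratedDeriv_succ']
      cases k with
      | zero =>
        have : deriv (μ 0) = fun _ => 0 := by ext x; simp [μ]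
        rw [this]
        simp
      | succ k =>
        have : deriv (μ (k + 1)) = μ k := by
          ext x
          have h1 : HasDerivAt (fun x : ℝ => ((x - x₁ : ℝ) : ℂ)) 1 x := by
            simpa using ((hasDerivAt_id x).sub_const x₁).ofReal_comp
          have h2 := ((h1.pow (k + 1)).div_const ((k + 1).factorial : ℂ)).deriv
          refine h2.trans ?_
          have hk : (k.factorial : ℂ) ≠ 0 := mod_cast k.factorial_ne_zero
          have hk' : (k : ℂ) + 1 ≠ 0 := mod_cast Nat.succ_ne_zero k
          simp only [μ, Nat.factorial_succ, Nat.add_sub_cancel]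
          push_cast
          field_simp
        rw [this, ih]
        simp
  refine ⟨fun x => ((B x : ℝ) : ℂ) * μ k x, ?_, fun j => ?_, fun j => ?_⟩
  · refine (Complex.ofRealCLM.contDiff.comp B.contDiff).mul ?_
    exact ((Complex.ofRealCLM.contDiff.comp (contDiff_id.sub contDiff_const)).pow k).div_const _
  · rw [← hμ j k]
    refine Filter.EventuallyEq.iteratedDeriv_eq j ?_
    filter_upwards [B.eventuallyEq_one_of_mem_ball (Metric.mem_ball_self B.rIn_pos)] with x hx
    simp [hx]
  · have : (fun x => ((B x : ℝ) : ℂ) * μ k x) =ᶠ[𝓝 x₀] fun _ => 0 := by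
      have hev : ∀ᶠ x in 𝓝 x₀, dist x₀ x₁ / 2 < dist x x₁ :=
        (continuous_id.dist continuous_const).continuousAt.eventually_const_lt (half_lt_self hd)
      filter_upwards [hev] with x hx
      rw [B.zero_of_le_dist hx.le]
      simp
    rw [Filter.EventuallyEq.iteratedDeriv_eq j this]
    simp

omit hY hT in
/-- A continuous function that vanishes for `x ≠ x₀` vanishes. -/
theorem eq_zero_of_ne {g : Pt → ℂ} (hg : ContinuousOn g (region Y T)) {x₀ : ℝ}
    (h : ∀ p ∈ region Y T, p.1 ≠ x₀ → g p = 0) {p : Pt} (hp : p ∈ region Y T) : g p = 0 := by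
  have := (continuous_line hg hp).ext_on (dense_compl_singleton x₀) continuous_const
    (fun x hx => h (x, p.2) (line_mem_region hp x) hx)
  exact congrFun this p.1

theorem C1X.of_line {γ : ℝ → Fin N → ℂ} (hγ : ContDiff ℝ ∞ γ) :
    C1X (Growth.free Y T) (fun p : Pt => γ p.1) ∧
      ∀ d, dD Y T d (fun p : Pt => γ p.1) = fun _ => 0 := by
  refine ⟨(C1X.of_contDiff (hγ.comp contDiff_fst)).1, fun d => ?_⟩
  ext1 p
  simp only [dD, slice_fst]
  exact congrFun (derivWithin_const _ _) _

theorem xSmooth_zsCoeff {a : Coeff n N} {b : Coeff m N}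
    (ha : ∀ i r c, C1X (Growth.free Y T) fun p => a i p r c)
    (hb : ∀ i r c, C1X (Growth.free Y T) fun p => b i p r c) (k : ℕ) (r c : Fin N) :
    XSmooth (Growth.free Y T) fun p => zsCoeff Y T a b k p r c := by
  have hco : ∀ {l : ℕ} {e : Coeff l N}, (∀ i r c, C1X (Growth.free Y T) fun p => e i p r c) →
      C1X (Growth.free Y T) fun q => coeffAt e k q r c := by
    intro l e he
    unfold coeffAt
    split
    · exact he _ r c
    · exact .zero
  have hcomp : ∀ {l l' : ℕ} {e : Coeff l N} {e' : Coeff l' N},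
      (∀ i r c, C1X (Growth.free Y T) fun p => e i p r c) →
      (∀ i r c, C1X (Growth.free Y T) fun p => e' i p r c) →
      XSmooth (Growth.free Y T) fun p => compCoeff e e' k p r c := by
    intro l l' e e' he he'
    simp only [compCoeff, Matrix.sum_apply]
    refine .sum fun i _ => .sum fun j _ => .sum fun s _ => ?_
    by_cases hks : k + s = (i : ℕ) + (j : ℕ)
    · simp only [if_pos hks, Matrix.smul_apply, Matrix.mul_apply, Matrix.of_apply, smul_eq_mul,
        Finset.mul_sum]
      exact .sum fun q _ => .bilin bilin_mul (Growth.acts_free _) (.const _ (Growth.free_mem _))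
        (.bilin bilin_mul (Growth.acts_free _) (he i r q).xSmooth ((he' j q c).xSmooth.dX s))
    · simp only [if_neg hks]
      exact .zero
  exact (((hco ha).xSmooth_dD true).sub ((hco hb).xSmooth_dD false)).add
    ((hcomp ha hb).sub (hcomp hb ha))

/-- If the sum `∑ₖ Cₖ ∂ᵏ` of matrix expressions annihilates at `p` a function with the jet
`∂ⁱ g = δᵢₖ e_c`, then the column `c` of `Cₖ` vanishes there. -/
theorem eq_zero_of_jet {C : ℕ → Fin N → ℂ} {J : ℕ → Fin N → ℂ} {K k : ℕ} (hk : k < K) {c : Fin N}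
    (hJ : ∀ i s, J i s = if i = k ∧ s = c then 1 else 0)
    (h : ∑ i ∈ Finset.range K, ∑ s, C i s * J i s = 0) : C k c = 0 := by
  rw [Finset.sum_eq_single_of_mem k (Finset.mem_range.2 hk), Finset.sum_eq_single c] at h
  · simpa [hJ] using h
  · intro s _ hs
    simp [hJ, hs]
  · simp
  · intro i _ hi
    simp [hJ, hi]

/-- Vector-valued test functions of `x` with a prescribed jet at `x₁` that are flat at `x₀`. -/
theorem exists_testVector {x₁ x₀ : ℝ} (hne : x₁ ≠ x₀) (k : ℕ) (c : Fin N) :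
    ∃ γ : ℝ → Fin N → ℂ, ContDiff ℝ ∞ γ ∧
      (∀ i s, iteratedDeriv i (fun x => γ x s) x₁ = if i = k ∧ s = c then 1 else 0) ∧
      ∀ i, iteratedDeriv i γ x₀ = 0 := by
  obtain ⟨τ, hτ, h1, h0⟩ := exists_testFunction hne k
  have hγ : ∀ s : Fin N, (fun x => (Pi.single c (τ x) : Fin N → ℂ) s)
      = if s = c then τ else fun _ => 0 := fun s => by
    split_ifs with h
    · subst h; simp
    · simp [h]
  have hsm : ContDiff ℝ ∞ fun x => (Pi.single c (τ x) : Fin N → ℂ) := contDiff_pi.2 fun s => by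
    rw [hγ s]
    split_ifs
    · exact hτ
    · exact contDiff_const
  refine ⟨fun x => Pi.single c (τ x), hsm, fun i s => ?_, fun i => ?_⟩
  · rw [hγ s]
    by_cases hs : s = c <;> simp [hs, h1]
  · have e : (fun x => (Pi.single c (τ x) : Fin N → ℂ))
        = (ContinuousLinearMap.single ℝ (fun _ : Fin N => ℂ) c) ∘ τ := rfl
    have h2 : ∀ (j : ℕ) (σ : ℝ → ℂ), ContDiff ℝ ∞ σ → ∀ x,
        iteratedDeriv j ((ContinuousLinearMap.single ℝ (fun _ : Fin N => ℂ) c) ∘ σ) x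
          = ContinuousLinearMap.single ℝ (fun _ : Fin N => ℂ) c (iteratedDeriv j σ x) := by
      intro j σ hσ x
      have := ContinuousLinearMap.iteratedFDeriv_comp_left
        (ContinuousLinearMap.single ℝ (fun _ : Fin N => ℂ) c) (x := x) (hσ.contDiffAt)
        (i := j) (mod_cast le_top)
      simp only [iteratedDeriv, this]
      rfl
    rw [e, h2 i τ hτ, h0, map_zero]

theorem zsCoeff_of_commuting {a : Coeff n N} {b : Coeff m N}
    (ha : ∀ i r c, C1X (Growth.free Y T) fun p => a i p r c)
    (hb : ∀ i r c, C1X (Growth.free Y T) fun p => b i p r c) (h : Commuting Y T a b) (k : ℕ)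
    {p : Pt} (hp : p ∈ region Y T) : zsCoeff Y T a b k p = 0 := by
  ext r c
  obtain ⟨γ, hγ, hjet, -⟩ := exists_testVector (x₁ := p.1) (x₀ := p.1 + 1) (by simp) k c
  have hf : ContDiff ℝ ∞ fun p : Pt => γ p.1 := hγ.comp contDiff_fst
  obtain ⟨h1, h2⟩ := C1X.of_contDiff (Y := Y) (T := T) hf
  have hc := commutator_eq ha hb h1 h2 (K := n + m + k + 1) (by omega) hp r
  have h0 : opD Y T false a (opD Y T true b fun p : Pt => γ p.1) p
      = opD Y T true b (opD Y T false a fun p : Pt => γ p.1) p := h _ hf p hp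
  rw [h0, sub_self] at hc
  exact eq_zero_of_jet (C := fun k c => zsCoeff Y T a b k p r c) (by omega) hjet hc.symm

end Commutator

/-! ### Consequences of the intertwining relation -/

section Consequences

variable {H : Type*} [NormedAddCommGroup H] [NormedSpace ℂ H] [CompleteSpace H] {n m N : ℕ}
  {Y T : ℝ} [hY : Fact (0 < Y)] [hT : Fact (0 < T)] {Φ : Fin N → Pt → H}
  {Ψ : Fin N → Pt → H →L[ℂ] ℂ} {Om : Pt → H →L[ℂ] H}

/-- The class of functions that vanish at `x = x₀`. -/
abbrev Growth.flat (Y T x₀ : ℝ) : Growth Y T := Growth.vanishing Y T {p | p.1 = x₀}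

theorem mem_flatFunctions_iff {x₀ : ℝ} {f : Pt → Fin N → ℂ} :
    f ∈ flatFunctions Y T N x₀ ↔ C1X (Growth.free Y T) f ∧ (∀ p, p ∉ region Y T → f p = 0) ∧
      XSmooth (Growth.flat Y T x₀) f := by
  constructor
  · rintro ⟨h1, h2, h3⟩
    have h := h1.c1X.xSmooth
    exact ⟨h1.c1X, h2, .of_dX (fun k => (h.dX k).continuousOn)
      (fun k p hp hpx => by beta_reduce; rw [h3 k p hp hpx, norm_zero])
      fun k p hp => (h.hasDerivAt_dX k hp).differentiableAt⟩
  · rintro ⟨h1, h2, h3⟩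
    exact ⟨h1.c1Smooth, h2, fun k p hp hpx => norm_eq_zero.1 ((h3.dX k).mem p hp hpx)⟩

omit [CompleteSpace H] hY hT in
theorem conc_of_flat {x₀ : ℝ} {a : Coeff n N} {f : Pt → Fin N → ℂ}
    (hf : XSmooth (Growth.flat Y T x₀) f) {p : Pt} (hp : p ∈ region Y T) (hpx : p.1 = x₀) :
    conc (fun (v : H) (z : ℂ) => z • v) a Φ (fun c q => f q c) p = 0 := by
  have h : ∀ j c, dX j (fun q => f q c) p = 0 := fun j c =>
    norm_eq_zero.1 (((hf.comp c).dX j).mem p hp hpx)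
  simp [conc, h]

omit [NormedSpace ℂ H] [CompleteSpace H] hY hT in
theorem not_mem_region_line {p : Pt} (hp : p ∉ region Y T) (x : ℝ) : (x, p.2) ∉ region Y T :=
  fun h => hp ⟨mem_univ _, h.2⟩

omit [CompleteSpace H] hY hT in
theorem potential_of_not_mem {x₀ : ℝ} {f : Pt → Fin N → ℂ} (hf : ∀ p, p ∉ region Y T → f p = 0)
    {p : Pt} (hp : p ∉ region Y T) : potential Φ x₀ f p = 0 := by
  simp [potential, prim, hf _ (not_mem_region_line hp _)]

namespace Dressing

theorem bijOn (D : Dressing Y T Φ Ψ Om) (x₀ : ℝ) :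
    BijOn (dress Φ Ψ Om x₀) (flatFunctions Y T N x₀) (flatFunctions Y T N x₀) := by
  refine ⟨fun f hf => ?_, fun f hf g hg h => ?_, fun g hg => ⟨undress Φ Ψ Om x₀ g, ?_, ?_⟩⟩
  · rw [mem_flatFunctions_iff] at hf ⊢
    refine ⟨D.c1X_dress x₀ hf.1, fun p hp => ?_, D.xSmooth_dress (fun _ h => h) hf.2.2⟩
    ext r
    simp [dress, potential_of_not_mem hf.2.1 hp, hf.2.1 p hp]
  · rw [mem_flatFunctions_iff] at hf hg
    ext1 p
    by_cases hp : p ∈ region Y T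
    · rw [← D.undress_dress x₀ hf.1 hp, h, D.undress_dress x₀ hg.1 hp]
    · rw [hf.2.1 p hp, hg.2.1 p hp]
  · rw [mem_flatFunctions_iff] at hg ⊢
    refine ⟨D.c1X_undress x₀ hg.1, fun p hp => ?_, D.xSmooth_undress (fun _ h => h) hg.2.2⟩
    ext r
    simp [undress, potential_of_not_mem hg.2.1 hp, hg.2.1 p hp]
  · rw [mem_flatFunctions_iff] at hg
    ext1 p
    by_cases hp : p ∈ region Y T
    · exact D.dress_undress x₀ hg.1 hp
    · ext r
      have h0 : ∀ p, p ∉ region Y T → undress Φ Ψ Om x₀ g p = 0 := fun p hp => by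
        ext r
        simp [undress, potential_of_not_mem hg.2.1 hp, hg.2.1 p hp]
      simp [dress, potential_of_not_mem h0 hp, h0 p hp, hg.2.1 p hp]

variable {d : Bool} {a : Coeff n N} {b : Coeff m N}

theorem intertwines_flat (D : Dressing Y T Φ Ψ Om) (V : Evolves Y T d a Φ Ψ Om) (x₀ : ℝ) :
    Intertwines Y T (dress Φ Ψ Om x₀) (opD Y T d a) (opD Y T d (dressCoeff Φ Ψ Om a))
      (flatFunctions Y T N x₀) := fun f hf p hp => by
  rw [mem_flatFunctions_iff] at hf
  exact D.dress_opD V x₀ hf.1 (fun p hp hpx => conc_of_flat hf.2.2 hp hpx) hp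

/-- The coefficients of the dressed expression are determined by its action on the transforms of
flat functions. These are all flat functions, so that any jet occurs at a point with `x ≠ x₀`. -/
theorem coeff_unique (D : Dressing Y T Φ Ψ Om) (V : Evolves Y T d a Φ Ψ Om) (x₀ : ℝ)
    {a'' : Coeff n N} (ha'' : ∀ i r c, C1X (Growth.free Y T) fun p => a'' i p r c)
    (h : Intertwines Y T (dress Φ Ψ Om x₀) (opD Y T d a) (opD Y T d a'') (flatFunctions Y T N x₀))
    (i : Fin (n + 1)) {p : Pt} (hp : p ∈ region Y T) : a'' i p = dressCoeff Φ Ψ Om a i p := by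
  ext r c
  refine sub_eq_zero.1 (eq_zero_of_ne (g := fun p => a'' i p r c - dressCoeff Φ Ψ Om a i p r c)
    (((ha'' i r c).xSmooth.continuousOn.sub
      (D.c1X_dressCoeff V i r c).xSmooth.continuousOn)) (x₀ := x₀) (fun p hp hpx => ?_) hp)
  obtain ⟨γ, hγ, hjet, hflat⟩ := exists_testVector hpx (i : ℕ) c
  classical
  let g : Pt → Fin N → ℂ := fun q => if q ∈ region Y T then γ q.1 else 0
  have hgγ : EqOn g (fun q => γ q.1) (region Y T) := fun q hq => if_pos hq
  have hγC := (C1X.of_line (Y := Y) (T := T) hγ).1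
  have hg : g ∈ flatFunctions Y T N x₀ := by
    refine ⟨(hγC.congr hgγ).c1Smooth, fun q hq => if_neg hq, fun k q hq hqx => ?_⟩
    rw [dX_congr hgγ k hq, dX, hqx]
    exact hflat k
  obtain ⟨f, hf, hfg⟩ := (D.bijOn x₀).surjOn hg
  have e := (D.intertwines_flat V x₀ f hf p hp).symm.trans (h f hf p hp)
  rw [hfg, opD_congr hgγ hp, opD_congr hgγ hp] at e
  have e' : DelsarteDarboux.diffOp a'' (fun q => γ q.1) p r
      - DelsarteDarboux.diffOp (dressCoeff Φ Ψ Om a) (fun q => γ q.1) p r = 0 := by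
    have := congrFun e r
    simp only [opD, Pi.sub_apply, sub_right_inj] at this
    rw [this, sub_self]
  rw [diffOp_apply hγC.xSmooth hp, diffOp_apply hγC.xSmooth hp, ← Finset.sum_sub_distrib] at e'
  simp only [← Finset.sum_sub_distrib, ← sub_mul] at e'
  have hC := Fin.sum_univ_eq_sum_range (fun k => ∑ s, (coeffAt a'' k p r s
    - coeffAt (dressCoeff Φ Ψ Om a) k p r s) * dX k (fun q : Pt => γ q.1 s) p) (n + 1)
  simp only [coeffAt_val] at hC
  rw [hC] at e'
  have := eq_zero_of_jet (C := fun k s => coeffAt a'' k p r s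
    - coeffAt (dressCoeff Φ Ψ Om a) k p r s) (J := fun k s => dX k (fun q : Pt => γ q.1 s) p)
    i.2 hjet e'
  simpa only [coeffAt_val] using this

/-- On the transforms of functions `f`, the commutator of the dressed operators is the transform of
`[𝓛, 𝓜] f = 0`. At a point with `x ≠ x₀`, every jet is that of the transform of some `f`, which may
be taken independent of `y` and `t`, hence jointly smooth, as the commutation hypothesis requires. -/
theorem zsCoeff_dressCoeff (D : Dressing Y T Φ Ψ Om) (Va : Evolves Y T false a Φ Ψ Om)
    (Vb : Evolves Y T true b Φ Ψ Om) (x₀ : ℝ) (h : Commuting Y T a b) (k : ℕ) {p : Pt}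
    (hp : p ∈ region Y T) :
    zsCoeff Y T (dressCoeff Φ Ψ Om a) (dressCoeff Φ Ψ Om b) k p = 0 := by
  have ha' := fun i r c => D.c1X_dressCoeff Va i r c
  have hb' := fun i r c => D.c1X_dressCoeff Vb i r c
  ext r c
  refine eq_zero_of_ne (x₀ := x₀) (xSmooth_zsCoeff ha' hb' k r c).continuousOn
    (fun p hp hpx => ?_) hp
  obtain ⟨γ, hγ, hjet, hflat⟩ := exists_testVector hpx k c
  -- `f` agrees with the inverse image of the test function on the line through `p`
  have hg := (C1X.of_line (Y := Y) (T := T) hγ).1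
  have hgflat : XSmooth (Growth.flat Y T x₀) fun q : Pt => γ q.1 :=
    .of_dX (fun k => (hg.xSmooth.dX k).continuousOn)
      (fun k q hq hqx => by
        have hqx : q.1 = x₀ := hqx
        beta_reduce
        rw [dX, hqx]
        exact norm_eq_zero.2 (hflat k))
      fun k q hq => (hg.xSmooth.hasDerivAt_dX k hq).differentiableAt
  have hf₀ := D.c1X_undress x₀ hg
  have hf₀flat := D.xSmooth_undress (fun _ h => h) hgflat
  let f : Pt → Fin N → ℂ := fun q => undress Φ Ψ Om x₀ (fun q : Pt => γ q.1) (q.1, p.2)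
  have hγf : ContDiff ℝ ∞ fun x => undress Φ Ψ Om x₀ (fun q : Pt => γ q.1) (x, p.2) :=
    hf₀.xSmooth.contDiff hp
  have hfs : ContDiff ℝ ∞ f := hγf.comp contDiff_fst
  obtain ⟨hf, hfD⟩ : C1X (Growth.free Y T) f ∧ ∀ d, dD Y T d f = fun _ => 0 := C1X.of_line hγf
  have hfflat : XSmooth (Growth.flat Y T x₀) f :=
    .of_dX (fun k => (hf.xSmooth.dX k).continuousOn)
      (fun k q hq hqx => (hf₀flat.dX k).mem (q.1, p.2) (line_mem_region hp _) hqx)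
      fun k q hq => (hf.xSmooth.hasDerivAt_dX k hq).differentiableAt
  have hdress : ∀ x, dress Φ Ψ Om x₀ f (x, p.2) = γ x := fun x =>
    D.dress_undress x₀ hg (line_mem_region hp x)
  -- the operators applied to `f` stay in the domain of the intertwining relation
  have hop : ∀ {l : ℕ} {e : Coeff l N} {d : Bool}, Evolves Y T d e Φ Ψ Om →
      C1X (Growth.free Y T) (opD Y T d e f) ∧ XSmooth (Growth.flat Y T x₀) (opD Y T d e f) ∧
      EqOn (dress Φ Ψ Om x₀ (opD Y T d e f))
        (opD Y T d (dressCoeff Φ Ψ Om e) (dress Φ Ψ Om x₀ f)) (region Y T) := fun {l e d} V => by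
    have e1 : EqOn (opD Y T d e f) (fun q => -DelsarteDarboux.diffOp e f q) (region Y T) :=
      fun q _ => by rw [opD, hfD d, zero_sub]
    exact ⟨(C1X.diffOp V.coeff hf).neg.congr e1,
      (XSmooth.diffOp (Growth.acts_vanishing _ _) (fun i r c => (V.coeff i r c).xSmooth)
        hfflat).neg.congr e1,
      fun q hq => D.dress_opD V x₀ hf (fun q hq hqx => conc_of_flat hfflat hq hqx) hq⟩
  obtain ⟨a1, a2, a3⟩ := hop Va
  obtain ⟨b1, b2, b3⟩ := hop Vb
  have hW := D.c1X_dress x₀ hf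
  have hWd : ∀ d, C1X (Growth.free Y T) (dD Y T d (dress Φ Ψ Om x₀ f)) := by
    have key : ∀ {l : ℕ} {e : Coeff l N} {d : Bool}, Evolves Y T d e Φ Ψ Om →
        C1X (Growth.free Y T) (dD Y T d (dress Φ Ψ Om x₀ f)) := fun {l e d} V =>
      ((D.c1X_dress x₀ (hop V).1).add
        (C1X.diffOp (fun i r c => D.c1X_dressCoeff V i r c) hW)).congr fun q hq => by
          beta_reduce
          rw [(hop V).2.2 hq, opD, sub_add_cancel]
    intro d
    cases d
    · exact key Va
    · exact key Vb
  have hc := commutator_eq ha' hb' hW hWd (K := n + m + k + 1) (by omega) hp r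
  have e1 : opD Y T false (dressCoeff Φ Ψ Om a)
      (opD Y T true (dressCoeff Φ Ψ Om b) (dress Φ Ψ Om x₀ f)) p
      = dress Φ Ψ Om x₀ (opD Y T false a (opD Y T true b f)) p := by
    rw [← opD_congr b3 hp]
    exact (D.dress_opD Va x₀ b1 (fun q hq hqx => conc_of_flat b2 hq hqx) hp).symm
  have e2 : opD Y T true (dressCoeff Φ Ψ Om b)
      (opD Y T false (dressCoeff Φ Ψ Om a) (dress Φ Ψ Om x₀ f)) p
      = dress Φ Ψ Om x₀ (opD Y T true b (opD Y T false a f)) p := by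
    rw [← opD_congr a3 hp]
    exact (D.dress_opD Vb x₀ a1 (fun q hq hqx => conc_of_flat a2 hq hqx) hp).symm
  have e3 : EqOn (opD Y T false a (opD Y T true b f)) (opD Y T true b (opD Y T false a f))
      (region Y T) := fun q hq => h f hfs q hq
  rw [e1, e2, dress_congr e3 hp, sub_self] at hc
  refine eq_zero_of_jet (C := fun k s => zsCoeff Y T (dressCoeff Φ Ψ Om a)
    (dressCoeff Φ Ψ Om b) k p r s) (by omega) (fun i s => ?_) hc.symm
  rw [← hjet i s]
  exact congrArg (fun F => iteratedDeriv i F p.1) (funext fun x => congrFun (hdress x) s)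

end Dressing

omit [CompleteSpace H] in
/-- A vanishing coefficient contributes nothing to the dressed expression. This is the regularity
statement for the class of functions that vanish everywhere. -/
theorem dressTerm_eq_zero (D : Dressing Y T Φ Ψ Om)
    (hR : C1X (Growth.free Y T) fun p => Ring.inverse (Om p))
    {A : Pt → Matrix (Fin N) (Fin N) ℂ} (hA : ∀ p ∈ region Y T, A p = 0) (i k : ℕ) (r c : Fin N)
    {p : Pt} (hp : p ∈ region Y T) : dressTerm Φ Ψ Om i A k r c p = 0 := by
  have h := C1X.dressTerm (κ := Growth.vanishing Y T univ) (Growth.acts_free _)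
    (Growth.acts_vanishing _ _) (fun _ => Growth.free_mem _) D.c1X_Φ D.c1X_Ψ hR (A := A)
    (fun r c => C1X.zero.congr fun p hp => by rw [hA p hp]; rfl) i k r c
  exact norm_eq_zero.1 (h.xSmooth.mem p hp (mem_univ _))

omit [CompleteSpace H] hY hT in
theorem dressTerm_of_le {i k : ℕ} (hik : i ≤ k) (A : Pt → Matrix (Fin N) (Fin N) ℂ)
    (r c : Fin N) (p : Pt) :
    dressTerm Φ Ψ Om i A k r c p = if i = k then A p r c else 0 := by
  have h2 : ∀ l ∈ Finset.range i, (-1 : ℤ) ^ l • ∑ s,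
      dressPow Φ Ψ Om (i - 1 - l) k s c p • dX l (rowMul A Φ s) p = 0 := fun l hl => by
    have := Finset.mem_range.1 hl
    simp [dressPow_of_lt (show i - 1 - l < k by omega)]
  rw [dressTerm, Finset.sum_eq_zero h2, map_zero, map_zero, sub_zero]
  rcases hik.eq_or_lt with rfl | h
  · simp [dressPow_self]
  · simp [dressPow_of_lt h, h.ne]

theorem dressCoeff_eq (D : Dressing Y T Φ Ψ Om) {a : Coeff n N} {k : Fin (n + 1)}
    (h : ∀ i, k < i → ∀ p ∈ region Y T, a i p = 0) {p : Pt} (hp : p ∈ region Y T) :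
    dressCoeff Φ Ψ Om a k p = a k p := by
  ext r c
  simp only [dressCoeff, Matrix.of_apply]
  rw [Finset.sum_eq_single k]
  · rw [dressTerm_of_le le_rfl, if_pos rfl]
  · intro i _ hik
    rcases lt_or_gt_of_ne hik with hlt | hlt
    · rw [dressTerm_of_le (by exact_mod_cast hlt.le), if_neg (by simpa [Fin.ext_iff] using hik)]
    · exact dressTerm_eq_zero D D.c1X_inverse (h i hlt) _ _ _ _ hp
  · simp

/-- The order is preserved, because the coefficient of `∂ᵏ` is unchanged if those above it
vanish. -/
theorem hasOrder_dressCoeff (D : Dressing Y T Φ Ψ Om) {a : Coeff n N} (k : Fin (n + 1)) :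
    HasOrder Y T a k ↔ HasOrder Y T (dressCoeff Φ Ψ Om a) k := by
  have hiff : (∀ i, k < i → ∀ p ∈ region Y T, a i p = 0) ↔
      ∀ i, k < i → ∀ p ∈ region Y T, dressCoeff Φ Ψ Om a i p = 0 := by
    constructor
    · intro h i hi p hp
      rw [dressCoeff_eq D (fun j hj => h j (hi.trans hj)) hp, h i hi p hp]
    · intro h i
      induction i using WellFoundedGT.induction with
      | _ i ih =>
        intro hi p hp
        rw [← dressCoeff_eq D (fun j hj => ih j hj (hi.trans hj)) hp, h i hi p hp]
  constructor
  · rintro ⟨h1, p, hp, h2⟩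
    exact ⟨hiff.1 h1, p, hp, by rwa [dressCoeff_eq D h1 hp]⟩
  · rintro ⟨h1, p, hp, h2⟩
    exact ⟨hiff.2 h1, p, hp, by rwa [dressCoeff_eq D (hiff.2 h1) hp] at h2⟩

omit [CompleteSpace H] hY hT in
theorem XSmooth.zsmul {κ : Growth Y T} {E : Type*} [NormedAddCommGroup E] [NormedSpace ℝ E]
    {f : Pt → E} (hf : XSmooth κ f) (z : ℤ) : XSmooth κ fun p => z • f p := by
  simpa using hf.clm (z • ContinuousLinearMap.id ℝ E)

/-- If the coefficients, the solutions and `Om⁻¹` are of class `ν`, then the `y`- and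
`t`-derivatives are so as well, because of the evolution equations. -/
theorem c1X_of_evolves {ν : Growth Y T} (hν : ν.Acts ν) (D : Dressing Y T Φ Ψ Om)
    {n' : Bool → ℕ} {a : ∀ d, Coeff (n' d) N} (V : ∀ d, Evolves Y T d (a d) Φ Ψ Om)
    (ha : ∀ d i r c, C1X ν fun p => a d i p r c) (hΦ : ∀ c, XSmooth ν (Φ c))
    (hΨ : ∀ c, XSmooth ν (Ψ c)) (hR : ν.mem fun p => ‖Ring.inverse (Om p)‖) :
    (∀ c, C1X ν (Φ c)) ∧ (∀ c, C1X ν (Ψ c)) ∧ C1X ν fun p => Ring.inverse (Om p) := by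
  have h1 : ∀ c, C1X ν (Φ c) := fun c => by
    refine ⟨hΦ c, fun d => ?_, (D.c1X_Φ c).hasD⟩
    refine XSmooth.congr (f := fun p => -∑ i : Fin (n' d + 1), (-1 : ℤ) ^ (i : ℕ) •
      dX (i : ℕ) (rowMul (a d i) Φ c) p) (.neg (.sum fun i _ => .zsmul (.dX ?_ i) _))
      fun p hp => (V d).dD_Φ c p hp
    exact .sum fun r _ => .bilin bilin_smul hν (ha d i r c).xSmooth (hΦ r)
  have h2 : ∀ c, C1X ν (Ψ c) := fun c => by
    refine ⟨hΨ c, fun d => ?_, (D.c1X_Ψ c).hasD⟩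
    exact XSmooth.congr (.sum fun i _ => .sum fun s _ => .bilin bilin_smul hν
      (ha d i c s).xSmooth ((hΨ s).dX i)) fun p hp => (V d).dD_Ψ c p hp
  refine ⟨h1, h2, D.c1X_Om.inverse hν ?_ (fun d => ?_) D.isUnit hR⟩
  · exact XSmooth.congr (.sum fun c _ => .bilin bilin_smulRight hν (hΨ c) (hΦ c))
      fun p hp => HasDerivAt.dX_one_eq (D.hasDerivAt p hp)
  · exact (C1X.conc bilin_smulRight' hν (ha d) h1 h2).xSmooth.congr fun p hp => (V d).dD_Om p hp

end Consequences

section Generator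

variable {H : Type*} [NormedAddCommGroup H] [NormedSpace ℂ H] {N : ℕ} {Y T : ℝ}
  [hY : Fact (0 < Y)] [hT : Fact (0 < T)]
  {Φ : Fin N → Pt → H} {Ψ : Fin N → Pt → H →L[ℂ] ℂ} {Om : Pt → H →L[ℂ] H}

/-- The generator inherits the regularity of its differential. -/
theorem c1X_of_generator {n' : Bool → ℕ} {a : ∀ d, Coeff (n' d) N}
    (ha : ∀ d i r c, C1X (Growth.free Y T) fun p => a d i p r c)
    (hΦ : ∀ c, C1X (Growth.free Y T) (Φ c)) (hΨ : ∀ c, C1X (Growth.free Y T) (Ψ c))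
    (hx : ∀ p ∈ region Y T,
      HasDerivAt (fun x => Om (x, p.2)) (∑ c, (Ψ c p).smulRight (Φ c p)) p.1)
    (hd : ∀ d, ∀ p ∈ region Y T,
      HasD Y T d Om (conc (fun v (l : H →L[ℂ] ℂ) => l.smulRight v) (a d) Φ Ψ p) p) :
    C1X (Growth.free Y T) Om := by
  have hfx : C1X (Growth.free Y T) fun p => ∑ c, (Ψ c p).smulRight (Φ c p) :=
    .sum fun c _ => .bilin bilin_smulRight (Growth.acts_free _) (hΨ c) (hΦ c)
  have hfd := fun d => C1X.conc (m := fun v (l : H →L[ℂ] ℂ) => l.smulRight v) bilin_smulRight'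
    (Growth.acts_free _) (ha d) hΦ hΨ
  have hc : ContinuousOn Om (region Y T) :=
    (contDiffOn_of_partials hx hd hfx.xSmooth.continuousOn
      fun d => (hfd d).xSmooth.continuousOn).continuousOn
  exact .of_hasD (.of_hasDerivAt hc (Growth.free_mem _) hx hfx.xSmooth)
    (fun d => (hfd d).xSmooth) hd

end Generator

/-! ### Complex conjugation and integral operators on `L²(ρ)` -/

section Realization

variable {n N : ℕ} {Y T : ℝ} [hY : Fact (0 < Y)] [hT : Fact (0 < T)]

/-- The equation `𝓛 ψ = 0` after the application of `A` to the entries of `ψ`. -/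
theorem dD_clm_of_evolution {E G : Type*} [NormedAddCommGroup E] [NormedSpace ℂ E]
    [NormedAddCommGroup G] [NormedSpace ℂ G] (A : E →L[ℂ] G) {d : Bool} {a : Coeff n N}
    {ψ : Pt → Fin N → E} (hψ : C1X (Growth.free Y T) ψ) {p : Pt} (hp : p ∈ region Y T)
    (h : dD Y T d ψ p - diffOp a ψ p = 0) (r : Fin N) :
    dD Y T d (fun q => A (ψ q r)) p
      = ∑ i : Fin (n + 1), ∑ c, a i p r c • dX (i : ℕ) (fun q => A (ψ q c)) p := by
  have h1 : dD Y T d (fun q => A (ψ q r)) p = A (dD Y T d ψ p r) := by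
    rw [hψ.dD_apply d r hp]
    exact HasD.dD_eq hp (((hψ.comp r).hasD d p hp).clm (A.restrictScalars ℝ))
  have h2 : ∀ (k : ℕ) (c : Fin N), dX k (fun q => A (ψ q c)) p = A (dX k ψ p c) := fun k c => by
    rw [dX_apply hψ.xSmooth c k hp]
    exact dX_clm (A.restrictScalars ℝ) (hψ.comp c).xSmooth k hp
  rw [h1, sub_eq_zero.1 h]
  simp only [diffOp, map_sum, map_smul, h2]

/-- The involution as a real-linear map. -/
noncomputable def starReal (E : Type*) [NormedAddCommGroup E] [NormedSpace ℂ E] [StarAddMonoid E]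
    [ContinuousStar E] : E →L[ℝ] E :=
  (starAddEquiv (R := E)).toAddMonoidHom.toRealLinearMap continuous_star

/-- The conjugate of `𝓛* φ = 0`, as an equation for the row `φ̄ᵀ`. -/
theorem dD_star_of_evolution {E : Type*} [NormedAddCommGroup E] [NormedSpace ℂ E]
    [StarAddMonoid E] [ContinuousStar E] [StarModule ℂ E] {d : Bool} {a : Coeff n N}
    (ha : ∀ i r c, C1X (Growth.free Y T) fun p => a i p r c)
    {φ : Pt → Fin N → E} (hφ : C1X (Growth.free Y T) φ) {p : Pt} (hp : p ∈ region Y T)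
    (h : -dD Y T d φ p - adjOp a φ p = 0) (c : Fin N) :
    dD Y T d (fun q => star (φ q c)) p = -∑ i : Fin (n + 1), (-1 : ℤ) ^ (i : ℕ) •
      dX (i : ℕ) (rowMul (a i) (fun r q => star (φ q r)) c) p := by
  have h1 : dD Y T d (fun q => star (φ q c)) p = star (dD Y T d φ p c) := by
    rw [hφ.dD_apply d c hp]
    exact HasD.dD_eq hp (((hφ.comp c).hasD d p hp).clm (starReal E))
  have h2 : dD Y T d φ p = -adjOp a φ p := by
    rw [← neg_eq_iff_eq_neg]; exact sub_eq_zero.1 h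
  have h3 : ∀ i : Fin (n + 1), XSmooth (Growth.free Y T)
      fun (q : Pt) (r : Fin N) => ∑ s, (a i q).conjTranspose r s • φ q s := fun i =>
    .pi fun r => .sum fun s _ => .bilin (f := fun q => star (a i q s r)) bilin_smul
      (Growth.acts_free _) ((ha i s r).xSmooth.clm Complex.conjCLE.toContinuousLinearMap)
      (hφ.comp s).xSmooth
  have h4 : ∀ i : Fin (n + 1), dX (i : ℕ) (rowMul (a i) (fun r q => star (φ q r)) c) p
      = star (dX (i : ℕ) (fun q r => ∑ s, (a i q).conjTranspose r s • φ q s) p c) := fun i => by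
    rw [dX_apply (h3 i) c _ hp]
    refine Eq.trans ?_ (dX_clm (starReal E) ((h3 i).comp c) i hp)
    congr 1
    ext1 q
    change _ = star (∑ s, (a i q).conjTranspose c s • φ q s)
    simp only [rowMul, star_sum, star_smul, Matrix.conjTranspose_apply, star_star]
  rw [h1, h2]
  simp only [adjOp, Pi.neg_apply, Finset.sum_apply, Pi.smul_apply, star_neg, star_sum, star_smul,
    star_pow, star_one, h4]
  congr 1
  refine Finset.sum_congr rfl fun i _ => ?_
  rw [← Int.cast_smul_eq_zsmul ℂ]
  push_cast
  rfl

variable {S : Type*} [MeasurableSpace S] {ρ : Measure S}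

theorem lp_star_add (u v : Lp ℂ 2 ρ) : star (u + v) = star u + star v := by
  refine Lp.ext ?_
  filter_upwards [Lp.coeFn_star (u + v), Lp.coeFn_star u, Lp.coeFn_star v, Lp.coeFn_add u v,
    Lp.coeFn_add (star u) (star v)] with s h1 h2 h3 h4 h5
  simp only [h1, h5, h2, h3, h4, Pi.star_apply, Pi.add_apply, star_add]

theorem lp_star_smul (c : ℂ) (u : Lp ℂ 2 ρ) : star (c • u) = star c • star u := by
  refine Lp.ext ?_
  filter_upwards [Lp.coeFn_star (c • u), Lp.coeFn_star u, Lp.coeFn_smul c u,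
    Lp.coeFn_smul (star c) (star u)] with s h1 h2 h3 h4
  simp only [h1, h2, h3, h4, Pi.star_apply, Pi.smul_apply, star_smul]

theorem lp_norm_star (u : Lp ℂ 2 ρ) : ‖star u‖ = ‖u‖ := by
  have h : ∀ᵐ s ∂ρ, ‖(star u : Lp ℂ 2 ρ) s‖ = ‖u s‖ := by
    filter_upwards [Lp.coeFn_star u] with s h1
    rw [h1, Pi.star_apply, norm_star]
  exact le_antisymm (Lp.norm_le_norm_of_ae_le (h.mono fun _ h => h.le))
    (Lp.norm_le_norm_of_ae_le (h.mono fun _ h => h.ge))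

/-- Complex conjugation is additive on `L²(ρ)`. -/
noncomputable instance : StarAddMonoid (Lp ℂ 2 ρ) where
  star_add := lp_star_add

instance : StarModule ℂ (Lp ℂ 2 ρ) where
  star_smul := lp_star_smul

instance : NormedStarGroup (Lp ℂ 2 ρ) where
  norm_star_le u := (lp_norm_star u).le

/-- The functional `row u` depends linearly on `u`: the two conjugations in its definition
cancel. -/
noncomputable def rowL (ρ : Measure S) : Lp ℂ 2 ρ →L[ℂ] (Lp ℂ 2 ρ →L[ℂ] ℂ) where
  toFun := row
  map_add' u v := by simp only [row, star_add, map_add]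
  map_smul' c u := by
    ext g
    simp [row, star_smul]
  cont := (innerSL ℂ).continuous.comp continuous_star

end Realization

section Kernels

variable {S : Type*} [MeasurableSpace S] {ρ : Measure S}
variable {n N : ℕ} {Y T : ℝ} [hY : Fact (0 < Y)] [hT : Fact (0 < T)]
variable {φ ψ : Pt → Fin N → Lp ℂ 2 ρ}

/-- The entries of the row `φ̄ᵀ`. -/
noncomputable def bra (φ : Pt → Fin N → Lp ℂ 2 ρ) (c : Fin N) (p : Pt) : Lp ℂ 2 ρ := star (φ p c)

/-- The entries of the column `ψ`, as functionals on `L²(ρ)`. -/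
noncomputable def ket (ψ : Pt → Fin N → Lp ℂ 2 ρ) (c : Fin N) (p : Pt) : Lp ℂ 2 ρ →L[ℂ] ℂ :=
  row (ψ p c)

omit hY hT in
theorem XSmooth.bra {κ : Growth Y T} (h : XSmooth κ φ) (c : Fin N) : XSmooth κ (bra φ c) :=
  (h.comp c).clm (starReal (Lp ℂ 2 ρ))

omit hY hT in
theorem XSmooth.ket {κ : Growth Y T} (h : XSmooth κ ψ) (c : Fin N) : XSmooth κ (ket ψ c) :=
  (h.comp c).clm ((rowL ρ).restrictScalars ℝ)

theorem C1X.bra {κ : Growth Y T} (h : C1X κ φ) (c : Fin N) : C1X κ (bra φ c) :=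
  (h.comp c).clm (starReal (Lp ℂ 2 ρ))

theorem C1X.ket {κ : Growth Y T} (h : C1X κ ψ) (c : Fin N) : C1X κ (ket ψ c) :=
  (h.comp c).clm ((rowL ρ).restrictScalars ℝ)

theorem concomitant_eq_conc {E F : Type*} [NormedAddCommGroup E] [NormedSpace ℝ E]
    [AddCommGroup F] (B : Lp ℂ 2 ρ → E → F) {a : Coeff n N} (ha : SmoothCoeff Y T a)
    (hφ : C1X (Growth.free Y T) φ) {f : Pt → Fin N → E} (hf : C1X (Growth.free Y T) f)
    {p : Pt} (hp : p ∈ region Y T) :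
    concomitant B a φ f p = conc B a (bra φ) (fun c q => f q c) p := by
  have h : ∀ i : Fin (n + 1), XSmooth (Growth.free Y T)
      fun (q : Pt) (c : Fin N) => rowMul (a i) (bra φ) c q := fun i =>
    .pi fun c => (C1X.rowMul (Growth.acts_free _) (fun r c => (ha i r c).c1X) hφ.bra c).xSmooth
  refine Finset.sum_congr rfl fun i _ => Finset.sum_congr rfl fun k _ => ?_
  congr 1
  refine Finset.sum_congr rfl fun c _ => ?_
  rw [dX_apply hf.xSmooth c _ hp]
  exact congrArg (fun v => B v _) (dX_apply (h i) c k hp)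

theorem concomitant_tensor_eq_conc {a : Coeff n N} (ha : SmoothCoeff Y T a)
    (hφ : C1X (Growth.free Y T) φ) (hψ : C1X (Growth.free Y T) ψ)
    {p : Pt} (hp : p ∈ region Y T) :
    concomitant tensor a φ ψ p
      = conc (fun (v : Lp ℂ 2 ρ) (l : Lp ℂ 2 ρ →L[ℂ] ℂ) => l.smulRight v) a (bra φ) (ket ψ) p := by
  rw [concomitant_eq_conc tensor ha hφ hψ hp]
  refine Finset.sum_congr rfl fun i _ => Finset.sum_congr rfl fun k _ => ?_
  congr 1
  refine Finset.sum_congr rfl fun c _ => ?_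
  exact congrArg (fun l : Lp ℂ 2 ρ →L[ℂ] ℂ => l.smulRight _)
    (dX_clm ((rowL ρ).restrictScalars ℝ) (hψ.comp c).xSmooth _ hp).symm

end Kernels

/-! ### Dressing data from a transmutation generator -/

section Main

variable {S : Type*} [MeasurableSpace S] {ρ : Measure S}
  {nL nM N : ℕ} {Y T : ℝ} [hY : Fact (0 < Y)] [hT : Fact (0 < T)]
  {a : Coeff nL N} {b : Coeff nM N} {φ ψ : Pt → Fin N → Lp ℂ 2 ρ}
  {Om : Pt → Lp ℂ 2 ρ →L[ℂ] Lp ℂ 2 ρ}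

/-- The two differential expressions, indexed by the direction of their evolution. -/
def pair (a : Coeff nL N) (b : Coeff nM N) : ∀ d : Bool, Coeff (bif d then nM else nL) N
  | false => a
  | true => b

/-- An invertible transmutation generator on `L²(ρ)` realizes the abstract dressing data. -/
theorem dressing_of_isGenerator (ha : SmoothCoeff Y T a) (hb : SmoothCoeff Y T b)
    (hφ : C1Smooth Y T φ) (hψ : C1Smooth Y T ψ)
    (hLψ : ∀ p ∈ region Y T, opY Y a ψ p = 0) (hMψ : ∀ p ∈ region Y T, opT T b ψ p = 0)
    (hLφ : ∀ p ∈ region Y T, adjY Y a φ p = 0) (hMφ : ∀ p ∈ region Y T, adjT T b φ p = 0)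
    (hOm : IsGenerator Y T a b φ ψ Om) (hinv : ∀ p ∈ region Y T, IsUnit (Om p)) :
    Dressing Y T (bra φ) (ket ψ) Om ∧
      ∀ d, Evolves Y T d (pair a b d) (bra φ) (ket ψ) Om := by
  have hc : ∀ d i r c, C1X (Growth.free Y T) fun p => pair a b d i p r c := fun d i r c => by
    cases d
    exacts [(ha i r c).c1X, (hb i r c).c1X]
  have hφ' : C1X (Growth.free Y T) φ := hφ.c1X
  have hψ' : C1X (Growth.free Y T) ψ := hψ.c1X
  have hx : ∀ p ∈ region Y T,
      HasDerivAt (fun x => Om (x, p.2)) (∑ c, (ket ψ c p).smulRight (bra φ c p)) p.1 :=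
    fun p hp => (hOm p hp).1
  have hd : ∀ d, ∀ p ∈ region Y T, HasD Y T d Om (conc (fun (v : Lp ℂ 2 ρ)
      (l : Lp ℂ 2 ρ →L[ℂ] ℂ) => l.smulRight v) (pair a b d) (bra φ) (ket ψ) p) p := by
    intro d p hp
    cases d
    · change HasD Y T false Om (conc _ a _ _ p) p
      rw [← concomitant_tensor_eq_conc ha hφ' hψ' hp]
      exact (hOm p hp).2.1
    · change HasD Y T true Om (conc _ b _ _ p) p
      rw [← concomitant_tensor_eq_conc hb hφ' hψ' hp]
      exact (hOm p hp).2.2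
  refine ⟨⟨hφ'.bra, hψ'.ket, c1X_of_generator hc hφ'.bra hψ'.ket hx hd, hinv, hx⟩, fun d =>
    ⟨hc d, fun r p hp => ?_, fun c p hp => ?_, fun p hp => (hd d p hp).dD_eq hp⟩⟩
  · cases d
    exacts [dD_clm_of_evolution (rowL ρ) (d := false) (a := a) hψ' hp (hLψ p hp) r,
      dD_clm_of_evolution (rowL ρ) (d := true) (a := b) hψ' hp (hMψ p hp) r]
  · cases d
    exacts [dD_star_of_evolution (d := false) (a := a) (hc false) hφ' hp (hLφ p hp) c,
      dD_star_of_evolution (d := true) (a := b) (hc true) hφ' hp (hMφ p hp) c]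

/-- The factors `Ω₀` and `Ω₀⁻¹` in the Delsarte–Darboux operator cancel. -/
theorem delsarte_eq_dress {P₀ : Pt} (h : IsUnit (Om P₀)) :
    delsarte φ ψ Om P₀ = dress (bra φ) (ket ψ) Om P₀.1 := by
  funext f p r
  have h1 : ∀ v, Om P₀ (Ring.inverse (Om P₀) v) = v := fun v => by
    have := congrArg (fun A : Lp ℂ 2 ρ →L[ℂ] Lp ℂ 2 ρ => A v) (Ring.mul_inverse_cancel _ h)
    exact this
  simp only [delsarte, psiTilde, ContinuousLinearMap.comp_apply, h1]
  rfl

/-- Schwartz coefficients stay so if the data grow moderately: the direct hypotheses on `φ`, `ψ` and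
`Ω⁻¹` concern only their `x`-derivatives, and the evolution equations extend them to `y` and `t`. -/
theorem schwartzCoeff_dressCoeff (D : Dressing Y T (bra φ) (ket ψ) Om)
    (V : ∀ d, Evolves Y T d (pair a b d) (bra φ) (ket ψ) Om)
    (ha : SchwartzCoeff Y T a) (hb : SchwartzCoeff Y T b)
    (hφ : C1Smooth Y T φ) (hψ : C1Smooth Y T ψ)
    (hmφ : ModerateGrowth Y T φ) (hmψ : ModerateGrowth Y T ψ)
    (hmR : ModerateGrowth Y T fun p => Ring.inverse (Om p)) (d : Bool) :
    SchwartzCoeff Y T (dressCoeff (bra φ) (ket ψ) Om (pair a b d)) := by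
  have hc : ∀ d i r c, C1X (Growth.rapid Y T) fun p => pair a b d i p r c := fun d i r c => by
    cases d
    exacts [(ha i r c).c1X, (hb i r c).c1X]
  have hφ' : C1X (Growth.free Y T) φ := hφ.c1X
  have hψ' : C1X (Growth.free Y T) ψ := hψ.c1X
  have hR : (Growth.moderate Y T).mem fun p => ‖Ring.inverse (Om p)‖ := by
    obtain ⟨C, m, h⟩ := hmR 0
    refine ⟨C, m, fun p hp => ?_⟩
    rw [abs_norm]
    simpa only [dX_zero] using h p hp
  obtain ⟨h1, h2, h3⟩ := c1X_of_evolves Growth.moderate_acts_moderate D V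
    (fun d i r c => (hc d i r c).mono fun _ => Growth.moderate_of_rapid)
    (hφ'.xSmooth.of_moderateGrowth hmφ).bra (hψ'.xSmooth.of_moderateGrowth hmψ).ket hR
  exact fun i r c => c1Schwartz_of_c1X (.dressCoeff Growth.moderate_acts_moderate
    Growth.moderate_acts_rapid Growth.moderate_const h1 h2 h3 (hc d) i r c)

theorem intertwines_lagrangeDomain (D : Dressing Y T (bra φ) (ket ψ) Om)
    {n : ℕ} {d : Bool} {a : Coeff n N} (V : Evolves Y T d a (bra φ) (ket ψ) Om)
    (ha : SmoothCoeff Y T a) (hφ : C1Smooth Y T φ) (x₀ : ℝ) :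
    Intertwines Y T (dress (bra φ) (ket ψ) Om x₀) (opD Y T d a)
      (opD Y T d (dressCoeff (bra φ) (ket ψ) Om a)) (lagrangeDomain Y T a φ x₀) :=
  fun f hf p hp => by
    have hφ' : C1X (Growth.free Y T) φ := hφ.c1X
    have hf' : C1X (Growth.free Y T) f := hf.1.c1X
    ext1 r
    refine congrFun (D.dress_opD V x₀ hf' (fun q hq hqx => ?_) hp) r
    rw [← concomitant_eq_conc (fun (v : Lp ℂ 2 ρ) (z : ℂ) => z • v) ha hφ' hf' hq]
    exact hf.2 q hq hqx

end Main

end DelsarteDarboux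

open DelsarteDarboux in
theorem proposition3 {N nL nM : ℕ} {Y T : ℝ} (hY : 0 < Y) (hT : 0 < T)
    -- a compatible commuting pair `𝓛 = ∂/∂y - L`, `𝓜 = ∂/∂t - M`
    (a : Coeff nL N) (b : Coeff nM N) (ha : SmoothCoeff Y T a) (hb : SmoothCoeff Y T b)
    (hcomm : Commuting Y T a b)
    -- families of solutions over the spectral measure space
    {S : Type*} [MeasurableSpace S] (ρ : MeasureTheory.Measure S)
    [MeasureTheory.IsFiniteMeasure ρ]
    (φ ψ : Pt → Fin N → MeasureTheory.Lp ℂ 2 ρ)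
    (hφ : C1Smooth Y T φ) (hψ : C1Smooth Y T ψ)
    (hLψ : ∀ p ∈ region Y T, opY Y a ψ p = 0) (hMψ : ∀ p ∈ region Y T, opT T b ψ p = 0)
    (hLφ : ∀ p ∈ region Y T, adjY Y a φ p = 0) (hMφ : ∀ p ∈ region Y T, adjT T b φ p = 0)
    -- an invertible transmutation generator, and the base point
    (Om : Pt → MeasureTheory.Lp ℂ 2 ρ →L[ℂ] MeasureTheory.Lp ℂ 2 ρ)
    (hOm : IsGenerator Y T a b φ ψ Om) (hinv : ∀ p ∈ region Y T, IsUnit (Om p))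
    (P₀ : Pt) (hP₀ : P₀ ∈ region Y T) :
    Set.BijOn (delsarte φ ψ Om P₀) (flatFunctions Y T N P₀.1) (flatFunctions Y T N P₀.1) ∧
    ∃ (a' : Coeff nL N) (b' : Coeff nM N),
      -- the dressed operators are differential operators with coefficients of the same class
      SmoothCoeff Y T a' ∧ SmoothCoeff Y T b' ∧
      Intertwines Y T (delsarte φ ψ Om P₀) (opY Y a) (opY Y a') (flatFunctions Y T N P₀.1) ∧
      Intertwines Y T (delsarte φ ψ Om P₀) (opT T b) (opT T b') (flatFunctions Y T N P₀.1) ∧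
      Intertwines Y T (delsarte φ ψ Om P₀) (opY Y a) (opY Y a') (lagrangeDomain Y T a φ P₀.1) ∧
      Intertwines Y T (delsarte φ ψ Om P₀) (opT T b) (opT T b') (lagrangeDomain Y T b φ P₀.1) ∧
      -- their coefficients are determined by the dressing
      (∀ a'' : Coeff nL N, SmoothCoeff Y T a'' →
        Intertwines Y T (delsarte φ ψ Om P₀) (opY Y a) (opY Y a'') (flatFunctions Y T N P₀.1) →
        ∀ i, ∀ p ∈ region Y T, a'' i p = a' i p) ∧
      (∀ b'' : Coeff nM N, SmoothCoeff Y T b'' →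
        Intertwines Y T (delsarte φ ψ Om P₀) (opT T b) (opT T b'') (flatFunctions Y T N P₀.1) →
        ∀ j, ∀ p ∈ region Y T, b'' j p = b' j p) ∧
      -- the orders are preserved
      (∀ k, HasOrder Y T a k ↔ HasOrder Y T a' k) ∧
      (∀ k, HasOrder Y T b k ↔ HasOrder Y T b' k) ∧
      -- the dressed operators commute
      Commuting Y T a' b' ∧
      -- old and new coefficients solve the same nonlinear system
      ZakharovShabat Y T a b ∧ ZakharovShabat Y T a' b' ∧
      -- Schwartz coefficients stay so if the data grow moderately
      (SchwartzCoeff Y T a → SchwartzCoeff Y T b →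
        ModerateGrowth Y T φ → ModerateGrowth Y T ψ →
        ModerateGrowth Y T (fun p => Ring.inverse (Om p)) →
        SchwartzCoeff Y T a' ∧ SchwartzCoeff Y T b') := by

  have : Fact (0 < Y) := ⟨hY⟩
  have : Fact (0 < T) := ⟨hT⟩
  obtain ⟨D, V⟩ := dressing_of_isGenerator ha hb hφ hψ hLψ hMψ hLφ hMφ hOm hinv
  have Va : Evolves Y T false a (bra φ) (ket ψ) Om := V false
  have Vb : Evolves Y T true b (bra φ) (ket ψ) Om := V true
  have ha' := fun i r c => (ha i r c).c1X
  have hb' := fun i r c => (hb i r c).c1X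
  have hda := D.c1X_dressCoeff Va
  have hdb := D.c1X_dressCoeff Vb
  rw [delsarte_eq_dress (hinv P₀ hP₀)]
  exact ⟨D.bijOn P₀.1, dressCoeff (bra φ) (ket ψ) Om a, dressCoeff (bra φ) (ket ψ) Om b,
    fun i r c => (hda i r c).c1Smooth, fun i r c => (hdb i r c).c1Smooth,
    D.intertwines_flat Va P₀.1, D.intertwines_flat Vb P₀.1,
    intertwines_lagrangeDomain D Va ha hφ P₀.1, intertwines_lagrangeDomain D Vb hb hφ P₀.1,
    fun a'' ha'' h i p hp => D.coeff_unique Va P₀.1 (fun i r c => (ha'' i r c).c1X) h i hp,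
    fun b'' hb'' h i p hp => D.coeff_unique Vb P₀.1 (fun i r c => (hb'' i r c).c1X) h i hp,
    hasOrder_dressCoeff D, hasOrder_dressCoeff D,
    commuting_of_zsCoeff hda hdb fun k p hp => D.zsCoeff_dressCoeff Va Vb P₀.1 hcomm k hp,
    fun k p hp => zsCoeff_of_commuting ha' hb' hcomm k hp,
    fun k p hp => D.zsCoeff_dressCoeff Va Vb P₀.1 hcomm k hp,
    fun hSa hSb hmφ hmψ hmR => ⟨
      schwartzCoeff_dressCoeff D V hSa hSb hφ hψ hmφ hmψ hmR false,
      schwartzCoeff_dressCoeff D V hSa hSb hφ hψ hmφ hmψ hmR true⟩⟩
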